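/- **Setting.** Let $k_1,k_2,k_3\in\mathbb R$. On $\mathbb R[x_1,x_2,x_3]$ let $T_j f=\partial f/\partial x_j+k_j\,(f-f|_{x_j\mapsto -x_j})/x_j$ ($j=1,2,3$) be the Dunkl operators, let $e_1,e_2,e_3$ act on $\mathbb C^2$ by the Pauli matrices $\sigma_1=\begin{pmatrix}0&1\\1&0\end{pmatrix}$, $\sigma_2=\begin{pmatrix}0&-\mathrm i\\ \mathrm i&0\end{pmatrix}$, $\sigma_3=\begin{pmatrix}1&0\\0&-1\end{pmatrix}$, let $\mathbf D=\sum_j e_j\otimes T_j$, and for an integer $n\ge 0$ let $\mathscr M_n=\ker\bigl(\mathbf D|_{\mathbb C^2\otimes_{\mathbb R}\mathbb R[x_1,x_2,x_3]_n}\bigr)$, where $R_n$ denotes the homogeneous polynomials of degree $n$ in $R$. Put $t_j=-2k_j$ if $2k_j$ is an odd negative integer and $t_j=\infty$ otherwise. The universal Bannai–Ito algebra $\mathfrak{BI}$ is the unital associative $\mathbb C$-algebra generated by $X,Y,Z$ subject to the relations that $\kappa=XY+YX-Z$, $\lambda=YZ+ZY-X$, $\mu=ZX+XZ-Y$ commute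 with $X,Y,Z$. It acts on $\mathscr M_n$ by $$(Xf)(x_1,x_2,x_3)=\bigl(\mathrm i\,e_1\otimes(x_3T_2-x_2T_3)\bigr)f(x_1,-x_2,-x_3)+\tfrac12 f(x_1,-x_2,-x_3)+k_2f(x_1,x_2,-x_3)+k_3f(x_1,-x_2,x_3),$$ and $Y$, $Z$ act by the formulas obtained from this one by the cyclic permutations $1\to2\to3\to1$ and $1\to3\to2\to1$ of the indices. The subspaces $$\mathscr M_n(x_j)=\mathscr M_n\cap\bigoplus_{i=t_j}^n\mathbb C^2\otimes\bigl(x_j^i\cdot\mathbb R[x_l: l\ne j]_{n-i}\bigr)$$ (zero if $n<t_j$) are $\mathfrak{BI}$-submodules. For $a,b,c\in\mathbb C$ and an integer $d\geq 0$ put $\theta_i=\frac{(-1)^i(2a-d+2i)}2$ and $\theta_i^*=\frac{(-1)^i(2b-d+2i)}2$. For odd $d$ (resp. even $d$) let $E_d(a,b,c)$ (resp. $O_d(a,b,c)$) be the $(d+1)$-dimensional $\mathfrak{BI}$-module with a basis $v_0,\dots,v_d$ such that $Xv_i=\theta_iv_i+v_{i+1}$ and $Yv_i=\theta_i^*v_i+\varphi_iv_{i-1}$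 (with $v_{-1}=v_{d+1}=0$), where - on $E_d(a,b,c)$: $\kappa$ acts as the scalar $c^2-a^2-b^2+\frac{(d+1)^2}4$, and $\varphi_i=i(d-i+1)$ for even $i$, $\varphi_i=c^2-\frac{(2a+2b-d+2i-1)^2}4$ for odd $i$; - on $O_d(a,b,c)$: $\kappa$ acts as the scalar $2ab-c(d+1)$, and $\varphi_i=\frac{i(d+1-2i-2a-2b-2c)}2$ for even $i$, $\varphi_i=\frac{(i-d-1)(d+1-2i-2a-2b+2c)}2$ for odd $i$. Let $\sigma\in\mathfrak S_3$ act on $\mathfrak{BI}$ by permuting $(X_1,X_2,X_3)=(X,Y,Z)$, $X_j\mapsto X_{\sigma(j)}$; let $(\epsilon_1,\epsilon_2)\in\{\pm1\}^2$ act by $X\mapsto\epsilon_1X$, $Y\mapsto\epsilon_2Y$, $Z\mapsto\epsilon_1\epsilon_2Z$; and let $(\epsilon,\sigma)$ act as $\epsilon\circ\sigma$. For a $\mathfrak{BI}$-module $V$ and an automorphism $g$ of $\mathfrak{BI}$, let $V^g$ be $V$ with $u\in\mathfrak{BI}$ acting as $g(u)$. **Theorem.** Let $n$ be an odd positive integer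 and $s=k_1+k_2+k_3+n+1$. **(A)** Suppose $t_1+t_3\le n<t_2$. Then, as $\mathfrak{BI}$-modules: 1. $\mathscr M_n(x_1)\cap\mathscr M_n(x_3)$ is isomorphic to a direct sum of two copies of $E_{n-t_1-t_3}\bigl(k_1+k_2+\frac{n+1}2,\,-k_2-k_3-\frac{n+1}2,\,\frac{n+1}2\bigr)^{((-1,-1),(2\,3))}$. 2. $\mathscr M_n(x_1)/(\mathscr M_n(x_1)\cap\mathscr M_n(x_3))$ and $\mathscr M_n/\mathscr M_n(x_3)$ are each isomorphic to a direct sum of two copies of $O_{t_3-1}(k_2,-s,k_1)^{(2\,3)}$. 3. $\mathscr M_n(x_3)/(\mathscr M_n(x_1)\cap\mathscr M_n(x_3))$ and $\mathscr M_n/\mathscr M_n(x_1)$ are each isomorphic to a direct sum of two copies of $O_{t_1-1}(k_2,-s,k_3)^{(1\,2\,3)}$. If moreover $k_2\ge0$, then the three modules $E^{(\cdot)}$, $O^{(\cdot)}$, $O^{(\cdot)}$ in 1–3 are irreducible and are isomorphic, respectively, to $E_{n-t_1-t_3}\bigl(k_1+k_2+\frac{n+1}2,\frac{n+1}2,k_2+k_3+\frac{n+1}2\bigr)^{(-1,1)}$,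 $O_{t_3-1}(k_2,k_1,-s)$ and $O_{t_1-1}(-s,k_3,k_2)$. **(B)** Suppose $t_1+t_2\le n<t_3$. Then: 1. $\mathscr M_n(x_1)\cap\mathscr M_n(x_2)$ is isomorphic to a direct sum of two copies of $E_{n-t_1-t_2}\bigl(k_2+k_3+\frac{n+1}2,\,-k_1-k_3-\frac{n+1}2,\,\frac{n+1}2\bigr)^{((-1,-1),(1\,2))}$. 2. $\mathscr M_n(x_2)/(\mathscr M_n(x_1)\cap\mathscr M_n(x_2))$ and $\mathscr M_n/\mathscr M_n(x_1)$ are each isomorphic to a direct sum of two copies of $O_{t_1-1}(k_3,-s,k_2)^{(1\,2)}$. 3. $\mathscr M_n(x_1)/(\mathscr M_n(x_1)\cap\mathscr M_n(x_2))$ and $\mathscr M_n/\mathscr M_n(x_2)$ are each isomorphic to a direct sum of two copies of $O_{t_2-1}(k_3,-s,k_1)$. If moreover $k_3\ge0$, then the three modules in 1–3 are irreducible, and the first two are isomorphic, respectively, to $E_{n-t_1-t_2}\bigl(k_1+k_3+\frac{n+1}2,k_2+k_3+\frac{n+1}2,\frac{n+1}2\bigr)^{(-1,-1)}$ and $O_{t_1-1}(-s,k_3,k_2)$.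 **(C)** Suppose $t_2+t_3\le n<t_1$. Then: 1. $\mathscr M_n(x_2)\cap\mathscr M_n(x_3)$ is isomorphic to a direct sum of two copies of $E_{n-t_2-t_3}\bigl(k_1+k_3+\frac{n+1}2,\,-k_1-k_2-\frac{n+1}2,\,\frac{n+1}2\bigr)^{((-1,-1),(1\,3))}$. 2. $\mathscr M_n(x_3)/(\mathscr M_n(x_2)\cap\mathscr M_n(x_3))$ and $\mathscr M_n/\mathscr M_n(x_2)$ are each isomorphic to a direct sum of two copies of $O_{t_2-1}(k_1,-s,k_3)^{(1\,3)}$. 3. $\mathscr M_n(x_2)/(\mathscr M_n(x_2)\cap\mathscr M_n(x_3))$ and $\mathscr M_n/\mathscr M_n(x_3)$ are each isomorphic to a direct sum of two copies of $O_{t_3-1}(k_1,-s,k_2)^{(1\,3\,2)}$. If moreover $k_1\ge0$, then the three modules in 1–3 are irreducible and are isomorphic, respectively, to $E_{n-t_2-t_3}\bigl(\frac{n+1}2,k_1+k_2+\frac{n+1}2,k_1+k_3+\frac{n+1}2\bigr)^{(1,-1)}$, $O_{t_2-1}(k_3,-s,k_1)$ and $O_{t_3-1}(k_2,k_1,-s)$.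 -/

import Mathlib

open scoped TensorProduct

namespace BannaiIto

/-- The defining relations of the universal Bannai-Ito algebra. The generators `X`, `Y`, `Z` are
indexed by `0`, `1`, `2 : Fin 3`; for `i = 0, 1, 2` the element `{X_i, X_(i+1)} - X_(i+2)` (indices mod
`3`), that is `{X,Y} - Z`, `{Y,Z} - X`, `{Z,X} - Y`, commutes with each generator. -/
inductive Rel : FreeAlgebra ℂ (Fin 3) → FreeAlgebra ℂ (Fin 3) → Prop
  | comm (i j : Fin 3) : Rel
      ((FreeAlgebra.ι ℂ i * FreeAlgebra.ι ℂ (i + 1) + FreeAlgebra.ι ℂ (i + 1) * FreeAlgebra.ι ℂ i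
        - FreeAlgebra.ι ℂ (i + 2)) * FreeAlgebra.ι ℂ j)
      (FreeAlgebra.ι ℂ j * (FreeAlgebra.ι ℂ i * FreeAlgebra.ι ℂ (i + 1)
        + FreeAlgebra.ι ℂ (i + 1) * FreeAlgebra.ι ℂ i - FreeAlgebra.ι ℂ (i + 2)))

/-- The universal Bannai-Ito algebra over `ℂ`. -/
def BI : Type := RingQuot Rel

noncomputable instance : Ring BI := inferInstanceAs (Ring (RingQuot Rel))

noncomputable instance : Algebra ℂ BI := inferInstanceAs (Algebra ℂ (RingQuot Rel))

/-- The quotient map from the free algebra. -/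
noncomputable def BI.mk : FreeAlgebra ℂ (Fin 3) →ₐ[ℂ] BI := RingQuot.mkAlgHom ℂ Rel

/-- The generators `X = gen 0`, `Y = gen 1`, `Z = gen 2`. -/
noncomputable def BI.gen (j : Fin 3) : BI := BI.mk (FreeAlgebra.ι ℂ j)

theorem BI.gen_rel (i j : Fin 3) :
    Commute (BI.gen i * BI.gen (i + 1) + BI.gen (i + 1) * BI.gen i - BI.gen (i + 2))
      (BI.gen j) := by
  have h : BI.mk _ = BI.mk _ := RingQuot.mkAlgHom_rel ℂ (Rel.comm i j)
  simp only [map_mul, map_add, map_sub] at h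
  exact h

/-- The universal property of `BI`. -/
noncomputable def BI.lift {A : Type*} [Ring A] [Algebra ℂ A] (x : Fin 3 → A)
    (h : ∀ i j, Commute (x i * x (i + 1) + x (i + 1) * x i - x (i + 2)) (x j)) : BI →ₐ[ℂ] A :=
  RingQuot.liftAlgHom ℂ ⟨FreeAlgebra.lift ℂ x, by
    rintro _ _ ⟨i, j⟩
    simpa [Commute, SemiconjBy] using h i j⟩

@[simp] theorem BI.lift_gen {A : Type*} [Ring A] [Algebra ℂ A] (x : Fin 3 → A)
    (h : ∀ i j, Commute (x i * x (i + 1) + x (i + 1) * x i - x (i + 2)) (x j)) (j : Fin 3) :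
    BI.lift x h (BI.gen j) = x j := by
  have := RingQuot.liftAlgHom_mkAlgHom_apply ℂ (FreeAlgebra.lift ℂ x) (s := Rel) (by
    rintro _ _ ⟨i, j⟩
    simpa [Commute, SemiconjBy] using h i j) (FreeAlgebra.ι ℂ j)
  exact this.trans (by simp)

theorem BI.hom_ext {A : Type*} [Ring A] [Algebra ℂ A] {f g : BI →ₐ[ℂ] A}
    (h : ∀ j, f (BI.gen j) = g (BI.gen j)) : f = g := by
  apply RingQuot.ringQuot_ext'
  ext j
  exact h j

theorem BI.gen_rel' (a b c j : Fin 3) (hab : a ≠ b) (hbc : b ≠ c) (hac : a ≠ c) :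
    Commute (BI.gen a * BI.gen b + BI.gen b * BI.gen a - BI.gen c) (BI.gen j) := by
  have key : ∀ a b c : Fin 3, a ≠ b → b ≠ c → a ≠ c →
      (b = a + 1 ∧ c = a + 2) ∨ (a = b + 1 ∧ c = b + 2) := by decide
  rcases key a b c hab hbc hac with ⟨rfl, rfl⟩ | ⟨rfl, rfl⟩
  · exact BI.gen_rel a j
  · rw [add_comm]; exact BI.gen_rel b j

/-- The endomorphism sending the `j`-th generator to the `σ j`-th one. -/
noncomputable def BI.permHom (σ : Equiv.Perm (Fin 3)) : BI →ₐ[ℂ] BI :=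
  BI.lift (fun j => BI.gen (σ j)) fun i j =>
    BI.gen_rel' _ _ _ _ (by simp) (by simp) (by simp)

/-- The action of `𝔖₃` on `BI`: the automorphism sending the `j`-th generator to the `σ j`-th
one. So `(1 2)` exchanges `X` and `Y`, and `(2 3)` exchanges `Y` and `Z`. -/
noncomputable def BI.permAut (σ : Equiv.Perm (Fin 3)) : BI ≃ₐ[ℂ] BI :=
  AlgEquiv.ofAlgHom (BI.permHom σ) (BI.permHom σ⁻¹)
    (BI.hom_ext fun j => by simp [BI.permHom])
    (BI.hom_ext fun j => by simp [BI.permHom])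

/-- The signs by which `ε ∈ {±1}²` acts on `X`, `Y`, `Z`: `(1,-1)` fixes `X` and negates `Y`, `Z`,
and `(-1,1)` fixes `Y` and negates `X`, `Z`. -/
def sgn (ε : ℤˣ × ℤˣ) : Fin 3 → ℤˣ := ![ε.1, ε.2, ε.1 * ε.2]

theorem sgn_mul (ε : ℤˣ × ℤˣ) (i : Fin 3) :
    ((sgn ε i : ℤ) : ℂ) * ((sgn ε (i + 1) : ℤ) : ℂ) = ((sgn ε (i + 2) : ℤ) : ℂ) := by
  obtain ⟨a, b⟩ := ε
  rcases Int.units_eq_one_or a with rfl | rfl <;> rcases Int.units_eq_one_or b with rfl | rfl <;>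
    fin_cases i <;> simp [sgn]

/-- The endomorphism multiplying the generators by the signs of `ε`. -/
noncomputable def BI.signHom (ε : ℤˣ × ℤˣ) : BI →ₐ[ℂ] BI :=
  BI.lift (fun j => ((sgn ε j : ℤ) : ℂ) • BI.gen j) fun i j => by
    have h : ((sgn ε i : ℤ) : ℂ) • BI.gen i * ((sgn ε (i + 1) : ℤ) : ℂ) • BI.gen (i + 1)
        + ((sgn ε (i + 1) : ℤ) : ℂ) • BI.gen (i + 1) * ((sgn ε i : ℤ) : ℂ) • BI.gen i
        - ((sgn ε (i + 2) : ℤ) : ℂ) • BI.gen (i + 2)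
        = ((sgn ε (i + 2) : ℤ) : ℂ) • (BI.gen i * BI.gen (i + 1) + BI.gen (i + 1) * BI.gen i
          - BI.gen (i + 2)) := by
      rw [← sgn_mul]
      simp only [smul_mul_smul_comm]
      module
    rw [h]
    exact ((BI.gen_rel i j).smul_left _).smul_right _

theorem BI.signHom_comp (ε : ℤˣ × ℤˣ) :
    (BI.signHom ε).comp (BI.signHom ε) = AlgHom.id ℂ BI :=
  BI.hom_ext fun j => by
    rcases Int.units_eq_one_or (sgn ε j) with h | h <;> simp [BI.signHom, h]

/-- The action of `{±1}²` on `BI`. -/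
noncomputable def BI.signAut (ε : ℤˣ × ℤˣ) : BI ≃ₐ[ℂ] BI :=
  AlgEquiv.ofAlgHom (BI.signHom ε) (BI.signHom ε) (BI.signHom_comp ε) (BI.signHom_comp ε)

/-- The action on `BI` of the element `(ε, σ)` of `{±1}² ⋊ 𝔖₃`: first `σ`, then `ε`. -/
noncomputable def BI.aut (ε : ℤˣ × ℤˣ) (σ : Equiv.Perm (Fin 3)) : BI ≃ₐ[ℂ] BI :=
  (BI.permAut σ).trans (BI.signAut ε)

theorem BI.aut_gen (ε : ℤˣ × ℤˣ) (σ : Equiv.Perm (Fin 3)) (j : Fin 3) :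
    BI.aut ε σ (BI.gen j) = ((sgn ε (σ j) : ℤ) : ℂ) • BI.gen (σ j) := by
  simp [BI.aut, BI.permAut, BI.signAut, BI.permHom, BI.signHom]

/-- The twist `V^φ` of a `BI`-module by an automorphism `φ`: the element `u` acts as `φ u`. -/
def Twist (_φ : BI ≃ₐ[ℂ] BI) (V : Type*) : Type _ := V

instance (φ : BI ≃ₐ[ℂ] BI) (V : Type*) [h : AddCommGroup V] : AddCommGroup (Twist φ V) := h

noncomputable instance (φ : BI ≃ₐ[ℂ] BI) (V : Type*) [AddCommGroup V] [h : Module BI V] :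
    Module BI (Twist φ V) :=
  letI : Module BI V := h
  Module.compHom V ((φ : BI →ₐ[ℂ] BI) : BI →+* BI)

/-! ### The modules `E_d(a,b,c)` and `O_d(a,b,c)` -/

/-- The lower bidiagonal matrix with diagonal `θ_0, …, θ_d` and subdiagonal entries `1`. -/
def matX (d : ℕ) (θ : ℕ → ℂ) : Matrix (Fin (d + 1)) (Fin (d + 1)) ℂ :=
  Matrix.of fun i j => if i = j then θ i else if (i : ℕ) = j + 1 then 1 else 0

/-- The upper bidiagonal matrix with diagonal `θ_0, …, θ_d` and superdiagonal `φ_1, …, φ_d`. -/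
def matY (d : ℕ) (θ φ : ℕ → ℂ) : Matrix (Fin (d + 1)) (Fin (d + 1)) ℂ :=
  Matrix.of fun i j => if i = j then θ i else if (j : ℕ) = i + 1 then φ j else 0

/-- The matrix of `Z = XY + YX - κ`. -/
def matZ (d : ℕ) (θ θs φ : ℕ → ℂ) (κ : ℂ) : Matrix (Fin (d + 1)) (Fin (d + 1)) ℂ :=
  matX d θ * matY d θs φ + matY d θs φ * matX d θ - κ • 1

/-- `θ_i = (-1)^i (2a - d + 2i) / 2`. -/
noncomputable def theta (d : ℕ) (a : ℂ) (i : ℕ) : ℂ := (-1) ^ i * (2 * a - d + 2 * i) / 2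

/-- The superdiagonal entries `φ_i` for `E_d(a,b,c)`. -/
noncomputable def phiE (d : ℕ) (a b c : ℂ) (i : ℕ) : ℂ :=
  if Even i then (i : ℂ) * (d - i + 1) else c ^ 2 - (2 * a + 2 * b - d + 2 * i - 1) ^ 2 / 4

/-- The superdiagonal entries `φ_i` for `O_d(a,b,c)`. -/
noncomputable def phiO (d : ℕ) (a b c : ℂ) (i : ℕ) : ℂ :=
  if Even i then (i : ℂ) * (d + 1 - 2 * i - 2 * a - 2 * b - 2 * c) / 2
  else ((i : ℂ) - d - 1) * (d + 1 - 2 * i - 2 * a - 2 * b + 2 * c) / 2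

/-- The matrix `matX` on infinite sequences. -/
def seqX (θ : ℕ → ℂ) (F : ℕ → ℂ) : ℕ → ℂ
  | 0 => θ 0 * F 0
  | i + 1 => θ (i + 1) * F (i + 1) + F i

/-- The matrix `matY` on infinite sequences. -/
def seqY (θ φ : ℕ → ℂ) (F : ℕ → ℂ) (i : ℕ) : ℂ := θ i * F i + φ (i + 1) * F (i + 1)

theorem matX_mulVec (d : ℕ) (θ F : ℕ → ℂ) :
    (matX d θ).mulVec (fun i : Fin (d + 1) => F i) = fun i : Fin (d + 1) => seqX θ F i := by
  ext i
  have : ∀ j : Fin (d+1), (if i = j then θ i else if (i : ℕ) = j + 1 then (1:ℂ) else 0) * F j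
      = (if i = j then θ i * F i else 0) + (if (i : ℕ) = j + 1 then F j else 0) := by
    intro j
    by_cases h : i = j
    · subst h; simp
    · simp [h]
  simp only [matX, Matrix.mulVec, dotProduct, Matrix.of_apply, this, Finset.sum_add_distrib]
  obtain ⟨i, hi⟩ := i
  cases i with
  | zero =>
    rw [Finset.sum_ite_eq]
    simp [seqX]
  | succ i =>
    simp only [seqX, Finset.sum_ite_eq, Finset.mem_univ, if_true]
    congr 1
    rw [Finset.sum_eq_single (⟨i, by omega⟩ : Fin (d + 1))]
    · simp
    · intro b _ hb
      rw [if_neg]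
      intro h
      apply hb
      ext
      simp at h ⊢
      omega
    · simp

theorem matY_mulVec (d : ℕ) (θ φ F : ℕ → ℂ) (hφ : φ (d + 1) = 0) :
    (matY d θ φ).mulVec (fun i : Fin (d + 1) => F i) = fun i : Fin (d + 1) => seqY θ φ F i := by
  ext i
  have : ∀ j : Fin (d+1), (if i = j then θ i else if (j : ℕ) = i + 1 then φ j else 0) * F j
      = (if i = j then θ i * F i else 0) + (if (j : ℕ) = i + 1 then φ j * F j else 0) := by
    intro j
    by_cases h : i = j
    · subst h; simp
    · simp [h]
  simp only [matY, Matrix.mulVec, dotProduct, Matrix.of_apply, this, Finset.sum_add_distrib]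
  obtain ⟨i, hi⟩ := i
  simp only [seqY, Finset.sum_ite_eq, Finset.mem_univ, if_true]
  congr 1
  by_cases hd : i = d
  · subst hd
    rw [hφ, zero_mul]
    apply Finset.sum_eq_zero
    intro j _
    rw [if_neg]
    have := j.2
    simp
    omega
  · rw [Finset.sum_eq_single (⟨i + 1, by omega⟩ : Fin (d + 1))]
    · simp
    · intro b _ hb
      rw [if_neg]
      intro h
      apply hb
      ext
      simpa using h
    · simp

theorem mat_rel (d : ℕ) (θ θs φ : ℕ → ℂ) (κ l m : ℂ) (hφ : φ (d + 1) = 0)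
    (h1 : ∀ F : ℕ → ℂ, ∀ i, seqY θs φ (seqY θs φ (seqX θ F)) i
      + 2 * seqY θs φ (seqX θ (seqY θs φ F)) i
      + seqX θ (seqY θs φ (seqY θs φ F)) i - 2 * κ * seqY θs φ F i - seqX θ F i = l * F i)
    (h2 : ∀ F : ℕ → ℂ, ∀ i, seqX θ (seqX θ (seqY θs φ F)) i
      + 2 * seqX θ (seqY θs φ (seqX θ F)) i
      + seqY θs φ (seqX θ (seqX θ F)) i - 2 * κ * seqX θ F i - seqY θs φ F i = m * F i) :
    ∀ i j : Fin 3, Commute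
      (![matX d θ, matY d θs φ, matZ d θ θs φ κ] i * ![matX d θ, matY d θs φ, matZ d θ θs φ κ] (i + 1)
      + ![matX d θ, matY d θs φ, matZ d θ θs φ κ] (i + 1) * ![matX d θ, matY d θs φ, matZ d θ θs φ κ] i
      - ![matX d θ, matY d θs φ, matZ d θ θs φ κ] (i + 2))
      (![matX d θ, matY d θs φ, matZ d θ θs φ κ] j) := by
  set X := matX d θ with hX
  set Y := matY d θs φ with hY
  have ex : ∀ v : Fin (d + 1) → ℂ, ∃ F : ℕ → ℂ, v = fun i : Fin (d + 1) => F i := fun v =>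
    ⟨fun i => if h : i < d + 1 then v ⟨i, h⟩ else 0, by
      ext i
      simp only [i.2, dif_pos]⟩
  have mx : ∀ F : ℕ → ℂ, X.mulVec (fun i : Fin (d + 1) => F i) = fun i : Fin (d + 1) => seqX θ F i := matX_mulVec d θ
  have my : ∀ F : ℕ → ℂ, Y.mulVec (fun i : Fin (d + 1) => F i) = fun i : Fin (d + 1) => seqY θs φ F i :=
    fun F => matY_mulVec d θs φ F hφ
  have e1 : Y * Y * X + (2 : ℂ) • (Y * X * Y) + X * Y * Y - (2 * κ) • Y - X = l • 1 := by
    rw [← Matrix.mulVec_injective.eq_iff]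
    funext v
    obtain ⟨F, rfl⟩ := ex v
    ext i
    simp only [Matrix.add_mulVec, Matrix.sub_mulVec, Matrix.smul_mulVec, ← Matrix.mulVec_mulVec,
      mx, my, Matrix.one_mulVec, Pi.add_apply, Pi.sub_apply, Pi.smul_apply, smul_eq_mul]
    exact h1 F i
  have e2 : X * X * Y + (2 : ℂ) • (X * Y * X) + Y * X * X - (2 * κ) • X - Y = m • 1 := by
    rw [← Matrix.mulVec_injective.eq_iff]
    funext v
    obtain ⟨F, rfl⟩ := ex v
    ext i
    simp only [Matrix.add_mulVec, Matrix.sub_mulVec, Matrix.smul_mulVec, ← Matrix.mulVec_mulVec,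
      mx, my, Matrix.one_mulVec, Pi.add_apply, Pi.sub_apply, Pi.smul_apply, smul_eq_mul]
    exact h2 F i
  have f0 : X * Y + Y * X - matZ d θ θs φ κ = κ • 1 := by simp [matZ, hX, hY]
  have f1 : Y * matZ d θ θs φ κ + matZ d θ θs φ κ * Y - X = l • 1 := by
    rw [← e1, matZ, ← hX, ← hY]
    simp only [mul_add, add_mul, mul_sub, sub_mul, mul_smul_comm, smul_mul_assoc, mul_one, one_mul,
      mul_assoc]
    module
  have f2 : matZ d θ θs φ κ * X + X * matZ d θ θs φ κ - Y = m • 1 := by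
    rw [← e2, matZ, ← hX, ← hY]
    simp only [mul_add, add_mul, mul_sub, sub_mul, mul_smul_comm, smul_mul_assoc, mul_one, one_mul,
      mul_assoc]
    module
  have sc : ∀ (c : ℂ) (M : Matrix (Fin (d + 1)) (Fin (d + 1)) ℂ), Commute (c • 1) M :=
    fun c M => (Commute.one_left M).smul_left c
  intro i j
  fin_cases i
  · have := sc κ (![X, Y, matZ d θ θs φ κ] j)
    rw [← f0] at this
    exact this
  · have := sc l (![X, Y, matZ d θ θs φ κ] j)
    rw [← f1] at this
    exact this
  · have := sc m (![X, Y, matZ d θ θs φ κ] j)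
    rw [← f2] at this
    exact this

theorem seqE1 (d : ℕ) (a b c : ℂ) (F : ℕ → ℂ) (i : ℕ) :
    seqY (theta d b) (phiE d a b c) (seqY (theta d b) (phiE d a b c) (seqX (theta d a) F)) i
      + 2 * seqY (theta d b) (phiE d a b c) (seqX (theta d a) (seqY (theta d b) (phiE d a b c) F)) i
      + seqX (theta d a) (seqY (theta d b) (phiE d a b c) (seqY (theta d b) (phiE d a b c) F)) i
      - 2 * (c ^ 2 - a ^ 2 - b ^ 2 + (d + 1) ^ 2 / 4) * seqY (theta d b) (phiE d a b c) F i - seqX (theta d a) F i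
      = (a ^ 2 - b ^ 2 - c ^ 2 + (d + 1) ^ 2 / 4) * F i := by
  rcases i with _ | _ | i
  · simp [seqY, seqX, theta, phiE]
    ring
  · simp [seqY, seqX, theta, phiE, show ¬ Even 3 by decide]
    ring
  · rcases Nat.even_or_odd i with e | e
    · simp [seqY, seqX, theta, phiE, e, Nat.even_add_one, pow_succ, e.neg_one_pow]
      ring
    · have e' : ¬ Even i := Nat.not_even_iff_odd.2 e
      simp [seqY, seqX, theta, phiE, e', Nat.even_add_one, pow_succ, e.neg_one_pow]
      ring

theorem seqE2 (d : ℕ) (a b c : ℂ) (F : ℕ → ℂ) (i : ℕ) :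
    seqX (theta d a) (seqX (theta d a) (seqY (theta d b) (phiE d a b c) F)) i
      + 2 * seqX (theta d a) (seqY (theta d b) (phiE d a b c) (seqX (theta d a) F)) i
      + seqY (theta d b) (phiE d a b c) (seqX (theta d a) (seqX (theta d a) F)) i
      - 2 * (c ^ 2 - a ^ 2 - b ^ 2 + (d + 1) ^ 2 / 4) * seqX (theta d a) F i - seqY (theta d b) (phiE d a b c) F i
      = (b ^ 2 - c ^ 2 - a ^ 2 + (d + 1) ^ 2 / 4) * F i := by
  rcases i with _ | _ | i
  · simp [seqY, seqX, theta, phiE]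
    ring
  · simp [seqY, seqX, theta, phiE]
    ring
  · rcases Nat.even_or_odd i with e | e
    · simp [seqY, seqX, theta, phiE, e, Nat.even_add_one, pow_succ, e.neg_one_pow]
      ring
    · have e' : ¬ Even i := Nat.not_even_iff_odd.2 e
      simp [seqY, seqX, theta, phiE, e', Nat.even_add_one, pow_succ, e.neg_one_pow]
      ring

theorem seqO1 (d : ℕ) (a b c : ℂ) (F : ℕ → ℂ) (i : ℕ) :
    seqY (theta d b) (phiO d a b c) (seqY (theta d b) (phiO d a b c) (seqX (theta d a) F)) i
      + 2 * seqY (theta d b) (phiO d a b c) (seqX (theta d a) (seqY (theta d b) (phiO d a b c) F)) i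
      + seqX (theta d a) (seqY (theta d b) (phiO d a b c) (seqY (theta d b) (phiO d a b c) F)) i
      - 2 * (2 * a * b - c * (d + 1)) * seqY (theta d b) (phiO d a b c) F i - seqX (theta d a) F i
      = (2 * b * c - a * (d + 1)) * F i := by
  rcases i with _ | _ | i
  · simp [seqY, seqX, theta, phiO]
    ring
  · simp [seqY, seqX, theta, phiO, show ¬ Even 3 by decide]
    ring
  · rcases Nat.even_or_odd i with e | e
    · simp [seqY, seqX, theta, phiO, e, Nat.even_add_one, pow_succ, e.neg_one_pow]
      ring
    · have e' : ¬ Even i := Nat.not_even_iff_odd.2 e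
      simp [seqY, seqX, theta, phiO, e', Nat.even_add_one, pow_succ, e.neg_one_pow]
      ring

theorem seqO2 (d : ℕ) (a b c : ℂ) (F : ℕ → ℂ) (i : ℕ) :
    seqX (theta d a) (seqX (theta d a) (seqY (theta d b) (phiO d a b c) F)) i
      + 2 * seqX (theta d a) (seqY (theta d b) (phiO d a b c) (seqX (theta d a) F)) i
      + seqY (theta d b) (phiO d a b c) (seqX (theta d a) (seqX (theta d a) F)) i
      - 2 * (2 * a * b - c * (d + 1)) * seqX (theta d a) F i - seqY (theta d b) (phiO d a b c) F i
      = (2 * c * a - b * (d + 1)) * F i := by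
  rcases i with _ | _ | i
  · simp [seqY, seqX, theta, phiO]
    ring
  · simp [seqY, seqX, theta, phiO]
    ring
  · rcases Nat.even_or_odd i with e | e
    · simp [seqY, seqX, theta, phiO, e, Nat.even_add_one, pow_succ, e.neg_one_pow]
      ring
    · have e' : ¬ Even i := Nat.not_even_iff_odd.2 e
      simp [seqY, seqX, theta, phiO, e', Nat.even_add_one, pow_succ, e.neg_one_pow]
      ring

/-- The matrices of `X`, `Y`, `Z` on `E_d(a,b,c)`; `Z` is determined by `X`, `Y` and the condition
that `κ` acts as `c² - a² - b² + (d+1)²/4`. -/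
noncomputable def actE (d : ℕ) (a b c : ℂ) : Fin 3 → Matrix (Fin (d + 1)) (Fin (d + 1)) ℂ :=
  ![matX d (theta d a), matY d (theta d b) (phiE d a b c),
    matZ d (theta d a) (theta d b) (phiE d a b c) (c ^ 2 - a ^ 2 - b ^ 2 + (d + 1) ^ 2 / 4)]

/-- The matrices of `X`, `Y`, `Z` on `O_d(a,b,c)`; `Z` is determined by `X`, `Y` and the condition
that `κ` acts as `2ab - c(d+1)`. -/
noncomputable def actO (d : ℕ) (a b c : ℂ) : Fin 3 → Matrix (Fin (d + 1)) (Fin (d + 1)) ℂ :=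
  ![matX d (theta d a), matY d (theta d b) (phiO d a b c),
    matZ d (theta d a) (theta d b) (phiO d a b c) (2 * a * b - c * (d + 1))]

theorem phiE_last {d : ℕ} (hd : Odd d) (a b c : ℂ) : phiE d a b c (d + 1) = 0 := by
  rw [phiE, if_pos hd.add_one]
  push_cast
  ring

theorem phiO_last {d : ℕ} (hd : Even d) (a b c : ℂ) : phiO d a b c (d + 1) = 0 := by
  rw [phiO, if_neg (by simpa [Nat.even_add_one] using hd)]
  push_cast
  ring

theorem actE_rel (d : ℕ) (hd : Odd d) (a b c : ℂ) (i j : Fin 3) :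
    Commute (actE d a b c i * actE d a b c (i + 1) + actE d a b c (i + 1) * actE d a b c i
      - actE d a b c (i + 2)) (actE d a b c j) :=
  mat_rel d _ _ _ _ _ _ (phiE_last hd a b c) (seqE1 d a b c) (seqE2 d a b c) i j

/-- The representation of `BI` on `E_d(a,b,c)`. -/
noncomputable def repE (d : ℕ) (hd : Odd d) (a b c : ℂ) :
    BI →ₐ[ℂ] Matrix (Fin (d + 1)) (Fin (d + 1)) ℂ :=
  BI.lift (actE d a b c) (actE_rel d hd a b c)

theorem actO_rel (d : ℕ) (hd : Even d) (a b c : ℂ) (i j : Fin 3) :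
    Commute (actO d a b c i * actO d a b c (i + 1) + actO d a b c (i + 1) * actO d a b c i
      - actO d a b c (i + 2)) (actO d a b c j) :=
  mat_rel d _ _ _ _ _ _ (phiO_last hd a b c) (seqO1 d a b c) (seqO2 d a b c) i j

/-- The representation of `BI` on `O_d(a,b,c)`. -/
noncomputable def repO (d : ℕ) (hd : Even d) (a b c : ℂ) :
    BI →ₐ[ℂ] Matrix (Fin (d + 1)) (Fin (d + 1)) ℂ :=
  BI.lift (actO d a b c) (actO_rel d hd a b c)

/-- The `(d+1)`-dimensional `BI`-module `E_d(a,b,c)`, for odd `d`. -/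
def E (d : ℕ) (_hd : Odd d) (_a _b _c : ℂ) : Type := Fin (d + 1) → ℂ

/-- The `(d+1)`-dimensional `BI`-module `O_d(a,b,c)`, for even `d`. -/
def O (d : ℕ) (_hd : Even d) (_a _b _c : ℂ) : Type := Fin (d + 1) → ℂ

instance (d : ℕ) (hd : Odd d) (a b c : ℂ) : AddCommGroup (E d hd a b c) :=
  inferInstanceAs (AddCommGroup (Fin (d + 1) → ℂ))

instance (d : ℕ) (hd : Even d) (a b c : ℂ) : AddCommGroup (O d hd a b c) :=
  inferInstanceAs (AddCommGroup (Fin (d + 1) → ℂ))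

noncomputable instance (d : ℕ) (hd : Odd d) (a b c : ℂ) : Module BI (E d hd a b c) :=
  Module.compHom (Fin (d + 1) → ℂ)
    ((Matrix.toLinAlgEquiv'.toAlgHom.comp (repE d hd a b c)) : BI →+* Module.End ℂ (Fin (d + 1) → ℂ))

noncomputable instance (d : ℕ) (hd : Even d) (a b c : ℂ) : Module BI (O d hd a b c) :=
  Module.compHom (Fin (d + 1) → ℂ)
    ((Matrix.toLinAlgEquiv'.toAlgHom.comp (repO d hd a b c)) : BI →+* Module.End ℂ (Fin (d + 1) → ℂ))

theorem E_smul (d : ℕ) (hd : Odd d) (a b c : ℂ) (j : Fin 3) (v : Fin (d + 1) → ℂ) :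
    (BI.gen j • (show E d hd a b c from v)) = (actE d a b c j).mulVec v := by
  change Matrix.toLinAlgEquiv' (repE d hd a b c (BI.gen j)) v = _
  exact congrArg (fun M => Matrix.mulVec M v) (BI.lift_gen (actE d a b c) (actE_rel d hd a b c) j)

theorem O_smul (d : ℕ) (hd : Even d) (a b c : ℂ) (j : Fin 3) (v : Fin (d + 1) → ℂ) :
    (BI.gen j • (show O d hd a b c from v)) = (actO d a b c j).mulVec v := by
  change Matrix.toLinAlgEquiv' (repO d hd a b c (BI.gen j)) v = _
  exact congrArg (fun M => Matrix.mulVec M v) (BI.lift_gen (actO d a b c) (actO_rel d hd a b c) j)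

/-! ### Polynomials, Dunkl operators and reflections -/

open MvPolynomial

/-- Real polynomials in `x₁, x₂, x₃` (indexed by `0, 1, 2`). -/
abbrev Poly : Type := MvPolynomial (Fin 3) ℝ

/-- The reflection `f ↦ f(…, -x_j, …)`. -/
noncomputable def refl (j : Fin 3) : Poly →ₗ[ℝ] Poly :=
  (MvPolynomial.aeval fun i => if i = j then -X i else X i : Poly →ₐ[ℝ] Poly).toLinearMap

/-- Multiplication by `x_j`. -/
noncomputable def mulX (j : Fin 3) : Poly →ₗ[ℝ] Poly := LinearMap.mulLeft ℝ (X j)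

/-- The Dunkl operator `T_j f = ∂f/∂x_j + k_j (f - f(…, -x_j, …)) / x_j`; the division of polynomials
is exact, see `X_mul_dunkl`. -/
noncomputable def dunkl (k : Fin 3 → ℝ) (j : Fin 3) : Poly →ₗ[ℝ] Poly where
  toFun f := pderiv j f + k j • (f - refl j f).divMonomial (Finsupp.single j 1)
  map_add' f g := by
    rw [map_add, map_add, add_sub_add_comm, add_divMonomial, smul_add]
    abel
  map_smul' c f := by
    have h : ∀ g : Poly, (c • g).divMonomial (Finsupp.single j 1)
        = c • g.divMonomial (Finsupp.single j 1) := fun g => by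
      ext m
      simp [coeff_divMonomial]
    simp only [RingHom.id_apply]
    rw [(pderiv j).map_smul, map_smul, ← smul_sub, h, smul_comm, smul_add]

theorem refl_monomial (j : Fin 3) (a : Fin 3 →₀ ℕ) (r : ℝ) :
    refl j (monomial a r) = monomial a ((-1) ^ a j * r) := by
  have : ∀ i, ((if i = j then -X i else X i : Poly)) ^ a i
      = C (if i = j then (-1) ^ a j else 1) * X i ^ a i := by
    intro i
    split_ifs with h
    · subst h; rw [neg_pow]; simp
    · simp
  rw [refl, AlgHom.toLinearMap_apply, aeval_monomial, Finsupp.prod_fintype _ _ (by simp)]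
  simp_rw [this]
  rw [Finset.prod_mul_distrib, ← map_prod, Finset.prod_ite_eq' Finset.univ j]
  rw [monomial_eq, Finsupp.prod_fintype _ _ (by simp), map_mul, algebraMap_eq]
  simp only [Finset.mem_univ, if_true]
  ring

theorem mulX_monomial (j : Fin 3) (a : Fin 3 →₀ ℕ) (r : ℝ) :
    mulX j (monomial a r) = monomial (a + Finsupp.single j 1) r := by
  simp [mulX, X, monomial_mul, add_comm]

theorem dunkl_monomial (k : Fin 3 → ℝ) (j : Fin 3) (a : Fin 3 →₀ ℕ) (r : ℝ) :
    dunkl k j (monomial a r)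
      = monomial (a - Finsupp.single j 1) ((a j + k j * (1 - (-1) ^ a j)) * r) := by
  have h : (monomial a r - monomial a ((-1) ^ a j * r) : Poly) = monomial a ((1 - (-1) ^ a j) * r) := by
    rw [← map_sub]; congr 1; ring
  simp only [dunkl, LinearMap.coe_mk, AddHom.coe_mk]
  rw [refl_monomial, h, pderiv_monomial]
  by_cases hj : a j = 0
  · simp [hj, zero_divMonomial]
  · have : a = (a - Finsupp.single j 1) + Finsupp.single j 1 := by
      ext i; by_cases hi : j = i
      · subst hi; simp; omega
      · simp [hi]
    have h2 : (monomial a ((1 - (-1) ^ a j) * r) : Poly).divMonomial (Finsupp.single j 1)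
        = monomial (a - Finsupp.single j 1) ((1 - (-1) ^ a j) * r) := by
      generalize (1 - (-1) ^ a j) * r = s
      conv_lhs => rw [this]
      rw [add_comm, ← one_mul s, ← monomial_mul, divMonomial_monomial_mul, one_mul]
    rw [h2, smul_monomial, ← map_add]
    congr 1
    simp only [smul_eq_mul]
    ring

/-- The quotient in the definition of the Dunkl operator is exact. -/
theorem X_mul_dunkl (k : Fin 3 → ℝ) (j : Fin 3) (f : Poly) :
    X j * dunkl k j f = X j * pderiv j f + k j • (f - refl j f) := by
  induction f using MvPolynomial.induction_on' with
  | monomial a r =>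
    rw [dunkl_monomial, refl_monomial, X_mul_pderiv_monomial, ← map_sub, smul_monomial,
      smul_monomial, ← map_add, X, monomial_mul]
    by_cases hj : a j = 0
    · simp [hj]
    · have : Finsupp.single j 1 + (a - Finsupp.single j 1) = a := by
        ext i; by_cases hi : j = i
        · subst hi; simp; omega
        · simp [hi]
      rw [this]
      congr 1
      simp only [smul_eq_mul, nsmul_eq_mul]
      ring
  | add p q hp hq =>
    rw [map_add, mul_add, hp, hq, map_add, map_add, mul_add, add_sub_add_comm, smul_add]
    abel

/-! ### Abstract commutation relations -/

theorem asc {A : Type*} [Ring A] {a b c : A} (h : a * b = c) (w : A) : a * (b * w) = c * w := by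
  rw [← mul_assoc, h]

/-- Commutation relations between quaternion units `q`, multiplications by coordinates `x`, Dunkl
operators `T` and reflections `R`. -/
structure DRel {A : Type*} [Ring A] [Algebra ℂ A] (k : Fin 3 → ℂ) (q x T R : Fin 3 → A) :
    Prop where
  qq : ∀ j, q j * q j = -1
  qa : ∀ j, q j * q (j + 1) = -q (j + 2)
  qb : ∀ j, q (j + 1) * q j = q (j + 2)
  xq : ∀ i j, x i * q j = q j * x i
  Tq : ∀ i j, T i * q j = q j * T i
  Rq : ∀ i j, R i * q j = q j * R i
  xx : ∀ i j, x i * x j = x j * x i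
  TT : ∀ i j, T i * T j = T j * T i
  RR : ∀ i j, R i * R j = R j * R i
  R2 : ∀ j, R j * R j = 1
  Tx : ∀ i j, i ≠ j → T i * x j = x j * T i
  Ts : ∀ j, T j * x j = x j * T j + 1 + (2 * k j) • R j
  Rx : ∀ i j, i ≠ j → R i * x j = x j * R i
  Rxs : ∀ j, R j * x j = -(x j * R j)
  RT : ∀ i j, i ≠ j → R i * T j = T j * R i
  RTs : ∀ j, R j * T j = -(T j * R j)

/-- The abstract form of the operators representing the generators. -/
noncomputable def absOp {A : Type*} [Ring A] [Algebra ℂ A] (k : Fin 3 → ℂ) (q x T R : Fin 3 → A)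
    (j : Fin 3) : A :=
  q j * ((x (j + 2) * T (j + 1) - x (j + 1) * T (j + 2)) * (R (j + 1) * R (j + 2)))
    + ((1 / 2 : ℂ) • (R (j + 1) * R (j + 2)) + k (j + 1) • R (j + 2) + k (j + 2) • R (j + 1))

section
variable {A : Type*} [Ring A] [Algebra ℂ A] {k : Fin 3 → ℂ} {q x T R : Fin 3 → A}

theorem DRel.shift (H : DRel k q x T R) (s : Fin 3) :
    DRel (fun i => k (i + s)) (fun i => q (i + s)) (fun i => x (i + s)) (fun i => T (i + s))
      (fun i => R (i + s)) where
  qq j := H.qq _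
  qa j := by have := H.qa (j + s); rwa [add_right_comm j s 1, add_right_comm j s 2] at this
  qb j := by have := H.qb (j + s); rwa [add_right_comm j s 1, add_right_comm j s 2] at this
  xq i j := H.xq _ _
  Tq i j := H.Tq _ _
  Rq i j := H.Rq _ _
  xx i j := H.xx _ _
  TT i j := H.TT _ _
  RR i j := H.RR _ _
  R2 j := H.R2 _
  Tx i j h := H.Tx _ _ (by simpa using h)
  Ts j := H.Ts _
  Rx i j h := H.Rx _ _ (by simpa using h)
  Rxs j := H.Rxs _
  RT i j h := H.RT _ _ (by simpa using h)
  RTs j := H.RTs _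

theorem absOp_shift (k : Fin 3 → ℂ) (q x T R : Fin 3 → A) (s j : Fin 3) :
    absOp (fun i => k (i + s)) (fun i => q (i + s)) (fun i => x (i + s)) (fun i => T (i + s))
      (fun i => R (i + s)) j = absOp k q x T R (j + s) := by
  simp only [absOp, add_right_comm j _ s]

theorem absOp_zero (k : Fin 3 → ℂ) (q x T R : Fin 3 → A) : absOp k q x T R 0 =
    q 0 * ((x 2 * T 1 - x 1 * T 2) * (R 1 * R 2))
    + ((1 / 2 : ℂ) • (R 1 * R 2) + k 1 • R 2 + k 2 • R 1) := rfl

theorem absOp_one (k : Fin 3 → ℂ) (q x T R : Fin 3 → A) : absOp k q x T R 1 =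
    q 1 * ((x 0 * T 2 - x 2 * T 0) * (R 2 * R 0))
    + ((1 / 2 : ℂ) • (R 2 * R 0) + k 2 • R 0 + k 0 • R 2) := rfl

theorem absOp_two (k : Fin 3 → ℂ) (q x T R : Fin 3 → A) : absOp k q x T R 2 =
    q 2 * ((x 1 * T 0 - x 0 * T 1) * (R 0 * R 1))
    + ((1 / 2 : ℂ) • (R 0 * R 1) + k 0 • R 1 + k 1 • R 0) := rfl

set_option maxHeartbeats 4000000 in
set_option linter.unusedSimpArgs false in
theorem DRel.comm_quad_zero (H : DRel k q x T R) :
    (∑ i, q i * T i) * absOp k q x T R 0 = absOp k q x T R 0 * ∑ i, q i * T i ∧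
    absOp k q x T R 0 * absOp k q x T R 1 + absOp k q x T R 1 * absOp k q x T R 0
      - absOp k q x T R 2 = (2 * k 0 * k 1) • 1
      + (2 * k 2) • ((1 + ∑ i, (x i * T i + k i • R i)) * (R 0 * (R 1 * R 2)))
      - (2 * k 2) • ((∑ i, q i * x i) * (R 0 * (R 1 * R 2)) * ∑ i, q i * T i) := by
  have h0 : q 0 * q 0 = -1 := H.qq 0
  have h1 : q 0 * q 1 = -q 2 := H.qa 0
  have h2 : q 1 * q 0 = q 2 := H.qb 0
  have h3 : q 1 * q 1 = -1 := H.qq 1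
  have h4 : q 1 * q 2 = -q 0 := H.qa 1
  have h5 : q 2 * q 1 = q 0 := H.qb 1
  have h6 : q 2 * q 2 = -1 := H.qq 2
  have h7 : q 2 * q 0 = -q 1 := H.qa 2
  have h8 : q 0 * q 2 = q 1 := H.qb 2
  have h9 : x 1 * x 0 = x 0 * x 1 := H.xx 1 0
  have h10 : x 2 * x 0 = x 0 * x 2 := H.xx 2 0
  have h11 : x 2 * x 1 = x 1 * x 2 := H.xx 2 1
  have h12 : T 1 * T 0 = T 0 * T 1 := H.TT 1 0
  have h13 : T 2 * T 0 = T 0 * T 2 := H.TT 2 0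
  have h14 : T 2 * T 1 = T 1 * T 2 := H.TT 2 1
  have h15 : R 1 * R 0 = R 0 * R 1 := H.RR 1 0
  have h16 : R 2 * R 0 = R 0 * R 2 := H.RR 2 0
  have h17 : R 2 * R 1 = R 1 * R 2 := H.RR 2 1
  have h18 : T 0 * x 0 = x 0 * T 0 + 1 + (2 * k 0) • R 0 := H.Ts 0
  have h19 : R 0 * x 0 = -(x 0 * R 0) := H.Rxs 0
  have h20 : R 0 * T 0 = -(T 0 * R 0) := H.RTs 0
  have h21 : T 0 * x 1 = x 1 * T 0 := H.Tx 0 1 (by decide)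
  have h22 : R 0 * x 1 = x 1 * R 0 := H.Rx 0 1 (by decide)
  have h23 : R 0 * T 1 = T 1 * R 0 := H.RT 0 1 (by decide)
  have h24 : T 0 * x 2 = x 2 * T 0 := H.Tx 0 2 (by decide)
  have h25 : R 0 * x 2 = x 2 * R 0 := H.Rx 0 2 (by decide)
  have h26 : R 0 * T 2 = T 2 * R 0 := H.RT 0 2 (by decide)
  have h27 : T 1 * x 0 = x 0 * T 1 := H.Tx 1 0 (by decide)
  have h28 : R 1 * x 0 = x 0 * R 1 := H.Rx 1 0 (by decide)
  have h29 : R 1 * T 0 = T 0 * R 1 := H.RT 1 0 (by decide)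
  have h30 : T 1 * x 1 = x 1 * T 1 + 1 + (2 * k 1) • R 1 := H.Ts 1
  have h31 : R 1 * x 1 = -(x 1 * R 1) := H.Rxs 1
  have h32 : R 1 * T 1 = -(T 1 * R 1) := H.RTs 1
  have h33 : T 1 * x 2 = x 2 * T 1 := H.Tx 1 2 (by decide)
  have h34 : R 1 * x 2 = x 2 * R 1 := H.Rx 1 2 (by decide)
  have h35 : R 1 * T 2 = T 2 * R 1 := H.RT 1 2 (by decide)
  have h36 : T 2 * x 0 = x 0 * T 2 := H.Tx 2 0 (by decide)
  have h37 : R 2 * x 0 = x 0 * R 2 := H.Rx 2 0 (by decide)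
  have h38 : R 2 * T 0 = T 0 * R 2 := H.RT 2 0 (by decide)
  have h39 : T 2 * x 1 = x 1 * T 2 := H.Tx 2 1 (by decide)
  have h40 : R 2 * x 1 = x 1 * R 2 := H.Rx 2 1 (by decide)
  have h41 : R 2 * T 1 = T 1 * R 2 := H.RT 2 1 (by decide)
  have h42 : T 2 * x 2 = x 2 * T 2 + 1 + (2 * k 2) • R 2 := H.Ts 2
  have h43 : R 2 * x 2 = -(x 2 * R 2) := H.Rxs 2
  have h44 : R 2 * T 2 = -(T 2 * R 2) := H.RTs 2
  have h45 : R 0 * R 0 = 1 := H.R2 0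
  have h46 : R 1 * R 1 = 1 := H.R2 1
  have h47 : R 2 * R 2 = 1 := H.R2 2
  rw [absOp_zero, absOp_one, absOp_two, Fin.sum_univ_three, Fin.sum_univ_three,
    Fin.sum_univ_three]
  constructor <;>
  simp only [mul_add, add_mul, mul_sub, sub_mul, mul_assoc, neg_mul, mul_neg, smul_mul_assoc,
    mul_smul_comm, one_mul, mul_one, smul_add, smul_sub, smul_neg,
    h0, asc h0, h1, asc h1, h2, asc h2, h3, asc h3, h4, asc h4, h5, asc h5, h6, asc h6, h7,
    asc h7, h8, asc h8, h9, asc h9, h10, asc h10, h11, asc h11, h12, asc h12, h13, asc h13,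
    h14, asc h14, h15, asc h15, h16, asc h16, h17, asc h17, h18, asc h18, h19, asc h19, h20,
    asc h20, h21, asc h21, h22, asc h22, h23, asc h23, h24, asc h24, h25, asc h25, h26, asc
    h26, h27, asc h27, h28, asc h28, h29, asc h29, h30, asc h30, h31, asc h31, h32, asc h32,
    h33, asc h33, h34, asc h34, h35, asc h35, h36, asc h36, h37, asc h37, h38, asc h38, h39,
    asc h39, h40, asc h40, h41, asc h41, h42, asc h42, h43, asc h43, h44, asc h44, h45, asc
    h45, h46, asc h46, h47, asc h47, H.xq, H.Tq, H.Rq, asc (H.xq _ _), asc (H.Tq _ _), asc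
    (H.Rq _ _)]
  all_goals module

theorem DRel.comm (H : DRel k q x T R) (j : Fin 3) :
    (∑ i, q i * T i) * absOp k q x T R j = absOp k q x T R j * ∑ i, q i * T i := by
  have h := (H.shift j).comm_quad_zero.1
  have e1 : ∑ i, q (i + j) * T (i + j) = ∑ i, q i * T i :=
    Equiv.sum_comp (Equiv.addRight j) fun i => q i * T i
  rwa [absOp_shift, zero_add, e1] at h

theorem DRel.quad (H : DRel k q x T R) (j : Fin 3) :
    absOp k q x T R j * absOp k q x T R (j + 1) + absOp k q x T R (j + 1) * absOp k q x T R j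
      - absOp k q x T R (j + 2) = (2 * k j * k (j + 1)) • 1
      + (2 * k (j + 2)) • ((1 + ∑ i, (x i * T i + k i • R i)) * (R j * (R (j + 1) * R (j + 2))))
      - (2 * k (j + 2)) •
        ((∑ i, q i * x i) * (R j * (R (j + 1) * R (j + 2))) * ∑ i, q i * T i) := by
  have h := (H.shift j).comm_quad_zero.2
  simp only [absOp_shift] at h
  have e1 : ∑ i, q (i + j) * T (i + j) = ∑ i, q i * T i :=
    Equiv.sum_comp (Equiv.addRight j) fun i => q i * T i
  have e2 : ∑ i, q (i + j) * x (i + j) = ∑ i, q i * x i :=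
    Equiv.sum_comp (Equiv.addRight j) fun i => q i * x i
  have e3 : ∑ i, (x (i + j) * T (i + j) + k (i + j) • R (i + j)) = ∑ i, (x i * T i + k i • R i) :=
    Equiv.sum_comp (Equiv.addRight j) fun i => x i * T i + k i • R i
  rwa [e1, e2, e3, zero_add, add_comm 1 j, add_comm 2 j] at h

end

/-! ### Relations between operators on polynomials -/

theorem end_ext {f g : Poly →ₗ[ℝ] Poly} (h : ∀ a r, f (monomial a r) = g (monomial a r)) :
    f = g := by
  ext1 a
  ext1
  exact h a 1

section
variable (k : Fin 3 → ℝ)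

theorem mulX_mulX (i j : Fin 3) : mulX i * mulX j = mulX j * mulX i := by
  refine end_ext fun a r => ?_
  simp only [Module.End.mul_apply, mulX_monomial, add_right_comm]

theorem refl_refl (i j : Fin 3) : refl i * refl j = refl j * refl i := by
  refine end_ext fun a r => ?_
  simp only [Module.End.mul_apply, refl_monomial, mul_left_comm]

theorem refl_sq (j : Fin 3) : refl j * refl j = 1 := by
  refine end_ext fun a r => ?_
  simp only [Module.End.mul_apply, refl_monomial, Module.End.one_apply]
  rw [← mul_assoc, ← mul_pow]
  simp

theorem refl_mulX (i j : Fin 3) (h : i ≠ j) : refl i * mulX j = mulX j * refl i := by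
  refine end_ext fun a r => ?_
  simp [Module.End.mul_apply, mulX_monomial, refl_monomial, h.symm]

theorem refl_mulX_self (j : Fin 3) : refl j * mulX j = -(mulX j * refl j) := by
  refine end_ext fun a r => ?_
  simp only [Module.End.mul_apply, mulX_monomial, refl_monomial, LinearMap.neg_apply]
  rw [← map_neg]
  congr 1
  simp [pow_succ]

theorem refl_dunkl (i j : Fin 3) (h : i ≠ j) : refl i * dunkl k j = dunkl k j * refl i := by
  refine end_ext fun a r => ?_
  simp only [Module.End.mul_apply, dunkl_monomial, refl_monomial]
  congr 1
  simp [h.symm]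
  ring

theorem refl_dunkl_self (j : Fin 3) : refl j * dunkl k j = -(dunkl k j * refl j) := by
  refine end_ext fun a r => ?_
  simp only [Module.End.mul_apply, dunkl_monomial, refl_monomial, LinearMap.neg_apply]
  rw [← map_neg]
  congr 1
  cases h : a j with
  | zero => simp [h]
  | succ m =>
    simp [h, pow_succ]
    ring

theorem dunkl_dunkl (i j : Fin 3) : dunkl k i * dunkl k j = dunkl k j * dunkl k i := by
  by_cases h : i = j
  · rw [h]
  refine end_ext fun a r => ?_
  simp only [Module.End.mul_apply, dunkl_monomial]
  rw [tsub_right_comm]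
  congr 1
  simp [h, Ne.symm h]
  ring

theorem dunkl_mulX (i j : Fin 3) (h : i ≠ j) : dunkl k i * mulX j = mulX j * dunkl k i := by
  refine end_ext fun a r => ?_
  simp only [Module.End.mul_apply, dunkl_monomial, mulX_monomial]
  by_cases ha : a i = 0
  · simp [ha, h]
  · have : a + Finsupp.single j 1 - Finsupp.single i 1
        = a - Finsupp.single i 1 + Finsupp.single j 1 := by
      ext l
      by_cases hl : i = l
      · subst hl; simp [h]
      · simp [hl]
    rw [this]
    congr 1
    simp [h]

theorem dunkl_mulX_self (j : Fin 3) :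
    dunkl k j * mulX j = mulX j * dunkl k j + 1 + (2 * k j) • refl j := by
  refine end_ext fun a r => ?_
  simp only [Module.End.mul_apply, dunkl_monomial, mulX_monomial, refl_monomial,
    LinearMap.add_apply, LinearMap.smul_apply, Module.End.one_apply, smul_monomial]
  rw [add_tsub_cancel_right]
  by_cases ha : a j = 0
  · simp only [ha, Finsupp.add_apply, Finsupp.single_eq_same]
    simp
    rw [← map_add]
    congr 1
    ring
  · have : a - Finsupp.single j 1 + Finsupp.single j 1 = a := by
      ext l
      by_cases hl : j = l
      · subst hl; simp; omega
      · simp [hl]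
    rw [this, ← map_add, ← map_add]
    congr 1
    simp [pow_succ]
    ring

end

/-! ### Spinor-valued polynomials -/

/-- The space `ℂ² ⊗ ℝ[x₁,x₂,x₃]`. -/
def Spinor : Type := (Fin 2 → ℂ) ⊗[ℝ] Poly

noncomputable instance : AddCommGroup Spinor :=
  inferInstanceAs (AddCommGroup ((Fin 2 → ℂ) ⊗[ℝ] Poly))

noncomputable instance : Module ℂ Spinor :=
  inferInstanceAs (Module ℂ ((Fin 2 → ℂ) ⊗[ℝ] Poly))

/-- The pure tensor `v ⊗ f`. -/
noncomputable def tmul (v : Fin 2 → ℂ) (f : Poly) : Spinor := v ⊗ₜ[ℝ] f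

/-- The operator `M ⊗ P` on `ℂ² ⊗ ℝ[x₁,x₂,x₃]`. -/
noncomputable def tens (M : Matrix (Fin 2) (Fin 2) ℂ) (P : Poly →ₗ[ℝ] Poly) :
    Spinor →ₗ[ℂ] Spinor :=
  (TensorProduct.AlgebraTensorModule.map (Matrix.toLin' M) P :
    (Fin 2 → ℂ) ⊗[ℝ] Poly →ₗ[ℂ] (Fin 2 → ℂ) ⊗[ℝ] Poly)

/-- The Pauli matrices `σ₁, σ₂, σ₃`, by which `e₁, e₂, e₃` act on `ℂ²`. -/
noncomputable def pauli : Fin 3 → Matrix (Fin 2) (Fin 2) ℂ :=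
  ![!![0, 1; 1, 0], !![0, -Complex.I; Complex.I, 0], !![1, 0; 0, -1]]

theorem tens_tmul (M : Matrix (Fin 2) (Fin 2) ℂ) (P : Poly →ₗ[ℝ] Poly) (v : Fin 2 → ℂ)
    (f : Poly) : tens M P (tmul v f) = tmul (M.mulVec v) (P f) := rfl

theorem tmul_add (v : Fin 2 → ℂ) (f g : Poly) : tmul v (f + g) = tmul v f + tmul v g :=
  TensorProduct.tmul_add _ _ _

theorem add_tmul (v w : Fin 2 → ℂ) (f : Poly) : tmul (v + w) f = tmul v f + tmul w f :=
  TensorProduct.add_tmul _ _ _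

theorem smul_tmul (c : ℂ) (v : Fin 2 → ℂ) (f : Poly) : tmul (c • v) f = c • tmul v f := rfl

theorem tmul_smul (c : ℝ) (v : Fin 2 → ℂ) (f : Poly) : tmul v (c • f) = (c : ℂ) • tmul v f := by
  rw [← smul_tmul, Complex.coe_smul]
  exact (TensorProduct.smul_tmul c v f).symm

theorem Spinor.induction {p : Spinor → Prop} (h : ∀ v f, p (tmul v f)) (h0 : p 0)
    (ha : ∀ x y, p x → p y → p (x + y)) (x : Spinor) : p x :=
  TensorProduct.induction_on x h0 h ha

theorem Spinor.hom_ext {F G : Spinor →ₗ[ℂ] Spinor} (h : ∀ v f, F (tmul v f) = G (tmul v f)) :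
    F = G :=
  LinearMap.ext <| Spinor.induction h (by simp) fun x y hx hy => by rw [map_add, map_add, hx, hy]

theorem tens_mul (M N : Matrix (Fin 2) (Fin 2) ℂ) (P Q : Poly →ₗ[ℝ] Poly) :
    tens M P * tens N Q = tens (M * N) (P * Q) :=
  Spinor.hom_ext fun v f => by simp only [Module.End.mul_apply, tens_tmul, Matrix.mulVec_mulVec]

theorem tens_one : tens 1 1 = 1 := Spinor.hom_ext fun v f => by simp [tens_tmul]

theorem tens_add (M : Matrix (Fin 2) (Fin 2) ℂ) (P Q : Poly →ₗ[ℝ] Poly) :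
    tens M (P + Q) = tens M P + tens M Q :=
  Spinor.hom_ext fun v f => by simp [tens_tmul, tmul_add]

theorem tens_smul (M : Matrix (Fin 2) (Fin 2) ℂ) (c : ℝ) (P : Poly →ₗ[ℝ] Poly) :
    tens M (c • P) = (c : ℂ) • tens M P :=
  Spinor.hom_ext fun v f => by simp only [tens_tmul, LinearMap.smul_apply, tmul_smul]

theorem smul_tens (M : Matrix (Fin 2) (Fin 2) ℂ) (c : ℂ) (P : Poly →ₗ[ℝ] Poly) :
    tens (c • M) P = c • tens M P :=
  Spinor.hom_ext fun v f => by
    simp only [tens_tmul, LinearMap.smul_apply, Matrix.smul_mulVec, smul_tmul]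

theorem tens_neg (M : Matrix (Fin 2) (Fin 2) ℂ) (P : Poly →ₗ[ℝ] Poly) :
    tens M (-P) = -tens M P := by
  rw [← neg_one_smul ℝ P, tens_smul, Complex.ofReal_neg, Complex.ofReal_one, neg_one_smul]

theorem tens_sub (M : Matrix (Fin 2) (Fin 2) ℂ) (P Q : Poly →ₗ[ℝ] Poly) :
    tens M (P - Q) = tens M P - tens M Q := by
  rw [sub_eq_add_neg, tens_add, tens_neg, sub_eq_add_neg]

theorem neg_tens (M : Matrix (Fin 2) (Fin 2) ℂ) (P : Poly →ₗ[ℝ] Poly) :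
    tens (-M) P = -tens M P := by
  rw [← neg_one_smul ℂ M, smul_tens, neg_one_smul]

/-- The Dirac-Dunkl operator `e₁ ⊗ T₁ + e₂ ⊗ T₂ + e₃ ⊗ T₃`. -/
noncomputable def dirac (k : Fin 3 → ℝ) : Spinor →ₗ[ℂ] Spinor := ∑ j, tens (pauli j) (dunkl k j)

/-- The operators by which `X`, `Y`, `Z` (`j = 0, 1, 2`) act. For `j = 0`:
`f ↦ (i e₁ ⊗ (x₃T₂ - x₂T₃)) f(x₁,-x₂,-x₃) + f(x₁,-x₂,-x₃)/2 + k₂ f(x₁,x₂,-x₃) + k₃ f(x₁,-x₂,x₃)`,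
and cyclically. -/
noncomputable def biOp (k : Fin 3 → ℝ) (j : Fin 3) : Spinor →ₗ[ℂ] Spinor :=
  tens (Complex.I • pauli j)
      ((mulX (j + 2) * dunkl k (j + 1) - mulX (j + 1) * dunkl k (j + 2))
        * (refl (j + 1) * refl (j + 2)))
    + tens 1 ((1 / 2 : ℝ) • (refl (j + 1) * refl (j + 2)) + k (j + 1) • refl (j + 2)
        + k (j + 2) • refl (j + 1))

/-- The subspace `ℂ² ⊗ W` for a subspace `W` of `ℝ[x₁,x₂,x₃]`. -/
noncomputable def tensSub (W : Submodule ℝ Poly) : Submodule ℂ Spinor :=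
  Submodule.span ℂ {x | ∃ v, ∃ f ∈ W, x = tmul v f}

/-- The space `𝓜_n` of Dunkl monogenics of degree `n`: the kernel of the Dirac-Dunkl operator on
`ℂ² ⊗ ℝ[x₁,x₂,x₃]_n`. -/
noncomputable def monogenics (k : Fin 3 → ℝ) (n : ℕ) : Submodule ℂ Spinor :=
  tensSub (homogeneousSubmodule (Fin 3) ℝ n) ⊓ LinearMap.ker (dirac k)

theorem dRel (k : Fin 3 → ℝ) : DRel (fun j => (k j : ℂ)) (fun j => tens (Complex.I • pauli j) 1)
    (fun j => tens 1 (mulX j)) (fun j => tens 1 (dunkl k j)) (fun j => tens 1 (refl j)) where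
  qq j := by
    rw [tens_mul, ← tens_one, ← neg_tens]
    congr 1
    fin_cases j <;> ext a b <;> fin_cases a <;> fin_cases b <;> simp [pauli]
  qa j := by
    rw [tens_mul, ← neg_tens]
    congr 1
    fin_cases j <;> ext a b <;> fin_cases a <;> fin_cases b <;> simp [pauli]
  qb j := by
    rw [tens_mul]
    congr 1
    fin_cases j <;> ext a b <;> fin_cases a <;> fin_cases b <;> simp [pauli]
  xq i j := by simp [tens_mul]
  Tq i j := by simp [tens_mul]
  Rq i j := by simp [tens_mul]
  xx i j := by rw [tens_mul, tens_mul, mulX_mulX]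
  TT i j := by rw [tens_mul, tens_mul, dunkl_dunkl]
  RR i j := by rw [tens_mul, tens_mul, refl_refl]
  R2 j := by rw [tens_mul, refl_sq, mul_one, tens_one]
  Tx i j h := by rw [tens_mul, tens_mul, dunkl_mulX k i j h]
  Ts j := by
    rw [tens_mul, tens_mul, dunkl_mulX_self, mul_one, tens_add, tens_add, tens_one, tens_smul]
    push_cast
    rfl
  Rx i j h := by rw [tens_mul, tens_mul, refl_mulX i j h]
  Rxs j := by rw [tens_mul, tens_mul, refl_mulX_self, tens_neg]
  RT i j h := by rw [tens_mul, tens_mul, refl_dunkl k i j h]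
  RTs j := by rw [tens_mul, tens_mul, refl_dunkl_self, tens_neg]

theorem biOp_eq (k : Fin 3 → ℝ) (j : Fin 3) : biOp k j = absOp (fun j => (k j : ℂ))
    (fun j => tens (Complex.I • pauli j) 1) (fun j => tens 1 (mulX j))
    (fun j => tens 1 (dunkl k j)) (fun j => tens 1 (refl j)) j := by
  simp only [absOp, biOp, tens_add, tens_smul, tens_mul, ← tens_sub, mul_one, one_mul]
  norm_num

theorem sum_q_T (k : Fin 3 → ℝ) :
    ∑ i, tens (Complex.I • pauli i) 1 * tens 1 (dunkl k i) = Complex.I • dirac k := by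
  rw [dirac, Finset.smul_sum]
  refine Finset.sum_congr rfl fun i _ => ?_
  rw [tens_mul, mul_one, one_mul, smul_tens]

theorem dirac_biOp (k : Fin 3 → ℝ) (j : Fin 3) : dirac k * biOp k j = biOp k j * dirac k := by
  have h := (dRel k).comm j
  rw [sum_q_T, ← biOp_eq, smul_mul_assoc, mul_smul_comm] at h
  exact smul_right_injective _ Complex.I_ne_zero h

theorem tmul_mem_tensSub {W : Submodule ℝ Poly} (v : Fin 2 → ℂ) {f : Poly} (hf : f ∈ W) :
    tmul v f ∈ tensSub W := Submodule.subset_span ⟨v, f, hf, rfl⟩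

theorem tens_mem {W W' : Submodule ℝ Poly} (M : Matrix (Fin 2) (Fin 2) ℂ)
    {P : Poly →ₗ[ℝ] Poly} (hP : ∀ f ∈ W, P f ∈ W') {f : Spinor} (hf : f ∈ tensSub W) :
    tens M P f ∈ tensSub W' := by
  induction hf using Submodule.span_induction with
  | mem x hx => obtain ⟨v, f, hf, rfl⟩ := hx; exact tmul_mem_tensSub _ (hP f hf)
  | zero => simp
  | add x y _ _ hx hy => rw [map_add]; exact add_mem hx hy
  | smul c x _ hx => rw [map_smul]; exact Submodule.smul_mem _ _ hx

theorem tens_eq_smul {W : Submodule ℝ Poly} {P : Poly →ₗ[ℝ] Poly} {c : ℝ}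
    (hP : ∀ f ∈ W, P f = c • f) {f : Spinor} (hf : f ∈ tensSub W) :
    tens 1 P f = (c : ℂ) • f := by
  induction hf using Submodule.span_induction with
  | mem x hx =>
    obtain ⟨v, f, hf, rfl⟩ := hx
    rw [tens_tmul, hP f hf, Matrix.one_mulVec, tmul_smul]
  | zero => simp
  | add x y _ _ hx hy => rw [map_add, hx, hy, smul_add]
  | smul a x _ hx => rw [map_smul, hx, smul_comm]

theorem restrictSupport_map {S S' : Set (Fin 3 →₀ ℕ)} {P : Poly →ₗ[ℝ] Poly}
    (h : ∀ a ∈ S, P (monomial a 1) ∈ restrictSupport ℝ S') :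
    ∀ f ∈ restrictSupport ℝ S, P f ∈ restrictSupport ℝ S' := by
  rw [restrictSupport_eq_span ℝ S]
  intro f hf
  induction hf using Submodule.span_induction with
  | mem x hx => obtain ⟨a, ha, rfl⟩ := hx; exact h a ha
  | zero => simp
  | add x y _ _ hx hy => rw [map_add]; exact add_mem hx hy
  | smul c x _ hx => rw [map_smul]; exact Submodule.smul_mem _ _ hx

theorem homogeneous_eq (n : ℕ) :
    homogeneousSubmodule (Fin 3) ℝ n = restrictSupport ℝ {a | a.degree = n} :=
  homogeneousSubmodule_eq_finsupp_supported _ _ n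

theorem restrictSupport_eq_smul {S : Set (Fin 3 →₀ ℕ)} {P : Poly →ₗ[ℝ] Poly} {c : ℝ}
    (h : ∀ a ∈ S, P (monomial a 1) = c • monomial a 1) :
    ∀ f ∈ restrictSupport ℝ S, P f = c • f := by
  rw [restrictSupport_eq_span ℝ S]
  intro f hf
  induction hf using Submodule.span_induction with
  | mem x hx => obtain ⟨a, ha, rfl⟩ := hx; exact h a ha
  | zero => simp
  | add x y _ _ hx hy => rw [map_add, hx, hy, smul_add]
  | smul a x _ hx => rw [map_smul, hx, smul_comm]

/-- Index sets stable under the monomial moves of the operators. -/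
def Stable (k : Fin 3 → ℝ) (S : Set (Fin 3 →₀ ℕ)) : Prop :=
  ∀ a ∈ S, ∀ i j, i ≠ j → (a i : ℝ) + k i * (1 - (-1) ^ a i) ≠ 0 →
    a - Finsupp.single i 1 + Finsupp.single j 1 ∈ S

theorem refl_mem {S : Set (Fin 3 →₀ ℕ)} (j : Fin 3) :
    ∀ f ∈ restrictSupport ℝ S, refl j f ∈ restrictSupport ℝ S :=
  restrictSupport_map fun a ha => by
    rw [refl_monomial, monomial_mem_restrictSupport]
    exact Or.inl ha

theorem mulX_dunkl_mem {k : Fin 3 → ℝ} {S : Set (Fin 3 →₀ ℕ)} (hS : Stable k S) (i j : Fin 3)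
    (h : i ≠ j) : ∀ f ∈ restrictSupport ℝ S, mulX j (dunkl k i f) ∈ restrictSupport ℝ S :=
  restrictSupport_map (P := mulX j * dunkl k i) fun a ha => by
    rw [Module.End.mul_apply, dunkl_monomial, mulX_monomial, monomial_mem_restrictSupport,
      mul_one]
    by_cases h0 : (a i : ℝ) + k i * (1 - (-1) ^ a i) = 0
    · exact Or.inr h0
    · exact Or.inl (hS a ha i j h h0)

theorem biOp_mem {k : Fin 3 → ℝ} {S : Set (Fin 3 →₀ ℕ)} (hS : Stable k S) (j : Fin 3)
    {f : Spinor} (hf : f ∈ tensSub (restrictSupport ℝ S)) :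
    biOp k j f ∈ tensSub (restrictSupport ℝ S) := by
  rw [biOp, LinearMap.add_apply]
  refine add_mem (tens_mem _ (fun f hf => ?_) hf) (tens_mem _ (fun f hf => ?_) hf)
  · have h1 := refl_mem (j + 1) _ (refl_mem (j + 2) f hf)
    refine sub_mem (mulX_dunkl_mem hS _ _ ?_ _ h1) (mulX_dunkl_mem hS _ _ ?_ _ h1) <;> simp
  · exact add_mem (add_mem (Submodule.smul_mem _ _ (refl_mem _ _ (refl_mem _ f hf)))
      (Submodule.smul_mem _ _ (refl_mem _ f hf))) (Submodule.smul_mem _ _ (refl_mem _ f hf))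

theorem degree_move {a : Fin 3 →₀ ℕ} {i j : Fin 3} (h : a i ≠ 0) :
    (a - Finsupp.single i 1 + Finsupp.single j 1).degree = a.degree := by
  have : a - Finsupp.single i 1 + Finsupp.single i 1 = a := by
    ext l
    by_cases hl : i = l
    · subst hl; simp; omega
    · simp [hl]
  conv_rhs => rw [← this]
  simp [map_add]

theorem stable_degree (k : Fin 3 → ℝ) (n : ℕ) : Stable k {a | a.degree = n} := by
  intro a ha i j _ h0
  have hi : a i ≠ 0 := fun h => h0 (by simp [h])
  exact (degree_move hi).trans ha

theorem biOp_mem_monogenics (k : Fin 3 → ℝ) (n : ℕ) (j : Fin 3) {f : Spinor}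
    (hf : f ∈ monogenics k n) : biOp k j f ∈ monogenics k n := by
  obtain ⟨h1, h2⟩ := hf
  refine ⟨?_, ?_⟩
  · rw [homogeneous_eq] at h1 ⊢
    exact biOp_mem (stable_degree k n) j h1
  · have := LinearMap.congr_fun (dirac_biOp k j) f
    rw [Module.End.mul_apply, Module.End.mul_apply, LinearMap.mem_ker.1 h2, map_zero] at this
    exact this

/-- The operators `X`, `Y`, `Z` on `𝓜_n`. -/
noncomputable def act (k : Fin 3 → ℝ) (n : ℕ) (j : Fin 3) : Module.End ℂ (monogenics k n) :=
  (biOp k j).restrict fun _ hf => biOp_mem_monogenics k n j hf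

theorem biOp_quad (k : Fin 3 → ℝ) (n : ℕ) (j : Fin 3) {f : Spinor} (hf : f ∈ monogenics k n) :
    biOp k j (biOp k (j + 1) f) + biOp k (j + 1) (biOp k j f) - biOp k (j + 2) f
      = ((2 * (k j * k (j + 1) + (-1) ^ n * (k 0 + k 1 + k 2 + n + 1) * k (j + 2)) : ℝ) : ℂ)
        • f := by
  obtain ⟨h1, h2⟩ := hf
  rw [homogeneous_eq] at h1
  have h := (dRel k).quad j
  simp only [← biOp_eq] at h
  rw [sum_q_T] at h
  have hq := LinearMap.congr_fun h f
  have hR : (tens 1 (refl j) * (tens 1 (refl (j + 1)) * tens 1 (refl (j + 2)))) f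
      = (((-1) ^ n : ℝ) : ℂ) • f := by
    rw [tens_mul, tens_mul, one_mul, one_mul]
    refine tens_eq_smul (restrictSupport_eq_smul fun a ha => ?_) h1
    simp only [Module.End.mul_apply, refl_monomial, smul_monomial]
    congr 1
    have ha' : a.degree = n := ha
    rw [← ha', Finsupp.degree_eq_sum, Fin.sum_univ_three, smul_eq_mul, mul_one, mul_one,
      ← pow_add, ← pow_add]
    congr 1
    fin_cases j <;> simp <;> ring
  have hE : (∑ i, (tens 1 (mulX i) * tens 1 (dunkl k i) + (k i : ℂ) • tens 1 (refl i))) f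
      = ((n + (k 0 + k 1 + k 2) : ℝ) : ℂ) • f := by
    have e : ∑ i, (tens 1 (mulX i) * tens 1 (dunkl k i) + (k i : ℂ) • tens 1 (refl i))
        = tens 1 (∑ i, (mulX i * dunkl k i + k i • refl i)) := by
      simp only [Fin.sum_univ_three, tens_add, tens_smul, tens_mul, one_mul]
    rw [e]
    refine tens_eq_smul (restrictSupport_eq_smul fun a ha => ?_) h1
    have e2 : ∀ i, (mulX i * dunkl k i + k i • refl i) (monomial a 1)
        = (a i + k i : ℝ) • monomial a 1 := by
      intro i
      simp only [LinearMap.add_apply, LinearMap.smul_apply, Module.End.mul_apply, dunkl_monomial,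
        mulX_monomial, refl_monomial, smul_monomial]
      by_cases h0 : a i = 0
      · simp [h0]
      · have : a - Finsupp.single i 1 + Finsupp.single i 1 = a := by
          ext l
          by_cases hl : i = l
          · subst hl; simp; omega
          · simp [hl]
        rw [this, ← map_add]
        congr 1
        simp only [smul_eq_mul]
        ring
    have ha' : a.degree = n := ha
    rw [LinearMap.sum_apply, Fin.sum_univ_three, e2, e2, e2, ← ha', Finsupp.degree_eq_sum,
      Fin.sum_univ_three, ← add_smul, ← add_smul]
    congr 1
    push_cast
    ring
  simp only [LinearMap.sub_apply, LinearMap.add_apply, Module.End.mul_apply, LinearMap.smul_apply,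
    Module.End.one_apply] at hq hR hE
  rw [hq, LinearMap.mem_ker.1 h2]
  simp only [hR, map_smul, hE, smul_zero, map_zero, sub_zero]
  push_cast
  module

theorem act_rel (k : Fin 3 → ℝ) (n : ℕ) (i j : Fin 3) :
    Commute (act k n i * act k n (i + 1) + act k n (i + 1) * act k n i - act k n (i + 2))
      (act k n j) := by
  have : act k n i * act k n (i + 1) + act k n (i + 1) * act k n i - act k n (i + 2)
      = ((2 * (k i * k (i + 1) + (-1) ^ n * (k 0 + k 1 + k 2 + n + 1) * k (i + 2)) : ℝ) : ℂ)
        • 1 := by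
    refine LinearMap.ext fun f => Subtype.ext ?_
    exact biOp_quad k n i f.2
  rw [this]
  exact (Commute.one_left _).smul_left _

/-- `t = -2k` if `2k` is an odd negative integer, and `t = ∞` otherwise. -/
noncomputable def tval (k : ℝ) : ℕ∞ :=
  open Classical in if ∃ m : ℕ, Odd m ∧ -2 * k = m then (⌊-2 * k⌋₊ : ℕ∞) else ⊤

theorem tval_of_odd {k : ℝ} {m : ℕ} (hm : Odd m) (h : -2 * k = m) : tval k = m := by
  rw [tval, if_pos ⟨m, hm, h⟩, h, Nat.floor_natCast]

theorem tval_cases (k : ℝ) : (∃ m : ℕ, Odd m ∧ -2 * k = m ∧ tval k = m) ∨ tval k = ⊤ := by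
  by_cases h : ∃ m : ℕ, Odd m ∧ -2 * k = m
  · obtain ⟨m, hm, h⟩ := h
    exact Or.inl ⟨m, hm, h, tval_of_odd hm h⟩
  · exact Or.inr (if_neg h)

theorem even_pred_tval (k : ℝ) : Even ((tval k).toNat - 1) := by
  rcases tval_cases k with ⟨m, hm, -, h⟩ | h
  · rw [h, ENat.toNat_natCast]
    exact Nat.Odd.sub_odd hm odd_one
  · simp [h]

theorem odd_sub_tval {n : ℕ} (hn : Odd n) {k l : ℝ} (h : tval k + tval l ≤ n) :
    Odd (n - (tval k).toNat - (tval l).toNat) := by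
  rcases tval_cases k with ⟨m, hm, -, hk⟩ | hk
  · rcases tval_cases l with ⟨m', hm', -, hl⟩ | hl
    · rw [hk, hl] at h ⊢
      have h' : m + m' ≤ n := by exact_mod_cast h
      rw [ENat.toNat_natCast, ENat.toNat_natCast, Nat.sub_sub]
      exact Nat.Odd.sub_even h' hn (hm.add_odd hm')
    · simp [hl] at h
  · simp [hk] at h

/-- The subspace `⨁_{i=t}^n x_j^i · ℝ[the other two variables]_{n-i}` of `ℝ[x₁,x₂,x₃]_n` (zero if
`n < t`, in particular if `t = ∞`). -/
noncomputable def xFilt (t : ℕ∞) (n : ℕ) (j : Fin 3) : Submodule ℝ Poly :=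
  ⨆ (i : ℕ) (_ : t ≤ i) (_ : i ≤ n),
    (homogeneousSubmodule (Fin 3) ℝ (n - i) ⊓ Subalgebra.toSubmodule (supported ℝ {j}ᶜ)).map
      (LinearMap.mulLeft ℝ (X j ^ i))

theorem xFilt_eq (t : ℕ∞) (n : ℕ) (j : Fin 3) :
    xFilt t n j = restrictSupport ℝ {a | a.degree = n ∧ t ≤ a j} := by
  apply le_antisymm
  · refine iSup_le fun i => iSup_le fun ht => iSup_le fun hi => ?_
    rintro _ ⟨f, ⟨hf1, hf2⟩, rfl⟩
    rw [mem_restrictSupport_iff]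
    intro a ha
    rw [Finset.mem_coe, mem_support_iff, LinearMap.mulLeft_apply, X_pow_eq_monomial,
      coeff_monomial_mul'] at ha
    split_ifs at ha with hle
    · rw [one_mul] at ha
      have h1 : (a - Finsupp.single j i).degree = n - i := by
        by_contra h
        exact ha (IsHomogeneous.coeff_eq_zero hf1 h)
      have h3 : a - Finsupp.single j i + Finsupp.single j i = a := tsub_add_cancel_of_le hle
      have h4 : a.degree = n := by
        rw [← h3, map_add, h1, Finsupp.degree_single]
        omega
      refine ⟨h4, ht.trans ?_⟩
      have := hle j
      rw [Finsupp.single_eq_same] at this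
      exact_mod_cast this
    · exact absurd rfl ha
  · rw [restrictSupport_eq_span, Submodule.span_le]
    rintro _ ⟨a, ⟨hd, ht⟩, rfl⟩
    have hle : a j ≤ n := by
      rw [← hd]
      exact Finsupp.le_degree j a
    refine Submodule.mem_iSup_of_mem (a j) (Submodule.mem_iSup_of_mem ht
      (Submodule.mem_iSup_of_mem hle ?_))
    have h0 : Finsupp.single j (a j) + a.erase j = a := Finsupp.single_add_erase j a
    refine ⟨monomial (a.erase j) 1, ⟨?_, ?_⟩, ?_⟩
    · refine isHomogeneous_monomial _ ?_
      have h1 := congrArg Finsupp.degree h0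
      rw [map_add, Finsupp.degree_single, hd] at h1
      omega
    · refine mem_supported.2 fun i hi => ?_
      rw [vars_monomial one_ne_zero] at hi
      rintro rfl
      simp at hi
    · rw [LinearMap.mulLeft_apply, X_pow_eq_monomial, monomial_mul, h0, mul_one]

theorem stable_filt (k : Fin 3 → ℝ) (n : ℕ) (l : Fin 3) :
    Stable k {a | a.degree = n ∧ tval (k l) ≤ a l} := by
  rintro a ⟨hd, ht⟩ i j hij h0
  have hi : a i ≠ 0 := fun h => h0 (by simp [h])
  refine ⟨(degree_move hi).trans hd, ?_⟩
  by_cases hil : i = l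
  · subst hil
    rcases tval_cases (k i) with ⟨m, hm, hk, h⟩ | h
    · rw [h] at ht ⊢
      have ht' : m ≤ a i := by exact_mod_cast ht
      have hne : a i ≠ m := by
        intro h1
        apply h0
        rw [h1, hm.neg_one_pow, ← hk]
        ring
      have : m ≤ a i - 1 := by omega
      have h2 : (a - Finsupp.single i 1 + Finsupp.single j 1 : Fin 3 →₀ ℕ) i = a i - 1 := by simp [hij]
      rw [h2]
      exact_mod_cast this
    · rw [h, top_le_iff] at ht
      exact absurd ht (ENat.natCast_ne_top _)
  · refine ht.trans ?_
    simp [hil]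

/-- The `BI`-module structure on `𝓜_n`, see `gen_smul`. -/
noncomputable instance (k : Fin 3 → ℝ) (n : ℕ) : Module BI (monogenics k n) :=
  Module.compHom (monogenics k n)
    (BI.lift (act k n) (act_rel k n) : BI →+* Module.End ℂ (monogenics k n))

theorem gen_smul (k : Fin 3 → ℝ) (n : ℕ) (j : Fin 3) (f : monogenics k n) :
    ((BI.gen j • f : monogenics k n) : Spinor) = biOp k j f := by
  change ((BI.lift (act k n) (act_rel k n) (BI.gen j) f : monogenics k n) : Spinor) = _
  rw [BI.lift_gen]
  rfl

theorem algebraMap_smul_monogenics (k : Fin 3 → ℝ) (n : ℕ) (c : ℂ) (f : monogenics k n) :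
    algebraMap ℂ BI c • f = c • f := by
  change BI.lift (act k n) (act_rel k n) (algebraMap ℂ BI c) f = _
  rw [AlgHom.commutes]
  rfl

theorem BI.induction {p : BI → Prop} (h1 : ∀ c : ℂ, p (algebraMap ℂ BI c))
    (h2 : ∀ j, p (BI.gen j)) (h3 : ∀ a b, p a → p b → p (a * b))
    (h4 : ∀ a b, p a → p b → p (a + b)) (u : BI) : p u := by
  obtain ⟨w, rfl⟩ := RingQuot.mkAlgHom_surjective ℂ Rel u
  change p (BI.mk w)
  induction w using FreeAlgebra.induction with
  | grade0 c => rw [AlgHom.commutes]; exact h1 c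
  | grade1 j => exact h2 j
  | mul a b ha hb => rw [map_mul]; exact h3 _ _ ha hb
  | add a b ha hb => rw [map_add]; exact h4 _ _ ha hb

/-- The `BI`-submodule `𝓜_n(x_j) = 𝓜_n ∩ ⨁_{i=t_j}^n ℂ² ⊗ (x_j^i · ℝ[other variables]_{n-i})`. -/
noncomputable def Mx (k : Fin 3 → ℝ) (n : ℕ) (j : Fin 3) : Submodule BI (monogenics k n) where
  carrier := {f | (f : Spinor) ∈ tensSub (xFilt (tval (k j)) n j)}
  zero_mem' := Submodule.zero_mem (tensSub (xFilt (tval (k j)) n j))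
  add_mem' hf hg := Submodule.add_mem (tensSub (xFilt (tval (k j)) n j)) hf hg
  smul_mem' u := by
    induction u using BI.induction with
    | h1 c =>
      intro f hf
      rw [algebraMap_smul_monogenics]
      exact Submodule.smul_mem (tensSub (xFilt (tval (k j)) n j)) c hf
    | h2 i =>
      intro f hf
      change (f : Spinor) ∈ tensSub _ at hf
      change ((BI.gen i • f : monogenics k n) : Spinor) ∈ tensSub _
      rw [xFilt_eq] at hf ⊢
      rw [gen_smul]
      exact biOp_mem (stable_filt k n j) i hf
    | h3 a b ha hb =>
      intro f hf
      rw [mul_smul]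
      exact ha (hb hf)
    | h4 a b ha hb =>
      intro f hf
      rw [add_smul]
      exact Submodule.add_mem (tensSub (xFilt (tval (k j)) n j)) (ha hf) (hb hf)

/-- `M` is isomorphic, as a `BI`-module, to a direct sum of two copies of `V`. -/
def TwoCopies (M V : Type*) [AddCommGroup M] [Module BI M] [AddCommGroup V] [Module BI V] : Prop :=
  Nonempty (M ≃ₗ[BI] V × V)

end BannaiIto

open BannaiIto

namespace BannaiIto

/-! ### Complex structures on `BI`-modules and homomorphisms -/

noncomputable instance (d : ℕ) (hd : Odd d) (a b c : ℂ) : Module ℂ (E d hd a b c) :=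
  inferInstanceAs (Module ℂ (Fin (d + 1) → ℂ))

noncomputable instance (d : ℕ) (hd : Even d) (a b c : ℂ) : Module ℂ (O d hd a b c) :=
  inferInstanceAs (Module ℂ (Fin (d + 1) → ℂ))

instance (d : ℕ) (hd : Odd d) (a b c : ℂ) : IsScalarTower ℂ BI (E d hd a b c) where
  smul_assoc x u v := by
    change Matrix.toLinAlgEquiv' (repE d hd a b c (x • u)) v
      = x • Matrix.toLinAlgEquiv' (repE d hd a b c u) v
    rw [map_smul, map_smul]; rfl

instance (d : ℕ) (hd : Even d) (a b c : ℂ) : IsScalarTower ℂ BI (O d hd a b c) where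
  smul_assoc x u v := by
    change Matrix.toLinAlgEquiv' (repO d hd a b c (x • u)) v
      = x • Matrix.toLinAlgEquiv' (repO d hd a b c u) v
    rw [map_smul, map_smul]; rfl

noncomputable instance (g : BI ≃ₐ[ℂ] BI) (V : Type*) [AddCommGroup V] [h : Module ℂ V] :
    Module ℂ (Twist g V) := h

instance (g : BI ≃ₐ[ℂ] BI) (V : Type*) [AddCommGroup V] [Module ℂ V] [Module BI V]
    [IsScalarTower ℂ BI V] : IsScalarTower ℂ BI (Twist g V) where
  smul_assoc x u v := by
    change g (x • u) • (show V from v) = x • (g u • (show V from v))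
    rw [map_smul, smul_assoc]

instance (k : Fin 3 → ℝ) (n : ℕ) : IsScalarTower ℂ BI (monogenics k n) where
  smul_assoc x u v := by
    rw [Algebra.smul_def, mul_smul, algebraMap_smul_monogenics]

section
variable {V W : Type*} [AddCommGroup V] [Module ℂ V] [Module BI V] [IsScalarTower ℂ BI V]
  [AddCommGroup W] [Module ℂ W] [Module BI W] [IsScalarTower ℂ BI W]

theorem BI.smul_complex_smul (u : BI) (c : ℂ) (v : V) : u • c • v = c • u • v := by
  rw [← algebraMap_smul BI c v, ← algebraMap_smul BI c (u • v), ← mul_smul, ← mul_smul,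
    Algebra.commutes]

/-- The operator by which an element of `BI` acts. -/
noncomputable def BI.op (V : Type*) [AddCommGroup V] [Module ℂ V] [Module BI V] [IsScalarTower ℂ BI V]
    (u : BI) : V →ₗ[ℂ] V where
  toFun v := u • v
  map_add' := smul_add u
  map_smul' c v := BI.smul_complex_smul u c v

@[simp] theorem BI.op_apply (u : BI) (v : V) : BI.op V u v = u • v := rfl

/-- A `ℂ`-linear map commuting with the generators is `BI`-linear. -/
noncomputable def BI.linearMap (f : V →ₗ[ℂ] W) (h : ∀ j v, f (BI.gen j • v) = BI.gen j • f v) :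
    V →ₗ[BI] W where
  toFun := f
  map_add' := map_add f
  map_smul' u := by
    induction u using BI.induction with
    | h1 c => intro v; simp
    | h2 j => exact h j
    | h3 a b ha hb => intro v; simp only [mul_smul, ha, hb, RingHom.id_apply]
    | h4 a b ha hb => intro v; simp only [add_smul, map_add, ha, hb, RingHom.id_apply]

@[simp] theorem BI.linearMap_apply (f : V →ₗ[ℂ] W)
    (h : ∀ j v, f (BI.gen j • v) = BI.gen j • f v) (v : V) : BI.linearMap f h v = f v := rfl

/-- `X_{i+1} X_{i+2} + X_{i+2} X_{i+1} - X_i` acts as the scalar `s i`. -/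
def Central (V : Type*) [AddCommGroup V] [Module ℂ V] [Module BI V] (s : Fin 3 → ℂ) : Prop :=
  ∀ i (v : V), BI.gen (i + 1) • BI.gen (i + 2) • v + BI.gen (i + 2) • BI.gen (i + 1) • v
    - BI.gen i • v = s i • v

theorem Central.twist {s : Fin 3 → ℂ} (hV : Central V s) (ε : ℤˣ × ℤˣ) (σ : Equiv.Perm (Fin 3)) :
    Central (Twist (BI.aut ε σ) V) (fun i => ((sgn ε (σ i) : ℤ) : ℂ) * s (σ i)) := by
  intro i
  have key : ∀ p q r : Fin 3, p ≠ q → q ≠ r → p ≠ r → ∀ v : V,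
      BI.gen q • BI.gen r • v + BI.gen r • BI.gen q • v - BI.gen p • v = s p • v := by
    intro p q r h1 h2 h3 v
    have : (q = p + 1 ∧ r = p + 2) ∨ (r = p + 1 ∧ q = p + 2) := by revert p q r; decide
    rcases this with ⟨rfl, rfl⟩ | ⟨rfl, rfl⟩
    · exact hV p v
    · rw [add_comm (BI.gen _ • _)]; exact hV p v
  have sg : ∀ p q r : Fin 3, p ≠ q → q ≠ r → p ≠ r →
      ((sgn ε q : ℤ) : ℂ) * ((sgn ε r : ℤ) : ℂ) = ((sgn ε p : ℤ) : ℂ) := by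
    intro p q r h1 h2 h3
    have : (r = q + 1 ∧ p = q + 2) ∨ (q = r + 1 ∧ p = r + 2) := by clear * - h1 h2 h3; revert p q r; decide
    rcases this with ⟨rfl, rfl⟩ | ⟨rfl, rfl⟩
    · exact sgn_mul ε q
    · rw [mul_comm]; exact sgn_mul ε r
  have hs := sg (σ i) (σ (i + 1)) (σ (i + 2)) (by simp) (by simp) (by simp)
  suffices H : ∀ v : V, BI.aut ε σ (BI.gen (i + 1)) • BI.aut ε σ (BI.gen (i + 2)) • v
      + BI.aut ε σ (BI.gen (i + 2)) • BI.aut ε σ (BI.gen (i + 1)) • v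
      - BI.aut ε σ (BI.gen i) • v = (((sgn ε (σ i) : ℤ) : ℂ) * s (σ i)) • v from H
  intro v
  have hk := key (σ i) (σ (i + 1)) (σ (i + 2)) (by simp) (by simp) (by simp) v
  simp only [BI.aut_gen, smul_assoc, BI.smul_complex_smul]
  rw [mul_smul, ← hk, ← hs]
  generalize BI.gen (σ (i + 1)) • BI.gen (σ (i + 2)) • v = x
  generalize BI.gen (σ (i + 2)) • BI.gen (σ (i + 1)) • v = y
  generalize BI.gen (σ i) • v = z
  module

end

/-- If two of the generators commute with `f`, so does the third one. -/
theorem Central.third {V W : Type*} [AddCommGroup V] [Module ℂ V] [Module BI V]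
    [AddCommGroup W] [Module ℂ W] [Module BI W] {s : Fin 3 → ℂ} (hV : Central V s)
    (hW : Central W s) (f : V →ₗ[ℂ] W)
    (i : Fin 3) (h1 : ∀ v, f (BI.gen (i + 1) • v) = BI.gen (i + 1) • f v)
    (h2 : ∀ v, f (BI.gen (i + 2) • v) = BI.gen (i + 2) • f v) (j : Fin 3) (v : V) :
    f (BI.gen j • v) = BI.gen j • f v := by
  have hi : ∀ v, f (BI.gen i • v) = BI.gen i • f v := by
    intro v
    have e1 := congrArg f (hV i v)
    have e2 := hW i (f v)
    simp only [map_sub, map_add, map_smul, h1, h2] at e1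
    rw [← e2] at e1
    exact sub_right_injective e1
  have : j = i ∨ j = i + 1 ∨ j = i + 2 := by clear * -; revert i j; decide
  rcases this with rfl | rfl | rfl
  · exact hi v
  · exact h1 v
  · exact h2 v

theorem Central.of_injective {V W : Type*} [AddCommGroup V] [Module ℂ V] [Module BI V]
    [AddCommGroup W] [Module ℂ W] [Module BI W] {s : Fin 3 → ℂ} (hW : Central W s) (f : V →ₗ[BI] W)
    (hf : Function.Injective f) (hc : ∀ (c : ℂ) v, f (c • v) = c • f v) : Central V s := by
  intro i v
  apply hf
  rw [map_sub, map_add, hc]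
  simp only [map_smul]
  exact hW i (f v)

/-! ### Twists -/

section
variable {V W : Type*} [AddCommGroup V] [Module BI V] [AddCommGroup W] [Module BI W]

/-- Twisting is functorial. -/
noncomputable def Twist.congr (g : BI ≃ₐ[ℂ] BI) (f : V ≃ₗ[BI] W) : Twist g V ≃ₗ[BI] Twist g W where
  toFun v := f (show V from v)
  invFun v := f.symm (show W from v)
  left_inv _ := f.symm_apply_apply _
  right_inv _ := f.apply_symm_apply _
  map_add' v w := map_add f (show V from v) (show V from w)
  map_smul' u v := map_smul f (g u) (show V from v)

/-- An iterated twist is a twist by the composition. -/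
noncomputable def Twist.comp (g h l : BI ≃ₐ[ℂ] BI) (hl : ∀ u, h (g u) = l u) :
    Twist g (Twist h V) ≃ₗ[BI] Twist l V where
  toFun v := v
  invFun v := v
  left_inv _ := rfl
  right_inv _ := rfl
  map_add' _ _ := rfl
  map_smul' u v := by
    change h (g u) • (show V from v) = l u • (show V from v)
    rw [hl]

/-- The twist by the identity. -/
noncomputable def Twist.one (g : BI ≃ₐ[ℂ] BI) (hg : ∀ u, g u = u) : Twist g V ≃ₗ[BI] V where
  toFun v := v
  invFun v := v
  left_inv _ := rfl
  right_inv _ := rfl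
  map_add' _ _ := rfl
  map_smul' u v := by
    change g u • (show V from v) = u • (show V from v)
    rw [hg]

theorem BI.aut_ext {f g : BI →ₐ[ℂ] BI} (h : ∀ j, f (BI.gen j) = g (BI.gen j)) (u : BI) :
    f u = g u := by rw [BI.hom_ext h]

theorem Twist.isSimpleModule (g : BI ≃ₐ[ℂ] BI) (h : IsSimpleModule BI V) :
    IsSimpleModule BI (Twist g V) := by
  rw [isSimpleModule_iff_toSpanSingleton_surjective] at h ⊢
  refine ⟨h.1, fun x hx y => ?_⟩
  obtain ⟨u, hu⟩ := h.2 (show V from x) hx (show V from y)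
  refine ⟨g.symm u, ?_⟩
  change g (g.symm u) • (show V from x) = _
  rw [g.apply_symm_apply]
  exact hu

end

end BannaiIto

namespace BannaiIto

/-! ### Chains of vectors -/

/-- The scalar identities between the diagonals `θ`, `θs` and the superdiagonal `φ` of a pair of
bidiagonal operators `A`, `B` with `A²B + 2ABA + BA² = 2κA + B + μ`. -/
structure ChainData (θ θs φ : ℕ → ℂ) (κ μ : ℂ) : Prop where
  phi_zero : φ 0 = 0
  sq : ∀ i, (θ i + θ (i + 1)) ^ 2 = 1
  star : ∀ i, θs i + 2 * θs (i + 1) + θs (i + 2) = 0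
  diag_one : ∀ i, φ i + 2 * φ (i + 1) + φ (i + 2) + θs i * (θ (i + 1) + θ i)
    + 2 * θs (i + 1) * θ (i + 1) + 2 * θ i * θs i + (θ (i + 1) + θ i) * θs (i + 1) = 2 * κ
  diag : ∀ i, φ i * (θ i + θ (i - 1)) + θs i * θ i ^ 2 + 2 * (φ (i + 1) + θ i * θs i) * θ i
    + 2 * θ i * φ i + (θ (i + 1) + θ i) * φ (i + 1) + θ i ^ 2 * θs i = 2 * κ * θ i + θs i + μ

section
variable {V : Type*} [AddCommGroup V] [Module ℂ V]

/-- The vectors `(A - θ_{i-1}) ⋯ (A - θ_0) v`. -/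
def chain (A : V →ₗ[ℂ] V) (θ : ℕ → ℂ) (v : V) : ℕ → V
  | 0 => v
  | i + 1 => A (chain A θ v i) - θ i • chain A θ v i

theorem chain_step {A B : V →ₗ[ℂ] V} {κ μ : ℂ}
    (rel : ∀ v, A (A (B v)) + (2 : ℂ) • A (B (A v)) + B (A (A v)) = (2 * κ) • A v + B v + μ • v)
    {θ θs φ : ℕ → ℂ} (H : ChainData θ θs φ κ μ) (i : ℕ) {w w1 w2 z : V}
    (hw : A w = w1 + θ i • w) (hw1 : A w1 = w2 + θ (i + 1) • w1)
    (hz : A z = φ i • w + θ (i - 1) • z) (hz0 : i = 0 → z = 0)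
    (hB : B w = θs i • w + z) (hB1 : B w1 = θs (i + 1) • w1 + φ (i + 1) • w) :
    B w2 = θs (i + 2) • w2 + φ (i + 2) • w1 := by
  have h := rel w
  simp only [hw, hB, hw1, hB1, map_add, map_smul, hz] at h
  have hzz : ((θ i + θ (i - 1)) ^ 2 - 1) • z = 0 := by
    rcases i with _ | i
    · rw [hz0 rfl, smul_zero]
    · rw [Nat.add_sub_cancel, add_comm, H.sq, sub_self, zero_smul]
  have h1 : (θs i + 2 * θs (i + 1) + θs (i + 2)) • w2 = 0 := by rw [H.star, zero_smul]
  have h2 : _ • w1 = _ • w1 := congrArg (· • w1) (H.diag_one i)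
  have h3 : _ • w = _ • w := congrArg (· • w) (H.diag i)
  linear_combination (norm := module) h - hzz - h1 - h2 - h3

theorem chain_lower {A B : V →ₗ[ℂ] V} {κ μ : ℂ}
    (rel : ∀ v, A (A (B v)) + (2 : ℂ) • A (B (A v)) + B (A (A v)) = (2 * κ) • A v + B v + μ • v)
    {θ θs φ : ℕ → ℂ} (H : ChainData θ θs φ κ μ) {v : V} (h0 : B v = θs 0 • v)
    (h1 : B (chain A θ v 1) = θs 1 • chain A θ v 1 + φ 1 • v) (i : ℕ) :
    B (chain A θ v (i + 1)) = θs (i + 1) • chain A θ v (i + 1) + φ (i + 1) • chain A θ v i := by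
  have hA : ∀ i, A (chain A θ v i) = chain A θ v (i + 1) + θ i • chain A θ v i := fun i => by
    simp [chain]
  induction i using Nat.strong_induction_on with
  | _ i ih =>
  rcases i with _ | _ | i
  · exact h1
  · exact chain_step rel H 0 (hA 0) (hA 1) (z := 0) (by simp [H.phi_zero]) (fun _ => rfl)
      (by rw [add_zero]; exact h0) h1
  · refine chain_step rel H (i + 1) (hA _) (hA _) (z := φ (i + 1) • chain A θ v i) ?_ (by simp)
      (ih i (by omega)) (ih (i + 1) (by omega))
    rw [map_smul, hA, Nat.add_sub_cancel, smul_add, smul_comm]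

open Polynomial in
theorem chain_eq_aeval (A : V →ₗ[ℂ] V) (θ : ℕ → ℂ) (v : V) (i : ℕ) :
    chain A θ v i = aeval A (∏ j ∈ Finset.range i, (X - C (θ j))) v := by
  induction i with
  | zero => simp [chain]
  | succ i ih =>
    rw [chain, ih, Finset.prod_range_succ, mul_comm, map_mul, Module.End.mul_apply]
    simp

end

/-! ### Modules with split bases -/

/-- A `BI`-module on which the generators `gen 0` and `gen 1` act by the matrices `matX d θ` and
`matY d θs φ`, and the central elements by scalars. -/
structure Split (V : Type*) [AddCommGroup V] [Module ℂ V] [Module BI V] (d : ℕ)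
    (θ θs φ : ℕ → ℂ) (s : Fin 3 → ℂ) where
  e : V ≃ₗ[ℂ] (Fin (d + 1) → ℂ)
  e_zero : ∀ v, e (BI.gen 0 • v) = (matX d θ).mulVec (e v)
  e_one : ∀ v, e (BI.gen 1 • v) = (matY d θs φ).mulVec (e v)
  central : Central V s
  data : ChainData θ θs φ (s 2) (s 1)
  last : φ (d + 1) = 0

theorem Central.rel {V : Type*} [AddCommGroup V] [Module ℂ V] [Module BI V] [IsScalarTower ℂ BI V]
    {s : Fin 3 → ℂ} (h : Central V s) (v : V) :
    BI.gen 0 • BI.gen 0 • BI.gen 1 • v + (2 : ℂ) • BI.gen 0 • BI.gen 1 • BI.gen 0 • v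
      + BI.gen 1 • BI.gen 0 • BI.gen 0 • v
      = (2 * s 2) • BI.gen 0 • v + BI.gen 1 • v + s 1 • v := by
  have h1 := h 1 v
  have h2 : ∀ v : V, BI.gen 2 • v = BI.gen 0 • BI.gen 1 • v + BI.gen 1 • BI.gen 0 • v - s 2 • v :=
    fun v => by rw [← h 2 v]; exact (sub_sub_cancel _ _).symm
  change BI.gen 2 • BI.gen 0 • v + BI.gen 0 • BI.gen 2 • v - BI.gen 1 • v = _ at h1
  simp only [h2, smul_sub, smul_add, BI.smul_complex_smul] at h1
  rw [← h1]
  generalize BI.gen 0 • BI.gen 0 • BI.gen 1 • v = x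
  generalize BI.gen 0 • BI.gen 1 • BI.gen 0 • v = y
  generalize BI.gen 1 • BI.gen 0 • BI.gen 0 • v = z
  generalize BI.gen 0 • v = w
  generalize BI.gen 1 • v = u
  module

namespace Split

section
variable {V : Type*} [AddCommGroup V] [Module ℂ V] [Module BI V] {d : ℕ}
  {θ θs φ : ℕ → ℂ} {s : Fin 3 → ℂ} (S : Split V d θ θs φ s)
include S

/-- The basis vectors, extended by zero. -/
noncomputable def b (i : ℕ) : V := if h : i < d + 1 then S.e.symm (Pi.single ⟨i, h⟩ 1) else 0

theorem e_b {i : ℕ} (h : i < d + 1) : S.e (S.b i) = Pi.single ⟨i, h⟩ 1 := by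
  rw [b, dif_pos h, LinearEquiv.apply_symm_apply]

theorem b_last : S.b (d + 1) = 0 := dif_neg (by omega)

theorem sum_b (v : V) : v = ∑ i : Fin (d + 1), S.e v i • S.b i := by
  apply S.e.injective
  rw [map_sum]
  simp only [map_smul, S.e_b (Fin.is_lt _)]
  ext j
  simp [Pi.single_apply]

theorem gen_zero_b {i : ℕ} (h : i ≤ d) : BI.gen 0 • S.b i = θ i • S.b i + S.b (i + 1) := by
  apply S.e.injective
  rw [S.e_zero, map_add, map_smul, S.e_b (Nat.lt_succ_of_le h), Matrix.mulVec_single_one]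
  by_cases h1 : i + 1 < d + 1
  · rw [S.e_b h1]
    ext j
    simp only [Matrix.col_apply, matX, Matrix.of_apply, Pi.add_apply, Pi.smul_apply,
      Pi.single_apply, Fin.ext_iff, smul_eq_mul]
    by_cases h2 : (j : ℕ) = i
    · simp [h2]
    · simp [h2]
  · rw [b, dif_neg h1, map_zero, add_zero]
    ext j
    have := j.2
    simp only [Matrix.col_apply, matX, Matrix.of_apply, Pi.smul_apply,
      Pi.single_apply, Fin.ext_iff, smul_eq_mul]
    by_cases h2 : (j : ℕ) = i
    · simp [h2]
    · rw [if_neg h2, if_neg h2, if_neg (by omega), mul_zero]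

theorem gen_one_b {i : ℕ} (h : i ≤ d) :
    BI.gen 1 • S.b i = θs i • S.b i + φ i • S.b (i - 1) := by
  apply S.e.injective
  rw [S.e_one, map_add, map_smul, map_smul, S.e_b (Nat.lt_succ_of_le h), S.e_b (i := i - 1) (by omega),
    Matrix.mulVec_single_one]
  ext j
  simp only [Matrix.col_apply, matY, Matrix.of_apply, Pi.add_apply, Pi.smul_apply,
      Pi.single_apply, Fin.ext_iff, smul_eq_mul]
  rcases i with _ | i
  · by_cases h2 : (j : ℕ) = 0 <;> simp [h2, S.data.phi_zero]
  · by_cases h2 : (j : ℕ) = i + 1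
    · simp [h2]
    · simp [h2, eq_comm]

/-- The coordinates, extended by zero. -/
noncomputable def coord (v : V) (i : ℕ) : ℂ := if h : i < d + 1 then S.e v ⟨i, h⟩ else 0

theorem e_eq (v : V) : S.e v = fun i : Fin (d + 1) => S.coord v i := by
  ext i
  rw [coord, dif_pos i.2]

theorem coord_eq_zero {v : V} (h : ∀ i, i ≤ d → S.coord v i = 0) : v = 0 := by
  apply S.e.injective
  rw [S.e_eq, map_zero]
  ext i
  exact h i (Nat.le_of_lt_succ i.2)

theorem coord_zero_smul (v : V) {i : ℕ} (h : i ≤ d) :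
    S.coord (BI.gen 0 • v) i = seqX θ (S.coord v) i := by
  have := S.e_zero v
  rw [S.e_eq v, matX_mulVec, S.e_eq] at this
  exact congrFun this ⟨i, Nat.lt_succ_of_le h⟩

theorem coord_one_smul (v : V) {i : ℕ} (h : i ≤ d) :
    S.coord (BI.gen 1 • v) i = seqY θs φ (S.coord v) i := by
  have := S.e_one v
  rw [S.e_eq v, matY_mulVec _ _ _ _ S.last, S.e_eq] at this
  exact congrFun this ⟨i, Nat.lt_succ_of_le h⟩

theorem coord_smul (c : ℂ) (v : V) (i : ℕ) : S.coord (c • v) i = c * S.coord v i := by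
  unfold coord
  split_ifs <;> simp

theorem eq_zero_of_gen_zero {τ : ℂ} (hτ : ∀ i ≤ d, θ i ≠ τ) {y : V} (hy : BI.gen 0 • y = τ • y) :
    y = 0 := by
  refine S.coord_eq_zero fun i => ?_
  induction i with
  | zero =>
    intro hi
    have h := S.coord_zero_smul y hi
    rw [hy, coord_smul, seqX] at h
    have : (θ 0 - τ) * S.coord y 0 = 0 := by linear_combination -h
    exact (mul_eq_zero.1 this).resolve_left (sub_ne_zero.2 (hτ 0 hi))
  | succ i ih =>
    intro hi
    have h := S.coord_zero_smul y hi
    rw [hy, coord_smul, seqX, ih (by omega)] at h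
    have : (θ (i + 1) - τ) * S.coord y (i + 1) = 0 := by linear_combination -h
    exact (mul_eq_zero.1 this).resolve_left (sub_ne_zero.2 (hτ _ hi))

theorem eq_zero_of_gen_one {τ : ℂ} (hτ : ∀ i ≤ d, θs i ≠ τ) {y : V} (hy : BI.gen 1 • y = τ • y) :
    y = 0 := by
  have key : ∀ j, j ≤ d → S.coord y (d - j) = 0 := by
    intro j
    induction j with
    | zero =>
      intro _
      have h := S.coord_one_smul y (le_refl d)
      rw [hy, coord_smul, seqY, S.last] at h
      have : (θs d - τ) * S.coord y d = 0 := by linear_combination -h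
      exact (mul_eq_zero.1 this).resolve_left (sub_ne_zero.2 (hτ d le_rfl))
    | succ j ih =>
      intro hj
      have h := S.coord_one_smul y (Nat.sub_le d (j + 1))
      rw [hy, coord_smul, seqY, show d - (j + 1) + 1 = d - j by omega, ih (by omega)] at h
      have : (θs (d - (j + 1)) - τ) * S.coord y (d - (j + 1)) = 0 := by linear_combination -h
      exact (mul_eq_zero.1 this).resolve_left (sub_ne_zero.2 (hτ _ (Nat.sub_le _ _)))
  refine S.coord_eq_zero fun i hi => ?_
  have := key (d - i) (Nat.sub_le _ _)
  rwa [Nat.sub_sub_self hi] at this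

end

/-! ### Homomorphisms out of a module with a split basis -/

section
variable {V W : Type*} [AddCommGroup V] [Module ℂ V] [Module BI V] [IsScalarTower ℂ BI V]
  [AddCommGroup W] [Module ℂ W] [Module BI W] [IsScalarTower ℂ BI W] {d : ℕ}
  {θ θs φ : ℕ → ℂ} {s : Fin 3 → ℂ} (S : Split V d θ θs φ s)

theorem exists_hom_of_chain (hW : Central W s) {w : W} (h0 : BI.gen 1 • w = θs 0 • w)
    (h1 : BI.gen 1 • (BI.gen 0 • w - θ 0 • w) = θs 1 • (BI.gen 0 • w - θ 0 • w) + φ 1 • w)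
    (hs : chain (BI.op W (BI.gen 0)) θ w (d + 1) = 0) :
    ∃ f : V →ₗ[BI] W, f (S.b 0) = w := by
  set c := chain (BI.op W (BI.gen 0)) θ w with hc
  have lower : ∀ i, BI.gen 1 • c (i + 1) = θs (i + 1) • c (i + 1) + φ (i + 1) • c i :=
    chain_lower (A := BI.op W (BI.gen 0)) (B := BI.op W (BI.gen 1)) (hW.rel) S.data h0 h1
  have raise : ∀ i, BI.gen 0 • c i = θ i • c i + c (i + 1) := fun i => by
    simp [hc, chain]
  have hlast : c (d + 1) = 0 := hs
  let f : V →ₗ[ℂ] W := (Fintype.linearCombination ℂ (fun i : Fin (d + 1) => c i)) ∘ₗ S.e.toLinearMap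
  have fb : ∀ i ≤ d + 1, f (S.b i) = c i := by
    intro i hi
    rcases hi.lt_or_eq with h | rfl
    · simp only [f, LinearMap.comp_apply, LinearEquiv.coe_coe, S.e_b h,
        Fintype.linearCombination_apply_single, one_smul]
    · rw [S.b_last, map_zero, hlast]
  have ext : ∀ (F G : V →ₗ[ℂ] W), (∀ i ≤ d, F (S.b i) = G (S.b i)) → ∀ v, F v = G v := by
    intro F G h v
    rw [S.sum_b v, map_sum, map_sum]
    refine Finset.sum_congr rfl fun i _ => ?_
    rw [map_smul, map_smul, h i (Nat.le_of_lt_succ i.2)]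
  have f0 : ∀ v, f (BI.gen 0 • v) = BI.gen 0 • f v :=
    ext (f ∘ₗ BI.op V (BI.gen 0)) (BI.op W (BI.gen 0) ∘ₗ f) fun i hi => by
      simp only [LinearMap.comp_apply, BI.op_apply]
      rw [S.gen_zero_b hi, map_add, map_smul, fb _ (by omega), fb _ (by omega), raise]
  have f1 : ∀ v, f (BI.gen 1 • v) = BI.gen 1 • f v :=
    ext (f ∘ₗ BI.op V (BI.gen 1)) (BI.op W (BI.gen 1) ∘ₗ f) fun i hi => by
      simp only [LinearMap.comp_apply, BI.op_apply]
      rw [S.gen_one_b hi, map_add, map_smul, map_smul, fb _ (by omega), fb _ (by omega)]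
      rcases i with _ | i
      · rw [S.data.phi_zero, zero_smul, add_zero]
        exact h0.symm
      · exact (lower i).symm
  refine ⟨BI.linearMap f (S.central.third hW f 2 f0 f1), ?_⟩
  rw [BI.linearMap_apply, fb 0 (by omega)]
  rfl

theorem exists_hom (hW : Central W s) {w : W} (h0 : BI.gen 1 • w = θs 0 • w)
    (h1 : BI.gen 1 • (BI.gen 0 • w - θ 0 • w) = θs 1 • (BI.gen 0 • w - θ 0 • w) + φ 1 • w)
    (hs : ∀ y : W, BI.gen 1 • y = θs (d + 1) • y → y = 0) :
    ∃ f : V →ₗ[BI] W, f (S.b 0) = w := by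
  refine S.exists_hom_of_chain hW h0 h1 (hs _ ?_)
  have h := chain_lower (A := BI.op W (BI.gen 0)) (B := BI.op W (BI.gen 1)) hW.rel S.data h0 h1 d
  rw [S.last, zero_smul, add_zero] at h
  exact h

end

end Split
end BannaiIto

namespace BannaiIto

/-! ### Reversing the diagonal of the lower bidiagonal generator -/

/-- Data for a second chain starting at the first basis vector, in which the diagonal `θ` is
traversed backwards, after multiplying the lower bidiagonal generator by a sign `ε`. -/
structure ReverseData (d : ℕ) (θ θs φ : ℕ → ℂ) (κ μ ε : ℂ) (θ' φ' : ℕ → ℂ) : Prop where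
  sign : ε * ε = 1
  data : ChainData θ' θs φ' (ε * κ) μ
  rev : ∀ i ≤ d, θ' i = ε * θ (d - i)
  base : φ' 1 = ε * φ 1 + (ε * θ 0 - θ' 0) * (θs 0 - θs 1)

namespace Split

variable {V : Type*} [AddCommGroup V] [Module ℂ V] [Module BI V] [IsScalarTower ℂ BI V] {d : ℕ}
  {θ θs φ θ' φ' : ℕ → ℂ} {s : Fin 3 → ℂ} {ε : ℂ} (S : Split V d θ θs φ s)

/-- The reversed chain. -/
noncomputable def rchain (ε : ℂ) (θ' : ℕ → ℂ) : ℕ → V := chain (ε • BI.op V (BI.gen 0)) θ' (S.b 0)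

theorem gen_zero_rchain (hε : ε * ε = 1) (i : ℕ) : BI.gen 0 • S.rchain ε θ' i
    = (ε * θ' i) • S.rchain ε θ' i + ε • S.rchain ε θ' (i + 1) := by
  simp only [rchain, chain, LinearMap.smul_apply, BI.op_apply, smul_sub, smul_smul, hε, one_smul]
  abel

open Polynomial in
theorem aeval_Ico_b (ε : ℂ) (j : ℕ) (hj : j ≤ d + 1) :
    aeval (ε • BI.op V (BI.gen 0)) (∏ i ∈ Finset.Ico (d + 1 - j) (d + 1), (X - C (ε * θ i)))
      (S.b (d + 1 - j)) = 0 := by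
  induction j with
  | zero => rw [Nat.sub_zero, S.b_last, map_zero]
  | succ j ih =>
    have h1 := ih (by omega)
    rw [Finset.prod_Ico_eq_prod_range] at h1 ⊢
    rw [show d + 1 - (d + 1 - (j + 1)) = j + 1 by omega, Finset.prod_range_succ', map_mul,
      Module.End.mul_apply]
    rw [show d + 1 - (d + 1 - j) = j by omega] at h1
    have h2 : aeval (ε • BI.op V (BI.gen 0)) (X - C (ε * θ (d + 1 - (j + 1) + 0)))
        (S.b (d + 1 - (j + 1))) = ε • S.b (d + 1 - j) := by
      simp only [map_sub, aeval_X, aeval_C, LinearMap.sub_apply, LinearMap.smul_apply, BI.op_apply,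
        Module.algebraMap_end_apply]
      rw [S.gen_zero_b (by omega), add_zero, show d + 1 - (j + 1) + 1 = d + 1 - j by omega]
      module
    rw [h2, map_smul]
    simp only [show ∀ x, d + 1 - (j + 1) + (x + 1) = d + 1 - j + x by intro x; omega]
    rw [h1, smul_zero]

variable (R : ReverseData d θ θs φ (s 2) (s 1) ε θ' φ')
include R

theorem gen_one_rchain (i : ℕ) : BI.gen 1 • S.rchain ε θ' (i + 1)
    = θs (i + 1) • S.rchain ε θ' (i + 1) + φ' (i + 1) • S.rchain ε θ' i := by
  have hb0 : BI.gen 1 • S.b 0 = θs 0 • S.b 0 := by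
    rw [S.gen_one_b (Nat.zero_le d), S.data.phi_zero, zero_smul, add_zero]
  refine chain_lower (A := ε • BI.op V (BI.gen 0)) (B := BI.op V (BI.gen 1)) (fun v => ?_) R.data
    hb0 ?_ i
  · have h := S.central.rel v
    have hs : ∀ x : V, ε • ε • x = x := fun x => by rw [smul_smul, R.sign, one_smul]
    simp only [LinearMap.smul_apply, BI.op_apply, BI.smul_complex_smul, hs]
    rw [smul_smul (2 * (ε * s 2)), show 2 * (ε * s 2) * ε = 2 * s 2 * (ε * ε) by ring, R.sign, mul_one]
    exact h
  · simp only [chain, LinearMap.smul_apply, BI.op_apply]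
    rw [S.gen_zero_b (Nat.zero_le d), smul_sub, BI.smul_complex_smul, smul_add,
      BI.smul_complex_smul, BI.smul_complex_smul, hb0, R.base]
    have h1 : BI.gen 1 • S.b (0 + 1) = θs 1 • S.b 1 + φ 1 • S.b 0 := by
      rcases d with _ | d
      · have hl := S.last
        rw [zero_add] at hl
        rw [zero_add, hl, show S.b 1 = 0 from S.b_last]
        simp
      · rw [zero_add, S.gen_one_b (by omega)]
    rw [h1, zero_add]
    module

open Polynomial in
theorem prod_reverse (k : ℕ) (hk : k ≤ d + 1) :
    ∏ j ∈ Finset.range k, (X - C (θ' j)) = ∏ i ∈ Finset.Ico (d + 1 - k) (d + 1), (X - C (ε * θ i)) := by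
  rw [Finset.prod_Ico_eq_prod_range, show d + 1 - (d + 1 - k) = k by omega, ← Finset.prod_range_reflect]
  refine Finset.prod_congr rfl fun j hj => ?_
  rw [Finset.mem_range] at hj
  rw [R.rev _ (by omega), show d - (k - 1 - j) = d + 1 - k + j by omega]

theorem rchain_last : S.rchain ε θ' (d + 1) = 0 := by
  have := S.aeval_Ico_b ε (d + 1) le_rfl
  rw [← prod_reverse R (d + 1) le_rfl, Nat.sub_self] at this
  rw [rchain, chain_eq_aeval]
  exact this

theorem chain_eq_coord_smul (v : V) :
    chain (ε • BI.op V (BI.gen 0)) θ' v d = S.coord v 0 • S.rchain ε θ' d := by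
  have h0 : ∀ i, 1 ≤ i → i ≤ d →
      chain (ε • BI.op V (BI.gen 0)) θ' (S.b i) d = 0 := by
    intro i h1 h2
    have h := S.aeval_Ico_b ε (d + 1 - i) (by omega)
    rw [show d + 1 - (d + 1 - i) = i by omega] at h
    rw [chain_eq_aeval, prod_reverse R d (by omega), show d + 1 - d = 1 by omega,
      ← Finset.prod_Ico_consecutive _ h1 (by omega : i ≤ d + 1), map_mul, Module.End.mul_apply, h,
      map_zero]
  rw [S.sum_b v, chain_eq_aeval, map_sum, ← S.sum_b v, Fin.sum_univ_succ]
  simp only [map_smul, ← chain_eq_aeval]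
  rw [Finset.sum_eq_zero, add_zero]
  · rfl
  · intro i _
    rw [h0 _ (by simp) (by simp), smul_zero]

theorem b_zero_mem {p : Submodule BI V} (hφ : ∀ i, 1 ≤ i → i ≤ d → φ' i ≠ 0)
    (h : S.rchain ε θ' d ∈ p) : S.b 0 ∈ p := by
  have key : ∀ j ≤ d, S.rchain ε θ' (d - j) ∈ p := by
    intro j
    induction j with
    | zero => intro _; exact h
    | succ j ih =>
      intro hj
      have h1 := ih (by omega)
      have h2 := S.gen_one_rchain R (d - (j + 1))
      rw [show d - (j + 1) + 1 = d - j by omega] at h2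
      have h3 : φ' (d - j) • S.rchain ε θ' (d - (j + 1)) ∈ p := by
        rw [← sub_eq_iff_eq_add'] at h2
        rw [← h2]
        exact p.sub_mem (p.smul_mem _ h1) (p.smul_of_tower_mem _ h1)
      have := p.smul_of_tower_mem (φ' (d - j))⁻¹ h3
      rwa [inv_smul_smul₀ (hφ _ (by omega) (by omega))] at this
  have := key d le_rfl
  rwa [Nat.sub_self] at this

theorem rchain_ne_zero (hφ : ∀ i, 1 ≤ i → i ≤ d → φ' i ≠ 0) : S.rchain ε θ' d ≠ 0 := by
  intro h
  have h1 := S.b_zero_mem R (p := ⊥) hφ (by rw [h]; exact zero_mem _)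
  rw [Submodule.mem_bot] at h1
  have h2 := S.e_b (Nat.succ_pos d)
  rw [h1, map_zero] at h2
  exact Pi.single_ne_zero_iff.2 one_ne_zero h2.symm

include S in
/-- The irreducibility criterion. -/
theorem isSimpleModule (hφ : ∀ i, 1 ≤ i → i ≤ d → φ i ≠ 0)
    (hφ' : ∀ i, 1 ≤ i → i ≤ d → φ' i ≠ 0) : IsSimpleModule BI V := by
  have : Nontrivial V := ⟨_, _, S.rchain_ne_zero R hφ'⟩
  refine (isSimpleModule_iff BI V).2 { eq_bot_or_eq_top := fun p => or_iff_not_imp_left.2 fun hp => ?_ }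
  obtain ⟨w, hw, hw0⟩ := p.ne_bot_iff.1 hp
  have hex : ∃ i, i ≤ d ∧ ∃ w ∈ p, S.coord w i ≠ 0 := by
    by_contra! h
    exact hw0 (S.coord_eq_zero fun i hi => h i hi w hw)
  classical
  have h0 : Nat.find hex = 0 := by
    by_contra hne
    obtain ⟨i, hi⟩ := Nat.exists_eq_succ_of_ne_zero hne
    obtain ⟨h1, w, hw, h2⟩ := Nat.find_spec hex
    have hmin : ∀ w ∈ p, S.coord w i = 0 := by
      intro w hw
      by_contra h3
      exact Nat.find_min hex (m := i) (by omega) ⟨by omega, w, hw, h3⟩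
    have h3 := S.coord_one_smul w (i := i) (by omega)
    rw [hmin _ (p.smul_mem _ hw), seqY, hmin _ hw, mul_zero, zero_add, ← Nat.succ_eq_add_one, ← hi] at h3
    exact mul_ne_zero (hφ _ (by omega) h1) h2 h3.symm
  obtain ⟨-, w, hw, h2⟩ := Nat.find_spec hex
  rw [h0] at h2
  have hch : ∀ i, chain (ε • BI.op V (BI.gen 0)) θ' w i ∈ p := by
    intro i
    induction i with
    | zero => exact hw
    | succ i ih =>
      exact p.sub_mem (p.smul_of_tower_mem ε (p.smul_mem _ ih)) (p.smul_of_tower_mem _ ih)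
  have h3 := hch d
  rw [S.chain_eq_coord_smul R] at h3
  have h4 := p.smul_of_tower_mem (S.coord w 0)⁻¹ h3
  rw [inv_smul_smul₀ h2] at h4
  have h5 : ∀ i ≤ d, S.b i ∈ p := by
    intro i
    induction i with
    | zero => intro _; exact S.b_zero_mem R hφ' h4
    | succ i ih =>
      intro hi
      have h6 := S.gen_zero_b (i := i) (by omega)
      rw [eq_comm, ← eq_sub_iff_add_eq'] at h6
      rw [h6]
      exact p.sub_mem (p.smul_mem _ (ih (by omega))) (p.smul_of_tower_mem _ (ih (by omega)))
  refine Submodule.eq_top_iff'.2 fun v => ?_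
  rw [S.sum_b v]
  exact p.sum_mem fun i _ => p.smul_of_tower_mem _ (h5 _ (Nat.le_of_lt_succ i.2))

end Split
end BannaiIto

namespace BannaiIto

theorem BI.aut_one_gen (σ : Equiv.Perm (Fin 3)) (j : Fin 3) :
    BI.aut (1, 1) σ (BI.gen j) = BI.gen (σ j) := by
  have h : sgn (1, 1) (σ j) = 1 := by generalize σ j = i; fin_cases i <;> rfl
  rw [BI.aut_gen, h]
  simp

theorem Central.twist_one {V : Type*} [AddCommGroup V] [Module ℂ V] [Module BI V]
    [IsScalarTower ℂ BI V] {s t : Fin 3 → ℂ} (hV : Central V s) (σ : Equiv.Perm (Fin 3))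
    (h : ∀ i, t i = s (σ i)) : Central (Twist (BI.aut (1, 1) σ) V) t := by
  have e : t = fun i => ((sgn (1, 1) (σ i) : ℤ) : ℂ) * s (σ i) := by
    ext i
    have h1 : sgn (1, 1) (σ i) = 1 := by generalize σ i = j; fin_cases j <;> rfl
    rw [h1, h]
    simp
  rw [e]
  exact hV.twist (1, 1) σ

/-- The identity map from a module to its twist. -/
def Twist.of (g : BI ≃ₐ[ℂ] BI) {V : Type*} (v : V) : Twist g V := v

theorem Twist.gen_smul_of {V : Type*} [AddCommGroup V] [Module BI V] (σ : Equiv.Perm (Fin 3))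
    {i j : Fin 3} (h : σ i = j) (v : V) :
    BI.gen i • Twist.of (BI.aut (1, 1) σ) v = Twist.of (BI.aut (1, 1) σ) (BI.gen j • v) := by
  rw [← h, ← BI.aut_one_gen]
  rfl

namespace Split

theorem nonempty_equiv {V W : Type*} [AddCommGroup V] [Module BI V]
    [AddCommGroup W] [Module BI W] (hV : IsSimpleModule BI V) (hW : IsSimpleModule BI W) {f : V →ₗ[BI] W}
    {v : V} (h : f v ≠ 0) : Nonempty (V ≃ₗ[BI] W) :=
  ⟨LinearEquiv.ofBijective f (LinearMap.bijective_of_ne_zero fun h0 => h (by rw [h0]; rfl))⟩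


section
variable {V : Type*} [AddCommGroup V] [Module ℂ V] [Module BI V] {d : ℕ}
  {θ θs φ : ℕ → ℂ} {s : Fin 3 → ℂ} (S : Split V d θ θs φ s)
include S

theorem b_zero_ne_zero : S.b 0 ≠ 0 := by
  intro h
  have h2 := S.e_b (Nat.succ_pos d)
  rw [h, map_zero] at h2
  exact Pi.single_ne_zero_iff.2 one_ne_zero h2.symm

theorem gen_one_b_zero : BI.gen 1 • S.b 0 = θs 0 • S.b 0 := by
  rw [S.gen_one_b (Nat.zero_le d), S.data.phi_zero, zero_smul, add_zero]

theorem gen_one_b_one :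
    BI.gen 1 • S.b 1 = θs 1 • S.b 1 + φ 1 • S.b 0 := by
  rcases d with _ | d
  · have hl := S.last
    rw [zero_add] at hl
    rw [hl, show S.b 1 = 0 from S.b_last]
    simp
  · rw [S.gen_one_b (by omega)]

end

section
variable {V W : Type*} [AddCommGroup V] [Module ℂ V] [Module BI V] [IsScalarTower ℂ BI V]
  [AddCommGroup W] [Module ℂ W] [Module BI W] [IsScalarTower ℂ BI W] {d : ℕ}
  {θ θs φ θ' φ' η ψ : ℕ → ℂ} {s t : Fin 3 → ℂ} {ε : ℂ}

/-- Exchanging the first and the third generator. -/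
theorem equiv_swap_zero_two (S : Split V d θ θs φ s) (T : Split W d η θs ψ t)
    (hV : IsSimpleModule BI V) (hW : IsSimpleModule BI W) (ht : ∀ i, t i = s (Equiv.swap 0 2 i))
    (hbase : ψ 1 = (2 * θ 0 * θs 0 - s 2 + φ 1 - η 0) * (θs 0 - θs 1) + (θs 0 + θs 1) * φ 1)
    (hs : ∀ i ≤ d, θs i ≠ θs (d + 1)) :
    Nonempty (W ≃ₗ[BI] Twist (BI.aut (1, 1) (Equiv.swap 0 2)) V) := by
  have hV' := Twist.isSimpleModule (BI.aut (1, 1) (Equiv.swap 0 2)) hV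
  have h0 : ∀ v : V, _ = _ := fun v =>
    Twist.gen_smul_of (Equiv.swap 0 2) (i := 0) (j := 2) rfl v
  have h1 : ∀ v : V, _ = _ := fun v =>
    Twist.gen_smul_of (Equiv.swap 0 2) (i := 1) (j := 1) rfl v
  obtain ⟨f, hf⟩ := T.exists_hom (S.central.twist_one (Equiv.swap 0 2) ht)
    (w := Twist.of (BI.aut (1, 1) (Equiv.swap 0 2)) (S.b 0))
    ((h1 _).trans S.gen_one_b_zero) (by
      have e2 : BI.gen 2 • S.b 0 = (2 * θ 0 * θs 0 - s 2 + φ 1) • S.b 0 + (θs 0 + θs 1) • S.b 1 := by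
        have h2 := S.central 2 (S.b 0)
        change BI.gen 0 • BI.gen 1 • S.b 0 + BI.gen 1 • BI.gen 0 • S.b 0 - BI.gen 2 • S.b 0 = _ at h2
        rw [sub_eq_iff_eq_add, ← sub_eq_iff_eq_add'] at h2
        rw [← h2, S.gen_one_b_zero, BI.smul_complex_smul, S.gen_zero_b (Nat.zero_le _), smul_add,
          smul_add, BI.smul_complex_smul, S.gen_one_b_zero, S.gen_one_b_one]
        module
      have e3 : BI.gen 1 • (BI.gen 2 • S.b 0 - η 0 • S.b 0)
          = θs 1 • (BI.gen 2 • S.b 0 - η 0 • S.b 0) + ψ 1 • S.b 0 := by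
        rw [e2, smul_sub, smul_add, BI.smul_complex_smul, BI.smul_complex_smul,
          BI.smul_complex_smul, S.gen_one_b_zero, S.gen_one_b_one, hbase]
        module
      rw [h0]
      exact (h1 _).trans (congrArg (Twist.of _) e3))
    (fun y hy => S.eq_zero_of_gen_one hs ((h1 y).symm.trans hy))
  exact nonempty_equiv hW hV' (v := T.b 0) (by rw [hf]; exact S.b_zero_ne_zero)

/-- Exchanging the first two generators. -/
theorem equiv_swap_zero_one (S : Split V d θ θs φ s) (T : Split W d θs θ ψ t)
    (R : ReverseData d θ θs φ (s 2) (s 1) ε θ' φ') (hφ' : ∀ i, 1 ≤ i → i ≤ d → φ' i ≠ 0)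
    (hV : IsSimpleModule BI V) (hW : IsSimpleModule BI W) (ht : ∀ i, t i = s (Equiv.swap 0 1 i))
    (hbase : ψ 1 = (θs d - θs 0) * (θ 0 - θ 1) + ε * φ' d)
    (hs : ∀ i ≤ d, θ i ≠ θ (d + 1)) :
    Nonempty (W ≃ₗ[BI] Twist (BI.aut (1, 1) (Equiv.swap 0 1)) V) := by
  have hV' := Twist.isSimpleModule (BI.aut (1, 1) (Equiv.swap 0 1)) hV
  have h0 : ∀ v : V, _ = _ := fun v =>
    Twist.gen_smul_of (Equiv.swap 0 1) (i := 0) (j := 1) rfl v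
  have h1 : ∀ v : V, _ = _ := fun v =>
    Twist.gen_smul_of (Equiv.swap 0 1) (i := 1) (j := 0) rfl v
  set y := S.rchain ε θ' d with hy
  have hy0 : BI.gen 0 • y = θ 0 • y := by
    rw [hy, S.gen_zero_rchain R.sign, S.rchain_last R, R.rev d le_rfl, Nat.sub_self, ← mul_assoc,
      R.sign, one_mul, smul_zero, add_zero]
  have hy1 : ∃ z, BI.gen 1 • y = θs d • y + z ∧ BI.gen 0 • z = θ 1 • z + (ε * φ' d) • y := by
    rcases d with _ | d
    · refine ⟨0, ?_, ?_⟩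
      · rw [add_zero]; exact S.gen_one_b_zero
      · rw [R.data.phi_zero]; simp
    · refine ⟨φ' (d + 1) • S.rchain ε θ' d, S.gen_one_rchain R d, ?_⟩
      rw [BI.smul_complex_smul, S.gen_zero_rchain R.sign, R.rev d (by omega), ← mul_assoc, R.sign,
        one_mul, show d + 1 - d = 1 by omega]
      module
  obtain ⟨z, hz1, hz0⟩ := hy1
  obtain ⟨f, hf⟩ := T.exists_hom (S.central.twist_one (Equiv.swap 0 1) ht)
    (w := Twist.of (BI.aut (1, 1) (Equiv.swap 0 1)) y)
    ((h1 _).trans hy0) (by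
      have e3 : BI.gen 0 • (BI.gen 1 • y - θs 0 • y)
          = θ 1 • (BI.gen 1 • y - θs 0 • y) + ψ 1 • y := by
        rw [hz1, smul_sub, smul_add, BI.smul_complex_smul, BI.smul_complex_smul, hy0, hz0, hbase]
        module
      rw [h0]
      exact (h1 _).trans (congrArg (Twist.of _) e3))
    (fun y hy => S.eq_zero_of_gen_zero hs ((h1 y).symm.trans hy))
  exact nonempty_equiv hW hV' (v := T.b 0) (by rw [hf]; exact S.rchain_ne_zero R hφ')

/-- Reversing the first diagonal. -/
theorem equiv_reverse (S : Split V d θ θs φ s) (T : Split W d θ' θs φ' s)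
    (R : ReverseData d θ θs φ (s 2) (s 1) 1 θ' φ')
    (hV : IsSimpleModule BI V) (hW : IsSimpleModule BI W) : Nonempty (W ≃ₗ[BI] V) := by
  obtain ⟨f, hf⟩ := T.exists_hom_of_chain S.central S.gen_one_b_zero (by
    have := S.gen_one_rchain R 0
    simpa [rchain, chain] using this) (by
    have := S.rchain_last R
    rwa [rchain, one_smul] at this)
  exact nonempty_equiv hW hV (v := T.b 0) (by rw [hf]; exact S.b_zero_ne_zero)

end
end Split

/-! ### The modules `E` and `O` -/

theorem mat_central (d : ℕ) (θ θs φ : ℕ → ℂ) (κ l m : ℂ) (hφ : φ (d + 1) = 0)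
    (h1 : ∀ F : ℕ → ℂ, ∀ i, seqY θs φ (seqY θs φ (seqX θ F)) i
      + 2 * seqY θs φ (seqX θ (seqY θs φ F)) i
      + seqX θ (seqY θs φ (seqY θs φ F)) i - 2 * κ * seqY θs φ F i - seqX θ F i = l * F i)
    (h2 : ∀ F : ℕ → ℂ, ∀ i, seqX θ (seqX θ (seqY θs φ F)) i
      + 2 * seqX θ (seqY θs φ (seqX θ F)) i
      + seqY θs φ (seqX θ (seqX θ F)) i - 2 * κ * seqX θ F i - seqY θs φ F i = m * F i)
    (M : Fin 3 → Matrix (Fin (d + 1)) (Fin (d + 1)) ℂ)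
    (hM : M = ![matX d θ, matY d θs φ, matZ d θ θs φ κ]) (i : Fin 3) :
    M (i + 1) * M (i + 2) + M (i + 2) * M (i + 1) - M i = (![l, m, κ] i) • 1 := by
  have ex : ∀ v : Fin (d + 1) → ℂ, ∃ F : ℕ → ℂ, v = fun i : Fin (d + 1) => F i := fun v =>
    ⟨fun i => if h : i < d + 1 then v ⟨i, h⟩ else 0, by
      ext i
      simp only [i.2, dif_pos]⟩
  have mx := matX_mulVec d θ
  have my := fun F => matY_mulVec d θs φ F hφ
  subst hM
  have e1 : matY d θs φ * matY d θs φ * matX d θ + (2 : ℂ) • (matY d θs φ * matX d θ * matY d θs φ)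
      + matX d θ * matY d θs φ * matY d θs φ - (2 * κ) • matY d θs φ - matX d θ = l • 1 := by
    rw [← Matrix.mulVec_injective.eq_iff]
    funext v
    obtain ⟨F, rfl⟩ := ex v
    ext i
    simp only [Matrix.add_mulVec, Matrix.sub_mulVec, Matrix.smul_mulVec, ← Matrix.mulVec_mulVec,
      mx, my, Matrix.one_mulVec, Pi.add_apply, Pi.sub_apply, Pi.smul_apply, smul_eq_mul]
    exact h1 F i
  have e2 : matX d θ * matX d θ * matY d θs φ + (2 : ℂ) • (matX d θ * matY d θs φ * matX d θ)
      + matY d θs φ * matX d θ * matX d θ - (2 * κ) • matX d θ - matY d θs φ = m • 1 := by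
    rw [← Matrix.mulVec_injective.eq_iff]
    funext v
    obtain ⟨F, rfl⟩ := ex v
    ext i
    simp only [Matrix.add_mulVec, Matrix.sub_mulVec, Matrix.smul_mulVec, ← Matrix.mulVec_mulVec,
      mx, my, Matrix.one_mulVec, Pi.add_apply, Pi.sub_apply, Pi.smul_apply, smul_eq_mul]
    exact h2 F i
  fin_cases i
  · change matY d θs φ * matZ d θ θs φ κ + matZ d θ θs φ κ * matY d θs φ - matX d θ = l • 1
    rw [← e1, matZ]
    simp only [mul_add, add_mul, mul_sub, sub_mul, mul_smul_comm, smul_mul_assoc, mul_one, one_mul,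
      mul_assoc]
    module
  · change matZ d θ θs φ κ * matX d θ + matX d θ * matZ d θ θs φ κ - matY d θs φ = m • 1
    rw [← e2, matZ]
    simp only [mul_add, add_mul, mul_sub, sub_mul, mul_smul_comm, smul_mul_assoc, mul_one, one_mul,
      mul_assoc]
    module
  · change matX d θ * matY d θs φ + matY d θs φ * matX d θ - matZ d θ θs φ κ = κ • 1
    simp [matZ]

theorem chainData_E (d : ℕ) (a b c : ℂ) : ChainData (theta d a) (theta d b) (phiE d a b c)
    (c ^ 2 - a ^ 2 - b ^ 2 + (d + 1) ^ 2 / 4) (b ^ 2 - c ^ 2 - a ^ 2 + (d + 1) ^ 2 / 4) where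
  phi_zero := by simp [phiE]
  sq i := by
    rcases Nat.even_or_odd i with e | e <;> simp [theta, pow_succ, e.neg_one_pow] <;> ring
  star i := by
    rcases Nat.even_or_odd i with e | e <;> simp [theta, pow_succ, e.neg_one_pow] <;> ring
  diag_one i := by
    rcases Nat.even_or_odd i with e | e
    · simp [theta, phiE, e, Nat.even_add_one, pow_succ, e.neg_one_pow]
      ring
    · have e' : ¬ Even i := Nat.not_even_iff_odd.2 e
      simp [theta, phiE, e', Nat.even_add_one, pow_succ, e.neg_one_pow]
      ring
  diag i := by
    rcases i with _ | i
    · simp [theta, phiE]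
      ring
    rcases Nat.even_or_odd i with e | e
    · simp [theta, phiE, e, Nat.even_add_one, pow_succ, e.neg_one_pow]
      ring
    · have e' : ¬ Even i := Nat.not_even_iff_odd.2 e
      simp [theta, phiE, e', Nat.even_add_one, pow_succ, e.neg_one_pow]
      ring

theorem chainData_O (d : ℕ) (a b c : ℂ) : ChainData (theta d a) (theta d b) (phiO d a b c)
    (2 * a * b - c * (d + 1)) (2 * c * a - b * (d + 1)) where
  phi_zero := by simp [phiO]
  sq i := by
    rcases Nat.even_or_odd i with e | e <;> simp [theta, pow_succ, e.neg_one_pow] <;> ring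
  star i := by
    rcases Nat.even_or_odd i with e | e <;> simp [theta, pow_succ, e.neg_one_pow] <;> ring
  diag_one i := by
    rcases Nat.even_or_odd i with e | e
    · simp [theta, phiO, e, Nat.even_add_one, pow_succ, e.neg_one_pow]
      ring
    · have e' : ¬ Even i := Nat.not_even_iff_odd.2 e
      simp [theta, phiO, e', Nat.even_add_one, pow_succ, e.neg_one_pow]
      ring
  diag i := by
    rcases i with _ | i
    · simp [theta, phiO]
      ring
    rcases Nat.even_or_odd i with e | e
    · simp [theta, phiO, e, Nat.even_add_one, pow_succ, e.neg_one_pow]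
      ring
    · have e' : ¬ Even i := Nat.not_even_iff_odd.2 e
      simp [theta, phiO, e', Nat.even_add_one, pow_succ, e.neg_one_pow]
      ring

/-- The standard splitting of `E_d(a,b,c)`. -/
noncomputable def splitE (d : ℕ) (hd : Odd d) (a b c : ℂ) :
    Split (E d hd a b c) d (theta d a) (theta d b) (phiE d a b c)
      ![a ^ 2 - b ^ 2 - c ^ 2 + (d + 1) ^ 2 / 4, b ^ 2 - c ^ 2 - a ^ 2 + (d + 1) ^ 2 / 4,
        c ^ 2 - a ^ 2 - b ^ 2 + (d + 1) ^ 2 / 4] where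
  e := LinearEquiv.refl ℂ (Fin (d + 1) → ℂ)
  e_zero v := E_smul d hd a b c 0 v
  e_one v := E_smul d hd a b c 1 v
  central i v := by
    have h := mat_central d _ _ _ _ _ _ (phiE_last hd a b c) (seqE1 d a b c) (seqE2 d a b c)
      (actE d a b c) rfl i
    have h1 : ∀ w : Fin (d + 1) → ℂ, (actE d a b c (i + 1)).mulVec ((actE d a b c (i + 2)).mulVec w)
        + (actE d a b c (i + 2)).mulVec ((actE d a b c (i + 1)).mulVec w)
        - (actE d a b c i).mulVec w = _ • w := fun w => by
      have := congrArg (fun M => Matrix.mulVec M w) h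
      simpa only [Matrix.add_mulVec, Matrix.sub_mulVec, ← Matrix.mulVec_mulVec, Matrix.smul_mulVec,
        Matrix.one_mulVec] using this
    refine Eq.trans ?_ (h1 v)
    refine congrArg₂ _ (congrArg₂ _ ?_ ?_) (E_smul d hd a b c i v)
    · rw [E_smul d hd a b c (i + 2) v]; exact E_smul d hd a b c (i + 1) _
    · rw [E_smul d hd a b c (i + 1) v]; exact E_smul d hd a b c (i + 2) _
  data := chainData_E d a b c
  last := phiE_last hd a b c

/-- The standard splitting of `O_d(a,b,c)`. -/
noncomputable def splitO (d : ℕ) (hd : Even d) (a b c : ℂ) :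
    Split (O d hd a b c) d (theta d a) (theta d b) (phiO d a b c)
      ![2 * b * c - a * (d + 1), 2 * c * a - b * (d + 1), 2 * a * b - c * (d + 1)] where
  e := LinearEquiv.refl ℂ (Fin (d + 1) → ℂ)
  e_zero v := O_smul d hd a b c 0 v
  e_one v := O_smul d hd a b c 1 v
  central i v := by
    have h := mat_central d _ _ _ _ _ _ (phiO_last hd a b c) (seqO1 d a b c) (seqO2 d a b c)
      (actO d a b c) rfl i
    have h1 : ∀ w : Fin (d + 1) → ℂ, (actO d a b c (i + 1)).mulVec ((actO d a b c (i + 2)).mulVec w)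
        + (actO d a b c (i + 2)).mulVec ((actO d a b c (i + 1)).mulVec w)
        - (actO d a b c i).mulVec w = _ • w := fun w => by
      have := congrArg (fun M => Matrix.mulVec M w) h
      simpa only [Matrix.add_mulVec, Matrix.sub_mulVec, ← Matrix.mulVec_mulVec, Matrix.smul_mulVec,
        Matrix.one_mulVec] using this
    refine Eq.trans ?_ (h1 v)
    refine congrArg₂ _ (congrArg₂ _ ?_ ?_) (O_smul d hd a b c i v)
    · rw [O_smul d hd a b c (i + 2) v]; exact O_smul d hd a b c (i + 1) _
    · rw [O_smul d hd a b c (i + 1) v]; exact O_smul d hd a b c (i + 2) _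
  data := chainData_O d a b c
  last := phiO_last hd a b c

theorem theta_reverse_odd {d : ℕ} (hd : Odd d) (a : ℂ) {i : ℕ} (hi : i ≤ d) :
    theta d (-a) i = theta d a (d - i) := by
  obtain ⟨j, rfl⟩ := Nat.exists_eq_add_of_le hi
  rw [Nat.add_sub_cancel_left, theta, theta]
  have h : (-1 : ℂ) ^ i = - (-1) ^ j := by
    rcases Nat.even_or_odd i with e | e
    · rw [e.neg_one_pow, ((Nat.odd_add.1 hd).not.1 (by simpa using e) |> Nat.not_even_iff_odd.1).neg_one_pow, neg_neg]
    · rw [e.neg_one_pow, ((Nat.odd_add.1 hd).1 e).neg_one_pow]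
  rw [h]
  push_cast
  ring

theorem theta_reverse_even {d : ℕ} (hd : Even d) (a : ℂ) {i : ℕ} (hi : i ≤ d) :
    theta d (-a) i = -1 * theta d a (d - i) := by
  obtain ⟨j, rfl⟩ := Nat.exists_eq_add_of_le hi
  rw [Nat.add_sub_cancel_left, theta, theta]
  have h : (-1 : ℂ) ^ i = (-1) ^ j := by
    rcases Nat.even_or_odd i with e | e
    · rw [e.neg_one_pow, ((Nat.even_add.1 hd).1 e).neg_one_pow]
    · rw [e.neg_one_pow, (Nat.not_even_iff_odd.1 ((Nat.even_add.1 hd).not.1 (Nat.not_even_iff_odd.2 e))).neg_one_pow]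
  rw [h]
  push_cast
  ring

theorem reverseData_E {d : ℕ} (hd : Odd d) (a b c : ℂ) :
    ReverseData d (theta d a) (theta d b) (phiE d a b c)
      (c ^ 2 - a ^ 2 - b ^ 2 + (d + 1) ^ 2 / 4) (b ^ 2 - c ^ 2 - a ^ 2 + (d + 1) ^ 2 / 4) 1
      (theta d (-a)) (phiE d (-a) b c) where
  sign := one_mul 1
  data := by
    have := chainData_E d (-a) b c
    rwa [neg_sq, ← one_mul (c ^ 2 - a ^ 2 - b ^ 2 + ((d : ℂ) + 1) ^ 2 / 4)] at this
  rev i hi := by rw [one_mul, theta_reverse_odd hd a hi]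
  base := by
    simp [phiE, theta]
    ring

theorem reverseData_O {d : ℕ} (hd : Even d) (a b c : ℂ) :
    ReverseData d (theta d a) (theta d b) (phiO d a b c)
      (2 * a * b - c * (d + 1)) (2 * c * a - b * (d + 1)) (-1)
      (theta d (-a)) (phiO d (-a) b (-c)) where
  sign := by norm_num
  data := by
    have := chainData_O d (-a) b (-c)
    rwa [show 2 * -a * b - -c * ((d : ℂ) + 1) = -1 * (2 * a * b - c * (d + 1)) by ring,
      show 2 * -c * -a - b * ((d : ℂ) + 1) = 2 * c * a - b * (d + 1) by ring] at this
  rev i hi := theta_reverse_even hd a hi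
  base := by
    simp [phiO, theta]
    ring

end BannaiIto

namespace BannaiIto

/-! ### Irreducibility and isomorphisms -/

/-- The real part of `x` is at least `(d+1)/2` in absolute value. -/
def Far (d : ℕ) (x : ℂ) : Prop := ((d : ℝ) + 1) / 2 ≤ |x.re|

theorem Far.neg {d : ℕ} {x : ℂ} (h : Far d x) : Far d (-x) := by
  rwa [Far, Complex.neg_re, abs_neg]

theorem Far.ne {d : ℕ} {x : ℂ} (h : Far d x) {i : ℕ} (h1 : 1 ≤ i) (h2 : i ≤ d) :
    x - ((d + 1) / 2 - i) ≠ 0 := by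
  intro h0
  rw [sub_eq_zero] at h0
  have h3 : x = ((((d : ℝ) + 1) / 2 - i : ℝ) : ℂ) := by rw [h0]; push_cast; rfl
  rw [Far, h3, Complex.ofReal_re] at h
  have h1' : (1 : ℝ) ≤ i := by exact_mod_cast h1
  have h2' : (i : ℝ) ≤ d := by exact_mod_cast h2
  have : |((d : ℝ) + 1) / 2 - i| < ((d : ℝ) + 1) / 2 := abs_lt.2 ⟨by linarith, by linarith⟩
  linarith

/-- A sufficient condition for irreducibility. -/
structure Generic (d : ℕ) (a b c : ℂ) : Prop where
  ppp : Far d (a + b + c)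
  ppm : Far d (a + b - c)
  pmp : Far d (a - b + c)
  mpp : Far d (-a + b + c)

namespace Generic
variable {d : ℕ} {a b c : ℂ} (h : Generic d a b c)
include h

theorem swap_zero_one : Generic d b a c where
  ppp := by convert h.ppp using 1; ring
  ppm := by convert h.ppm using 1; ring
  pmp := by convert h.mpp using 1; ring
  mpp := by convert h.pmp using 1; ring

theorem swap_zero_two : Generic d c b a where
  ppp := by convert h.ppp using 1; ring
  ppm := by convert h.mpp using 1; ring
  pmp := by convert h.pmp using 1; ring
  mpp := by convert h.ppm using 1; ring

theorem neg_zero : Generic d (-a) b c where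
  ppp := h.mpp
  ppm := by convert h.pmp.neg using 1; ring
  pmp := by convert h.ppm.neg using 1; ring
  mpp := by convert h.ppp using 1; ring

theorem neg_two : Generic d a b (-c) where
  ppp := by convert h.ppm using 1; ring
  ppm := by convert h.ppp using 1; ring
  pmp := by convert h.mpp.neg using 1; ring
  mpp := by convert h.pmp.neg using 1; ring

theorem phiE_ne_zero (i : ℕ) (h1 : 1 ≤ i) (h2 : i ≤ d) : phiE d a b c i ≠ 0 := by
  rw [phiE]
  split_ifs
  · have h3 : ((i : ℂ)) ≠ 0 := by exact_mod_cast (by omega : i ≠ 0)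
    refine mul_ne_zero h3 ?_
    rw [← Nat.cast_sub h2]
    exact_mod_cast Nat.succ_ne_zero (d - i)
  · have h3 := mul_ne_zero (h.ppm.ne h1 h2) (h.ppp.ne h1 h2)
    intro h0
    apply h3
    linear_combination -h0

theorem phiO_ne_zero (i : ℕ) (h1 : 1 ≤ i) (h2 : i ≤ d) : phiO d a b c i ≠ 0 := by
  rw [phiO]
  split_ifs
  · have h3 : ((i : ℂ)) ≠ 0 := by exact_mod_cast (by omega : i ≠ 0)
    have h4 := mul_ne_zero h3 (h.ppp.ne h1 h2)
    intro h0
    apply h4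
    linear_combination -h0
  · have h3 : ((d - i : ℕ) : ℂ) + 1 ≠ 0 := by exact_mod_cast Nat.succ_ne_zero (d - i)
    rw [Nat.cast_sub h2] at h3
    have h4 := mul_ne_zero h3 (h.ppm.ne h1 h2)
    intro h0
    apply h4
    linear_combination h0

theorem isSimpleModule_E (hd : Odd d) : IsSimpleModule BI (E d hd a b c) :=
  (splitE d hd a b c).isSimpleModule (reverseData_E hd a b c) h.phiE_ne_zero h.neg_zero.phiE_ne_zero

theorem isSimpleModule_O (hd : Even d) : IsSimpleModule BI (O d hd a b c) :=
  (splitO d hd a b c).isSimpleModule (reverseData_O hd a b c) h.phiO_ne_zero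
    h.neg_zero.neg_two.phiO_ne_zero

end Generic

/-- The eigenvalue following the spectrum of the first generator is not in the spectrum. -/
def Regular (d : ℕ) (x : ℂ) : Prop := ∀ i ≤ d, theta d x i ≠ theta d x (d + 1)

theorem regular_of_re {d : ℕ} {x : ℂ} (h : 0 ≤ x.re ∨ x.re < -(((d : ℝ) + 1) / 2)) :
    Regular d x := by
  intro i hi h0
  have hi' : (i : ℝ) ≤ d := by exact_mod_cast hi
  have h1 : (2 * x.re - d + 2 * i = 2 * x.re + d + 2) ∨
      (2 * x.re - d + 2 * i = -(2 * x.re + d + 2)) := by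
    have h2 : ∀ j, theta d x j = (((-1) ^ j : ℝ) : ℂ) * (((1 / 2 : ℝ) : ℂ) *
        (2 * x - (d : ℝ) + 2 * (j : ℝ) : ℂ)) := by
      intro j; rw [theta]; push_cast; ring
    have h3 : ∀ j, (theta d x j).re = (-1) ^ j * (1 / 2 * (2 * x.re - d + 2 * j)) := by
      intro j
      rw [h2, Complex.re_ofReal_mul, Complex.re_ofReal_mul]
      simp
    have h4 := congrArg Complex.re h0
    rw [h3, h3] at h4
    rcases neg_one_pow_eq_or ℝ i with e | e <;> rcases neg_one_pow_eq_or ℝ (d + 1) with e' | e' <;>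
      rw [e, e'] at h4 <;> push_cast at h4
    · left; linarith
    · right; linarith
    · right; linarith
    · left; linarith
  have : (0 : ℝ) ≤ i := Nat.cast_nonneg i
  rcases h1 with h1 | h1
  · linarith
  · rcases h with h | h <;> linarith

section
variable {d : ℕ} {a b c : ℂ} (h : Generic d a b c)
include h

theorem equiv_E_swap_zero_two (hd : Odd d) (hb : Regular d b) :
    Nonempty (E d hd c b a ≃ₗ[BI] Twist (BI.aut (1, 1) (Equiv.swap 0 2)) (E d hd a b c)) := by
  refine (splitE d hd a b c).equiv_swap_zero_two (splitE d hd c b a) (h.isSimpleModule_E hd)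
    (h.swap_zero_two.isSimpleModule_E hd) (fun i => ?_) ?_ hb
  · fin_cases i
    · change _ = c ^ 2 - a ^ 2 - b ^ 2 + ((d : ℂ) + 1) ^ 2 / 4; simp; ring
    · change _ = b ^ 2 - c ^ 2 - a ^ 2 + ((d : ℂ) + 1) ^ 2 / 4; simp; ring
    · change _ = a ^ 2 - b ^ 2 - c ^ 2 + ((d : ℂ) + 1) ^ 2 / 4; simp; ring
  · simp [phiE, theta]
    ring

theorem equiv_O_swap_zero_two (hd : Even d) (hb : Regular d b) :
    Nonempty (O d hd c b a ≃ₗ[BI] Twist (BI.aut (1, 1) (Equiv.swap 0 2)) (O d hd a b c)) := by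
  refine (splitO d hd a b c).equiv_swap_zero_two (splitO d hd c b a) (h.isSimpleModule_O hd)
    (h.swap_zero_two.isSimpleModule_O hd) (fun i => ?_) ?_ hb
  · fin_cases i
    · change _ = 2 * a * b - c * ((d : ℂ) + 1); simp; ring
    · change _ = 2 * c * a - b * ((d : ℂ) + 1); simp; ring
    · change _ = 2 * b * c - a * ((d : ℂ) + 1); simp; ring
  · simp [phiO, theta]
    ring

theorem equiv_E_swap_zero_one (hd : Odd d) (ha : Regular d a) :
    Nonempty (E d hd b a c ≃ₗ[BI] Twist (BI.aut (1, 1) (Equiv.swap 0 1)) (E d hd a b c)) := by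
  refine (splitE d hd a b c).equiv_swap_zero_one (splitE d hd b a c) (reverseData_E hd a b c)
    h.neg_zero.phiE_ne_zero (h.isSimpleModule_E hd)
    (h.swap_zero_one.isSimpleModule_E hd) (fun i => ?_) ?_ ha
  · fin_cases i
    · change _ = b ^ 2 - c ^ 2 - a ^ 2 + ((d : ℂ) + 1) ^ 2 / 4; simp; ring
    · change _ = a ^ 2 - b ^ 2 - c ^ 2 + ((d : ℂ) + 1) ^ 2 / 4; simp; ring
    · change _ = c ^ 2 - a ^ 2 - b ^ 2 + ((d : ℂ) + 1) ^ 2 / 4; simp; ring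
  · simp [phiE, theta, hd.neg_one_pow, Nat.not_even_iff_odd.2 hd]
    ring

theorem equiv_O_swap_zero_one (hd : Even d) (ha : Regular d a) :
    Nonempty (O d hd b a c ≃ₗ[BI] Twist (BI.aut (1, 1) (Equiv.swap 0 1)) (O d hd a b c)) := by
  refine (splitO d hd a b c).equiv_swap_zero_one (splitO d hd b a c) (reverseData_O hd a b c)
    h.neg_zero.neg_two.phiO_ne_zero (h.isSimpleModule_O hd)
    (h.swap_zero_one.isSimpleModule_O hd) (fun i => ?_) ?_ ha
  · fin_cases i
    · change _ = 2 * c * a - b * ((d : ℂ) + 1); simp; ring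
    · change _ = 2 * b * c - a * ((d : ℂ) + 1); simp; ring
    · change _ = 2 * a * b - c * ((d : ℂ) + 1); simp; ring
  · simp [phiO, theta, hd.neg_one_pow, hd]
    ring

theorem equiv_E_neg_zero (hd : Odd d) : Nonempty (E d hd (-a) b c ≃ₗ[BI] E d hd a b c) := by
  have T := splitE d hd (-a) b c
  rw [neg_sq] at T
  exact (splitE d hd a b c).equiv_reverse T (reverseData_E hd a b c) (h.isSimpleModule_E hd)
    (h.neg_zero.isSimpleModule_E hd)

end

theorem equiv_E_neg_two (d : ℕ) (hd : Odd d) (a b c : ℂ) :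
    Nonempty (E d hd a b (-c) ≃ₗ[BI] E d hd a b c) := by
  have h : repE d hd a b (-c) = repE d hd a b c := BI.hom_ext fun j => by
    rw [repE, repE, BI.lift_gen, BI.lift_gen, actE, actE,
      show phiE d a b (-c) = phiE d a b c by ext i; rw [phiE, phiE, neg_sq], neg_sq]
  exact ⟨{ LinearEquiv.refl ℂ (Fin (d + 1) → ℂ) with
    map_smul' := fun u v => by
      change Matrix.toLinAlgEquiv' (repE d hd a b (-c) u) v
        = Matrix.toLinAlgEquiv' (repE d hd a b c u) v
      rw [h] }⟩

theorem nonempty_twist_comp {V W V' : Type*} [AddCommGroup V] [Module BI V] [AddCommGroup W]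
    [Module BI W] [AddCommGroup V'] [Module BI V'] (g h l : BI ≃ₐ[ℂ] BI)
    (hl : ∀ j, h (g (BI.gen j)) = l (BI.gen j))
    (h1 : Nonempty (V' ≃ₗ[BI] Twist g W)) (h2 : Nonempty (W ≃ₗ[BI] Twist h V)) :
    Nonempty (V' ≃ₗ[BI] Twist l V) := by
  obtain ⟨e1⟩ := h1
  obtain ⟨e2⟩ := h2
  exact ⟨e1.trans ((Twist.congr g e2).trans (Twist.comp g h l
    (BI.aut_ext (f := (h : BI →ₐ[ℂ] BI).comp (g : BI →ₐ[ℂ] BI)) (g := (l : BI →ₐ[ℂ] BI)) hl)))⟩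

theorem equiv_twist_aut_one {V : Type*} [AddCommGroup V] [Module BI V] :
    Nonempty (Twist (BI.aut (1, 1) 1) V ≃ₗ[BI] V) :=
  ⟨Twist.one _ (BI.aut_ext (f := (BI.aut (1, 1) 1 : BI →ₐ[ℂ] BI)) (g := AlgHom.id ℂ BI)
    fun j => BI.aut_one_gen 1 j)⟩

theorem nonempty_trans {V W V' : Type*} [AddCommGroup V] [Module BI V] [AddCommGroup W]
    [Module BI W] [AddCommGroup V'] [Module BI V'] (h1 : Nonempty (V ≃ₗ[BI] W))
    (h2 : Nonempty (W ≃ₗ[BI] V')) : Nonempty (V ≃ₗ[BI] V') :=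
  ⟨h1.some.trans h2.some⟩

theorem nonempty_symm {V W : Type*} [AddCommGroup V] [Module BI V] [AddCommGroup W]
    [Module BI W] (h1 : Nonempty (V ≃ₗ[BI] W)) : Nonempty (W ≃ₗ[BI] V) :=
  ⟨h1.some.symm⟩

theorem aut_one_comp (σ τ ρ : Equiv.Perm (Fin 3)) (h : ∀ j, τ (σ j) = ρ j) (j : Fin 3) :
    BI.aut (1, 1) τ (BI.aut (1, 1) σ (BI.gen j)) = BI.aut (1, 1) ρ (BI.gen j) := by
  rw [BI.aut_one_gen, BI.aut_one_gen, BI.aut_one_gen, h]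

theorem aut_comp (ε ε' : ℤˣ × ℤˣ) (τ : Equiv.Perm (Fin 3)) (h : ∀ j, sgn ε j = sgn ε' (τ j))
    (j : Fin 3) : BI.aut (1, 1) τ (BI.aut ε 1 (BI.gen j)) = BI.aut ε' τ (BI.gen j) := by
  rw [BI.aut_gen, map_smul, BI.aut_one_gen, BI.aut_gen, Equiv.Perm.one_apply, h]

section
variable {d : ℕ} {a b c : ℂ} (h : Generic d a b c)
include h

theorem equiv_E_swap_one_two (hd : Odd d) (ha : Regular d a) (hc : Regular d c) :
    Nonempty (E d hd a c b ≃ₗ[BI] Twist (BI.aut (1, 1) (Equiv.swap 1 2)) (E d hd a b c)) := by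
  have h1 := equiv_E_swap_zero_one h hd ha
  have h2 := equiv_E_swap_zero_two h.swap_zero_one hd ha
  have h3 := equiv_E_swap_zero_one h.swap_zero_one.swap_zero_two hd hc
  exact nonempty_twist_comp _ _ _ (aut_one_comp _ c[0, 2, 1] _ (by decide)) h3
    (nonempty_twist_comp _ _ _ (aut_one_comp _ _ c[0, 2, 1] (by decide)) h2 h1)

theorem equiv_O_swap_one_two (hd : Even d) (ha : Regular d a) :
    Nonempty (O d hd a c b ≃ₗ[BI] Twist (BI.aut (1, 1) (Equiv.swap 1 2)) (O d hd a b c)) := by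
  have h1 := equiv_O_swap_zero_one h hd ha
  have h2 := equiv_O_swap_zero_two h.swap_zero_one hd ha
  have h3 := equiv_O_swap_zero_one h.swap_zero_one.swap_zero_two.swap_zero_one hd ha
  have h3' : Nonempty (O d hd a c b ≃ₗ[BI] Twist (BI.aut (1, 1) (Equiv.swap 0 1)) (O d hd c a b)) :=
    nonempty_symm (nonempty_trans ⟨Twist.congr _ h3.some⟩ (nonempty_trans
      ⟨Twist.comp _ _ (BI.aut (1, 1) 1) (BI.aut_ext (f := ((BI.aut (1, 1) (Equiv.swap 0 1)).toAlgHom).comp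
          ((BI.aut (1, 1) (Equiv.swap 0 1)).toAlgHom)) (g := (BI.aut (1, 1) 1).toAlgHom)
          (aut_one_comp _ _ _ (by decide)))⟩
      equiv_twist_aut_one))
  exact nonempty_twist_comp _ _ _ (aut_one_comp _ c[0, 2, 1] _ (by decide)) h3'
    (nonempty_twist_comp _ _ _ (aut_one_comp _ _ c[0, 2, 1] (by decide)) h2 h1)

theorem equiv_O_cycle (hd : Even d) (ha : Regular d a) (hb : Regular d b) :
    Nonempty (O d hd b c a ≃ₗ[BI] Twist (BI.aut (1, 1) c[0, 1, 2]) (O d hd a b c)) :=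
  nonempty_twist_comp _ _ _ (aut_one_comp _ _ _ (by decide))
    (equiv_O_swap_one_two h.swap_zero_one hd hb) (equiv_O_swap_zero_one h hd ha)

theorem equiv_O_cycle_inv (hd : Even d) (ha : Regular d a) :
    Nonempty (O d hd c a b ≃ₗ[BI] Twist (BI.aut (1, 1) c[0, 2, 1]) (O d hd a b c)) := by
  have h3 := equiv_O_swap_zero_one h.swap_zero_one.swap_zero_two.swap_zero_one hd ha
  exact nonempty_twist_comp _ _ _ (aut_one_comp _ _ _ (by decide)) h3
    (equiv_O_swap_one_two h hd ha)

theorem equiv_E_twist_swap_one_two (hd : Odd d) (ha : Regular d a) (hc : Regular d c) :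
    Nonempty (Twist (BI.aut (-1, -1) (Equiv.swap 1 2)) (E d hd a b c) ≃ₗ[BI]
      Twist (BI.aut (-1, 1) 1) (E d hd a c (-b))) :=
  nonempty_symm (nonempty_twist_comp _ _ _ (aut_comp _ _ _ (by decide))
    ⟨Twist.congr _ (equiv_E_neg_two d hd a c b).some⟩ (equiv_E_swap_one_two h hd ha hc))

theorem equiv_E_twist_swap_zero_one (hd : Odd d) (ha : Regular d a) :
    Nonempty (Twist (BI.aut (-1, -1) (Equiv.swap 0 1)) (E d hd a b c) ≃ₗ[BI]
      Twist (BI.aut (-1, -1) 1) (E d hd (-b) a c)) :=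
  nonempty_symm (nonempty_twist_comp _ _ _ (aut_comp _ _ _ (by decide))
    ⟨Twist.congr _ (equiv_E_neg_zero h.swap_zero_one hd).some⟩ (equiv_E_swap_zero_one h hd ha))

theorem equiv_E_twist_swap_zero_two (hd : Odd d) (hb : Regular d b) (hb' : Regular d (-b))
    (hc : Regular d c) :
    Nonempty (Twist (BI.aut (-1, -1) (Equiv.swap 0 2)) (E d hd a b c) ≃ₗ[BI]
      Twist (BI.aut (1, -1) 1) (E d hd c (-b) a)) := by
  have h1 := equiv_E_swap_zero_two h hd hb
  have h2 := equiv_E_swap_zero_one h.swap_zero_two hd hc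
  have h3 := equiv_E_neg_zero h.swap_zero_two.swap_zero_one hd
  have h4 := equiv_E_swap_zero_one h.swap_zero_two.swap_zero_one.neg_zero hd hb'
  have h5 := nonempty_twist_comp _ _ _ (aut_one_comp (Equiv.swap 0 1) (Equiv.swap 0 2) c[0, 1, 2]
    (by decide)) h2 h1
  have h6 := nonempty_twist_comp _ _ _ (aut_one_comp (Equiv.swap 0 1) c[0, 1, 2] (Equiv.swap 0 2)
    (by decide)) h4 (nonempty_trans h3 h5)
  exact nonempty_symm (nonempty_twist_comp (BI.aut (1, -1) 1) _ _
    (aut_comp (1, -1) (-1, -1) (Equiv.swap 0 2) (by decide)) ⟨LinearEquiv.refl BI _⟩ h6)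

end

end BannaiIto

namespace BannaiIto
open MvPolynomial

/-! ### Coefficients of spinor-valued polynomials -/

/-- The coefficient of a monomial in a spinor-valued polynomial. -/
noncomputable def coef (m : Fin 3 →₀ ℕ) : Spinor →ₗ[ℂ] (Fin 2 → ℂ) :=
  (TensorProduct.AlgebraTensorModule.rid ℝ ℂ (Fin 2 → ℂ)).toLinearMap ∘ₗ
    (TensorProduct.AlgebraTensorModule.map (LinearMap.id : (Fin 2 → ℂ) →ₗ[ℂ] (Fin 2 → ℂ))
      (lcoeff ℝ m : Poly →ₗ[ℝ] ℝ) :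
      (Fin 2 → ℂ) ⊗[ℝ] Poly →ₗ[ℂ] (Fin 2 → ℂ) ⊗[ℝ] ℝ)

theorem coef_tmul (m : Fin 3 →₀ ℕ) (v : Fin 2 → ℂ) (f : Poly) :
    coef m (tmul v f) = ((coeff m f : ℝ) : ℂ) • v := by
  rw [Complex.coe_smul]
  rfl

theorem zero_tmul (f : Poly) : tmul 0 f = 0 := TensorProduct.zero_tmul _ _

theorem Spinor.funext {V : Type*} [AddCommGroup V] [Module ℂ V] {F G : Spinor →ₗ[ℂ] V}
    (h : ∀ v m, F (tmul v (monomial m 1)) = G (tmul v (monomial m 1))) (f : Spinor) :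
    F f = G f := by
  have h2 : ∀ (v : Fin 2 → ℂ) (p : Poly), F (tmul v p) = G (tmul v p) := by
    intro v p
    induction p using MvPolynomial.induction_on' with
    | monomial a r =>
      rw [show (monomial a r : Poly) = r • monomial a 1 by rw [smul_monomial, smul_eq_mul, mul_one],
        tmul_smul, map_smul, map_smul, h]
    | add p q hp hq => rw [tmul_add, map_add, map_add, hp, hq]
  refine Spinor.induction (p := fun f => F f = G f) h2 (by simp) (fun x y hx hy => ?_) f
  rw [map_add, map_add, hx, hy]

theorem tens_coef {P : Poly →ₗ[ℝ] Poly} {m m' : Fin 3 →₀ ℕ} {r : ℝ}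
    (h : ∀ a, coeff m (P (monomial a 1)) = r * coeff m' (monomial a (1 : ℝ)))
    (M : Matrix (Fin 2) (Fin 2) ℂ) (f : Spinor) :
    coef m (tens M P f) = (r : ℂ) • M.mulVec (coef m' f) := by
  refine Spinor.funext (F := coef m ∘ₗ tens M P) (G := (r : ℂ) • (M.mulVecLin ∘ₗ coef m')) ?_ f
  intro v a
  simp only [LinearMap.comp_apply, LinearMap.smul_apply, Matrix.mulVecLin_apply, tens_tmul, coef_tmul,
    h, Matrix.mulVec_smul, smul_smul]
  push_cast
  rfl

theorem exists_eq_sum (f : Spinor) : ∃ S : Finset (Fin 3 →₀ ℕ), ∀ T, S ⊆ T →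
    f = ∑ m ∈ T, tmul (coef m f) (monomial m 1) := by
  classical
  refine Spinor.induction (p := fun f => ∃ S : Finset (Fin 3 →₀ ℕ), ∀ T, S ⊆ T →
    f = ∑ m ∈ T, tmul (coef m f) (monomial m 1)) (fun v p => ?_) ?_ (fun x y hx hy => ?_) f
  · refine ⟨p.support, fun T hT => ?_⟩
    have h1 : p = ∑ m ∈ T, coeff m p • monomial m 1 := by
      conv_lhs => rw [p.as_sum]
      rw [Finset.sum_subset hT]
      · simp [smul_monomial]
      · intro m _ hm
        rw [notMem_support_iff.1 hm, map_zero]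
    have h2 : ∀ T : Finset (Fin 3 →₀ ℕ), tmul v (∑ m ∈ T, coeff m p • monomial m 1)
        = ∑ m ∈ T, tmul (coef m (tmul v p)) (monomial m 1) := by
      intro T
      induction T using Finset.induction_on with
      | empty => exact TensorProduct.tmul_zero _ _
      | insert a T ha ih =>
        rw [Finset.sum_insert ha, Finset.sum_insert ha, tmul_add, ih, tmul_smul, coef_tmul,
          smul_tmul]
    rw [← h2, ← h1]
  · exact ⟨∅, fun T _ => by
      rw [Finset.sum_eq_zero]
      intro m _
      rw [map_zero]
      exact zero_tmul _⟩
  · obtain ⟨S, hS⟩ := hx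
    obtain ⟨S', hS'⟩ := hy
    refine ⟨S ∪ S', fun T hT => ?_⟩
    have e : x + y = ∑ m ∈ T, tmul (coef m x) (monomial m 1)
        + ∑ m ∈ T, tmul (coef m y) (monomial m 1) := congrArg₂ _
      (hS T (Finset.union_subset_left hT)) (hS' T (Finset.union_subset_right hT))
    rw [← Finset.sum_add_distrib] at e
    refine e.trans ?_
    refine Finset.sum_congr rfl fun m _ => ?_
    rw [map_add, add_tmul]

theorem coef_ext {f g : Spinor} (h : ∀ m, coef m f = coef m g) : f = g := by
  rw [← sub_eq_zero]
  obtain ⟨S, hS⟩ := exists_eq_sum (f - g)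
  rw [hS S subset_rfl, Finset.sum_eq_zero]
  intro m _
  rw [map_sub, h, sub_self]
  exact zero_tmul _

theorem mem_tensSub_iff {S : Set (Fin 3 →₀ ℕ)} {f : Spinor} :
    f ∈ tensSub (restrictSupport ℝ S) ↔ ∀ m ∉ S, coef m f = 0 := by
  constructor
  · intro hf m hm
    induction hf using Submodule.span_induction with
    | mem x hx =>
      obtain ⟨v, p, hp, rfl⟩ := hx
      rw [coef_tmul, notMem_support_iff.1 fun h' => hm ((mem_restrictSupport_iff ℝ).1 hp h')]
      simp
    | zero => simp
    | add x y _ _ hx hy => rw [map_add, hx, hy, add_zero]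
    | smul c x _ hx => rw [map_smul, hx, smul_zero]
  · intro h
    obtain ⟨T, hT⟩ := exists_eq_sum f
    rw [hT T subset_rfl]
    refine Submodule.sum_mem _ fun m _ => ?_
    by_cases hm : m ∈ S
    · refine tmul_mem_tensSub _ ?_
      rw [monomial_mem_restrictSupport]
      exact Or.inl hm
    · rw [h m hm]
      rw [zero_tmul]
      exact zero_mem _

/-- The factor `m + k (1 - (-1)^m)` by which the Dunkl operator acts on the `m`-th power. -/
noncomputable def dnum (k : ℝ) (m : ℕ) : ℝ := m + k * (1 - (-1) ^ m)

theorem coeff_dunkl (k : Fin 3 → ℝ) (i : Fin 3) (m a : Fin 3 →₀ ℕ) :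
    coeff m (dunkl k i (monomial a 1))
      = dnum (k i) (m i + 1) * coeff (m + Finsupp.single i 1) (monomial a (1 : ℝ)) := by
  rw [dunkl_monomial, coeff_monomial, coeff_monomial]
  by_cases h : a = m + Finsupp.single i 1
  · subst h
    rw [if_pos (by simp), if_pos rfl]
    simp [dnum]
  · rw [if_neg h, mul_zero]
    split_ifs with h1
    · have h0 : a i = 0 := by
        by_contra h2
        apply h
        rw [← h1]
        ext l
        by_cases hl : i = l
        · subst hl; simp; omega
        · simp [hl]
      simp [h0]
    · rfl

theorem coeff_refl (i : Fin 3) (m a : Fin 3 →₀ ℕ) :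
    coeff m (refl i (monomial a 1)) = (-1) ^ m i * coeff m (monomial a (1 : ℝ)) := by
  rw [refl_monomial, coeff_monomial, coeff_monomial]
  split_ifs with h
  · rw [h]
  · simp

end BannaiIto

namespace BannaiIto
open MvPolynomial

theorem coef_dunkl (k : Fin 3 → ℝ) (i : Fin 3) (M : Matrix (Fin 2) (Fin 2) ℂ) (m : Fin 3 →₀ ℕ)
    (f : Spinor) : coef m (tens M (dunkl k i) f)
      = (dnum (k i) (m i + 1) : ℂ) • M.mulVec (coef (m + Finsupp.single i 1) f) :=
  tens_coef (coeff_dunkl k i m) M f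

theorem coef_refl (i : Fin 3) (M : Matrix (Fin 2) (Fin 2) ℂ) (m : Fin 3 →₀ ℕ)
    (f : Spinor) : coef m (tens M (refl i) f) = (-1 : ℂ) ^ m i • M.mulVec (coef m f) := by
  rw [tens_coef (coeff_refl i m) M f]
  push_cast
  rfl

theorem coef_mulX_add (i : Fin 3) (M : Matrix (Fin 2) (Fin 2) ℂ) (m : Fin 3 →₀ ℕ)
    (f : Spinor) : coef (m + Finsupp.single i 1) (tens M (mulX i) f) = M.mulVec (coef m f) := by
  rw [tens_coef (r := 1) (m' := m) (fun a => ?_) M f, Complex.ofReal_one, one_smul]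
  rw [mulX_monomial, coeff_monomial, coeff_monomial, one_mul]
  simp

theorem coef_mulX_zero {i : Fin 3} (M : Matrix (Fin 2) (Fin 2) ℂ) {m : Fin 3 →₀ ℕ} (hm : m i = 0)
    (f : Spinor) : coef m (tens M (mulX i) f) = 0 := by
  rw [tens_coef (r := 0) (m' := m) (fun a => ?_) M f, Complex.ofReal_zero, zero_smul]
  rw [mulX_monomial, coeff_monomial, zero_mul, if_neg]
  rintro rfl
  simp at hm

/-- The exponent with entries `l`, `p`, `q` at `j`, `j + 1`, `j + 2`. -/
noncomputable def ex (j : Fin 3) (l p q : ℕ) : Fin 3 →₀ ℕ :=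
  Finsupp.single j l + Finsupp.single (j + 1) p + Finsupp.single (j + 2) q

theorem ex_zero (j : Fin 3) (l p q : ℕ) : ex j l p q j = l := by simp [ex]

theorem ex_one (j : Fin 3) (l p q : ℕ) : ex j l p q (j + 1) = p := by simp [ex]

theorem ex_two (j : Fin 3) (l p q : ℕ) : ex j l p q (j + 2) = q := by simp [ex]

theorem eq_or_eq_or_eq (i j : Fin 3) : j = i ∨ j = i + 1 ∨ j = i + 2 := by revert i j; decide

theorem ex_self (j : Fin 3) (m : Fin 3 →₀ ℕ) : ex j (m j) (m (j + 1)) (m (j + 2)) = m := by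
  ext i
  rcases eq_or_eq_or_eq j i with rfl | rfl | rfl
  · rw [ex_zero]
  · rw [ex_one]
  · rw [ex_two]

theorem ex_degree (j : Fin 3) (l p q : ℕ) : (ex j l p q).degree = l + p + q := by
  simp [ex, map_add]

theorem ex_add_zero (j : Fin 3) (l p q : ℕ) :
    ex j l p q + Finsupp.single j 1 = ex j (l + 1) p q := by
  simp only [ex, Finsupp.single_add]; abel

theorem ex_add_one (j : Fin 3) (l p q : ℕ) :
    ex j l p q + Finsupp.single (j + 1) 1 = ex j l (p + 1) q := by
  simp only [ex, Finsupp.single_add]; abel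

theorem ex_add_two (j : Fin 3) (l p q : ℕ) :
    ex j l p q + Finsupp.single (j + 2) 1 = ex j l p (q + 1) := by
  simp only [ex, Finsupp.single_add]; abel

theorem sum_eq_shift {A : Type*} [AddCommMonoid A] (j : Fin 3) (F : Fin 3 → A) :
    ∑ i, F i = F j + F (j + 1) + F (j + 2) := by
  rw [Fin.sum_univ_three]
  fin_cases j
  · rfl
  · change F 0 + F 1 + F 2 = F 1 + F 2 + F 0; abel
  · change F 0 + F 1 + F 2 = F 2 + F 0 + F 1; abel

theorem coef_dirac (k : Fin 3 → ℝ) (j : Fin 3) (l p q : ℕ) (f : Spinor) :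
    coef (ex j l p q) (dirac k f)
      = (dnum (k j) (l + 1) : ℂ) • (pauli j).mulVec (coef (ex j (l + 1) p q) f)
      + (dnum (k (j + 1)) (p + 1) : ℂ) • (pauli (j + 1)).mulVec (coef (ex j l (p + 1) q) f)
      + (dnum (k (j + 2)) (q + 1) : ℂ) • (pauli (j + 2)).mulVec (coef (ex j l p (q + 1)) f) := by
  rw [dirac, LinearMap.sum_apply, map_sum, sum_eq_shift j, coef_dunkl, coef_dunkl, coef_dunkl,
    ex_zero, ex_one, ex_two, ex_add_zero, ex_add_one, ex_add_two]

theorem pauli_sq (j : Fin 3) : pauli j * pauli j = 1 := by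
  fin_cases j <;> ext a b <;> fin_cases a <;> fin_cases b <;> simp [pauli]

theorem pauli_mul (j : Fin 3) : pauli j * pauli (j + 1) = Complex.I • pauli (j + 2) := by
  fin_cases j <;> ext a b <;> fin_cases a <;> fin_cases b <;> simp [pauli]

theorem pauli_mul' (j : Fin 3) : pauli (j + 1) * pauli j = -Complex.I • pauli (j + 2) := by
  fin_cases j <;> ext a b <;> fin_cases a <;> fin_cases b <;> simp [pauli]

theorem dirac_solve {k : Fin 3 → ℝ} {f : Spinor} (hf : dirac k f = 0) (j : Fin 3) (l p q : ℕ) :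
    (dnum (k j) (l + 1) : ℂ) • coef (ex j (l + 1) p q) f
      = -((dnum (k (j + 1)) (p + 1) : ℂ) • (pauli j * pauli (j + 1)).mulVec (coef (ex j l (p + 1) q) f))
      - (dnum (k (j + 2)) (q + 1) : ℂ) • (pauli j * pauli (j + 2)).mulVec (coef (ex j l p (q + 1)) f) := by
  have h := coef_dirac k j l p q f
  rw [hf, map_zero] at h
  have h2 := congrArg (fun x => (pauli j).mulVec x) h
  simp only [Matrix.mulVec_zero, Matrix.mulVec_add, Matrix.mulVec_smul, Matrix.mulVec_mulVec,
    pauli_sq, Matrix.one_mulVec] at h2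
  rw [eq_sub_iff_add_eq, eq_neg_iff_add_eq_zero, h2]
  abel

theorem add_two_add_one (j : Fin 3) : j + 2 + 1 = j := by revert j; decide
theorem add_two_add_two (j : Fin 3) : j + 2 + 2 = j + 1 := by revert j; decide
theorem add_one_add_one (j : Fin 3) : j + 1 + 1 = j + 2 := by revert j; decide
theorem add_one_add_two (j : Fin 3) : j + 1 + 2 = j := by revert j; decide

theorem biOp_apply (k : Fin 3 → ℝ) (i : Fin 3) (f : Spinor) : biOp k i f =
    tens (Complex.I • pauli i) (mulX (i + 2)) (tens 1 (dunkl k (i + 1))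
      (tens 1 (refl (i + 1)) (tens 1 (refl (i + 2)) f)))
    - tens (Complex.I • pauli i) (mulX (i + 1)) (tens 1 (dunkl k (i + 2))
      (tens 1 (refl (i + 1)) (tens 1 (refl (i + 2)) f)))
    + ((1 / 2 : ℂ) • tens 1 (refl (i + 1)) (tens 1 (refl (i + 2)) f)
      + (k (i + 1) : ℂ) • tens 1 (refl (i + 2)) f + (k (i + 2) : ℂ) • tens 1 (refl (i + 1)) f) := by
  have h : ∀ P : Poly →ₗ[ℝ] Poly, tens (Complex.I • pauli i) P
    = tens (Complex.I • pauli i) 1 * tens 1 P := fun P => by rw [tens_mul, mul_one, one_mul]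
  rw [biOp_eq, absOp, h (mulX _), h (mulX _)]
  simp only [LinearMap.add_apply, LinearMap.smul_apply, Module.End.mul_apply, LinearMap.sub_apply,
    map_sub]

/-- The action of `gen (j + 2)` on the coefficients of degree zero in `x_j`. -/
theorem coef_biOp_two_zero (k : Fin 3 → ℝ) (j : Fin 3) (q : ℕ) (f : Spinor) :
    coef (ex j 0 0 q) (biOp k (j + 2) f)
      = (1 / 2 + k j + k (j + 1) : ℂ) • coef (ex j 0 0 q) f := by
  rw [biOp_apply, add_two_add_one, add_two_add_two, map_add, map_sub,
    coef_mulX_zero _ (ex_one j 0 0 q), coef_mulX_zero _ (ex_zero j 0 0 q)]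
  simp only [map_add, map_smul, coef_refl, ex_zero, ex_one, Matrix.one_mulVec, pow_zero, one_smul]
  module

theorem coef_biOp_two_succ {k : Fin 3 → ℝ} {f : Spinor} (hf : dirac k f = 0) (j : Fin 3) (p q : ℕ) :
    coef (ex j 0 (p + 1) q) (biOp k (j + 2) f)
      = ((-1) ^ (p + 1) * ((p + 1 : ℕ) + 1 / 2 + k j + k (j + 1)) : ℂ) • coef (ex j 0 (p + 1) q) f
        + ((-1) ^ (p + 1) * Complex.I * dnum (k (j + 2)) (q + 1) : ℂ) •
          (pauli j).mulVec (coef (ex j 0 p (q + 1)) f) := by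
  rw [biOp_apply, add_two_add_one, add_two_add_two, map_add, map_sub, ← ex_add_one,
    coef_mulX_add, ex_add_one, coef_mulX_zero _ (ex_zero j 0 _ q), coef_dunkl, ex_add_zero]
  have h := dirac_solve hf j 0 p q
  have hp : pauli (j + 2) * pauli j = Complex.I • pauli (j + 1) := by
    have := pauli_mul (j + 2)
    rwa [add_two_add_one, add_two_add_two] at this
  have e1 : pauli (j + 2) * (pauli j * pauli (j + 1)) = Complex.I • 1 := by
    rw [← mul_assoc, hp, smul_mul_assoc, pauli_sq]
  have e2 : pauli (j + 2) * (pauli j * pauli (j + 2)) = -pauli j := by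
    have h3 := pauli_mul (j + 1)
    rw [add_one_add_one, add_one_add_two] at h3
    rw [← mul_assoc, hp, smul_mul_assoc, h3, smul_smul, Complex.I_mul_I, neg_one_smul]
  have h2 := congrArg (fun x => (pauli (j + 2)).mulVec x) h
  simp only [Matrix.mulVec_sub, Matrix.mulVec_neg, Matrix.mulVec_smul, Matrix.mulVec_mulVec,
    e1, e2] at h2
  simp only [map_add, map_smul, coef_refl, ex_zero, ex_one, Matrix.one_mulVec, pow_zero, one_smul,
    Matrix.mulVec_smul, Matrix.smul_mulVec, Matrix.neg_mulVec] at h2 ⊢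
  have hd : (dnum (k (j + 1)) (p + 1) : ℂ) = (p + 1 : ℕ) + k (j + 1) * (1 - (-1) ^ (p + 1)) := by
    rw [dnum]; push_cast; rfl
  have hs : ((-1 : ℂ) ^ p) ^ 2 = 1 := by rw [← pow_mul, mul_comm, pow_mul]; simp
  rw [hd] at h2
  linear_combination (norm := skip) (-(-1) ^ p * Complex.I : ℂ) • h2
  rw [← sub_eq_zero]
  match_scalars
  · ring
  · ring_nf
    rw [Complex.I_sq, pow_mul, hs]
    ring
  · ring

/-- The action of `gen (j + 1)` on the coefficients of degree zero in `x_j`. -/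
theorem coef_biOp_one_zero (k : Fin 3 → ℝ) (j : Fin 3) (p : ℕ) (f : Spinor) :
    coef (ex j 0 p 0) (biOp k (j + 1) f)
      = (1 / 2 + k j + k (j + 2) : ℂ) • coef (ex j 0 p 0) f := by
  rw [biOp_apply, add_one_add_one, add_one_add_two, map_add, map_sub,
    coef_mulX_zero _ (ex_two j 0 p 0), coef_mulX_zero _ (ex_zero j 0 p 0)]
  simp only [map_add, map_smul, coef_refl, ex_zero, ex_two, Matrix.one_mulVec, pow_zero, one_smul]
  module

theorem coef_biOp_one_succ {k : Fin 3 → ℝ} {f : Spinor} (hf : dirac k f = 0) (j : Fin 3) (p q : ℕ) :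
    coef (ex j 0 p (q + 1)) (biOp k (j + 1) f)
      = ((-1) ^ (q + 1) * ((q + 1 : ℕ) + 1 / 2 + k j + k (j + 2)) : ℂ) • coef (ex j 0 p (q + 1)) f
        + (-(-1) ^ (q + 1) * Complex.I * dnum (k (j + 1)) (p + 1) : ℂ) •
          (pauli j).mulVec (coef (ex j 0 (p + 1) q) f) := by
  rw [biOp_apply, add_one_add_one, add_one_add_two, map_add, map_sub,
    coef_mulX_zero _ (ex_zero j 0 p _), ← ex_add_two,
    coef_mulX_add, ex_add_two, coef_dunkl, ex_add_zero]
  have h := dirac_solve hf j 0 p q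
  have hp := pauli_mul' j
  have e1 : pauli (j + 1) * (pauli j * pauli (j + 2)) = -Complex.I • 1 := by
    rw [← mul_assoc, hp, smul_mul_assoc, pauli_sq]
  have e2 : pauli (j + 1) * (pauli j * pauli (j + 1)) = -pauli j := by
    have h3 := pauli_mul' (j + 1)
    rw [add_one_add_one, add_one_add_two] at h3
    rw [← mul_assoc, hp, smul_mul_assoc, h3, smul_smul, neg_mul_neg, Complex.I_mul_I, neg_one_smul]
  have h2 := congrArg (fun x => (pauli (j + 1)).mulVec x) h
  simp only [Matrix.mulVec_sub, Matrix.mulVec_neg, Matrix.mulVec_smul, Matrix.mulVec_mulVec,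
    e1, e2] at h2
  simp only [map_add, map_smul, coef_refl, ex_zero, ex_two, Matrix.one_mulVec, pow_zero, one_smul,
    Matrix.mulVec_smul, Matrix.smul_mulVec, Matrix.neg_mulVec] at h2 ⊢
  have hd : (dnum (k (j + 2)) (q + 1) : ℂ) = (q + 1 : ℕ) + k (j + 2) * (1 - (-1) ^ (q + 1)) := by
    rw [dnum]; push_cast; rfl
  have hs : ((-1 : ℂ) ^ q) ^ 2 = 1 := by rw [← pow_mul, mul_comm, pow_mul]; simp
  rw [hd] at h2
  linear_combination (norm := skip) ((-1) ^ q * Complex.I : ℂ) • h2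
  rw [← sub_eq_zero]
  match_scalars
  · ring
  · ring_nf
    rw [Complex.I_sq, pow_mul, hs]
    ring
  · ring

end BannaiIto

namespace BannaiIto
open MvPolynomial

/-! ### Cauchy-Kovalevskaya extension -/

theorem exists_pauli_eigen (j : Fin 3) : ∃ L : (Fin 2 → ℂ) ≃ₗ[ℂ] ℂ × ℂ,
    ∀ v, L ((pauli j).mulVec v) = ((L v).1, -(L v).2) := by
  have mk : ∀ x y z w : ℂ, x * w - y * z ≠ 0 →
      (∀ v, x * (pauli j).mulVec v 0 + y * (pauli j).mulVec v 1 = x * v 0 + y * v 1) →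
      (∀ v, z * (pauli j).mulVec v 0 + w * (pauli j).mulVec v 1 = -(z * v 0 + w * v 1)) →
      ∃ L : (Fin 2 → ℂ) ≃ₗ[ℂ] ℂ × ℂ, ∀ v, L ((pauli j).mulVec v) = ((L v).1, -(L v).2) := by
    intro x y z w hD h1 h2
    refine ⟨{ toFun := fun v => (x * v 0 + y * v 1, z * v 0 + w * v 1)
              invFun := fun c => ![(w * c.1 - y * c.2) / (x * w - y * z),
                (x * c.2 - z * c.1) / (x * w - y * z)]
              map_add' := ?_, map_smul' := ?_, left_inv := ?_, right_inv := ?_ }, ?_⟩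
    · intro u v; ext <;> simp <;> ring
    · intro c v; ext <;> simp <;> ring
    · intro v
      ext i
      fin_cases i
      · simp
        rw [div_eq_iff hD]
        ring
      · simp
        rw [div_eq_iff hD]
        ring
    · rintro ⟨c, c'⟩
      ext
      · simp
        rw [← mul_div_assoc, ← mul_div_assoc, ← add_div, div_eq_iff hD]
        ring
      · simp
        rw [← mul_div_assoc, ← mul_div_assoc, ← add_div, div_eq_iff hD]
        ring
    · intro v
      exact Prod.ext (h1 v) (h2 v)
  fin_cases j
  · refine mk 1 1 1 (-1) (by norm_num) (fun v => ?_) (fun v => ?_)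
    · simp [pauli, Matrix.mulVec, dotProduct, Fin.sum_univ_two]
      ring
    · simp [pauli, Matrix.mulVec, dotProduct, Fin.sum_univ_two]
  · refine mk 1 (-Complex.I) 1 Complex.I ?_ (fun v => ?_) (fun v => ?_)
    · rw [one_mul, mul_one, sub_neg_eq_add, ← two_mul]
      exact mul_ne_zero two_ne_zero Complex.I_ne_zero
    · simp [pauli, Matrix.mulVec, dotProduct, Fin.sum_univ_two]
      rw [← mul_assoc, Complex.I_mul_I]
      ring
    · simp [pauli, Matrix.mulVec, dotProduct, Fin.sum_univ_two]
      rw [← mul_assoc, Complex.I_mul_I]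
      ring
  · refine mk 1 0 0 1 (by norm_num) (fun v => ?_) (fun v => ?_) <;>
      simp [pauli, Matrix.mulVec, dotProduct, Fin.sum_univ_two]

theorem dirac_monogenics {k : Fin 3 → ℝ} {n : ℕ} (f : monogenics k n) : dirac k (f : Spinor) = 0 :=
  LinearMap.mem_ker.1 f.2.2

theorem coef_of_degree_ne {k : Fin 3 → ℝ} {n : ℕ} (f : monogenics k n) {m : Fin 3 →₀ ℕ}
    (hm : m.degree ≠ n) : coef m (f : Spinor) = 0 := by
  have h : (f : Spinor) ∈ tensSub (homogeneousSubmodule (Fin 3) ℝ n) := f.2.1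
  rw [homogeneous_eq] at h
  exact mem_tensSub_iff.1 h m hm

theorem mem_Mx_iff {k : Fin 3 → ℝ} {n : ℕ} {i : Fin 3} {f : monogenics k n} :
    f ∈ Mx k n i ↔ ∀ m : Fin 3 →₀ ℕ, (m i : ℕ∞) < tval (k i) → coef m (f : Spinor) = 0 := by
  change (f : Spinor) ∈ tensSub _ ↔ _
  rw [xFilt_eq, mem_tensSub_iff]
  constructor
  · intro h m hm
    exact h m fun h' => absurd h'.2 (not_le.2 hm)
  · intro h m hm
    by_cases hd : m.degree = n
    · exact h m (not_le.1 fun h' => hm ⟨hd, h'⟩)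
    · exact coef_of_degree_ne f hd

/-- Vanishing of coefficients spreads from degree zero in `x_j` to all degrees. -/
theorem coef_spread {k : Fin 3 → ℝ} {n : ℕ} {j : Fin 3}
    (hk : ∀ l, 1 ≤ l → l ≤ n → dnum (k j) l ≠ 0) (S : ℕ → ℕ → Prop)
    (hS : ∀ p q, S p q → (S (p + 1) q ∨ dnum (k (j + 1)) (p + 1) = 0) ∧
      (S p (q + 1) ∨ dnum (k (j + 2)) (q + 1) = 0))
    {f : monogenics k n} (h0 : ∀ p q, S p q → coef (ex j 0 p q) (f : Spinor) = 0) (l : ℕ) :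
    ∀ p q, S p q → coef (ex j l p q) (f : Spinor) = 0 := by
  induction l with
  | zero => exact h0
  | succ l ih =>
    intro p q hpq
    by_cases hl : l + 1 ≤ n
    · have h := dirac_solve (dirac_monogenics f) j l p q
      have h1 : (dnum (k (j + 1)) (p + 1) : ℂ) •
          (pauli j * pauli (j + 1)).mulVec (coef (ex j l (p + 1) q) (f : Spinor)) = 0 := by
        rcases (hS p q hpq).1 with h | h
        · rw [ih _ _ h, Matrix.mulVec_zero, smul_zero]
        · rw [h, Complex.ofReal_zero, zero_smul]
      have h2 : (dnum (k (j + 2)) (q + 1) : ℂ) •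
          (pauli j * pauli (j + 2)).mulVec (coef (ex j l p (q + 1)) (f : Spinor)) = 0 := by
        rcases (hS p q hpq).2 with h | h
        · rw [ih _ _ h, Matrix.mulVec_zero, smul_zero]
        · rw [h, Complex.ofReal_zero, zero_smul]
      rw [h1, h2, neg_zero, sub_zero] at h
      exact (smul_eq_zero.1 h).resolve_left (Complex.ofReal_ne_zero.2 (hk _ (by omega) hl))
    · exact coef_of_degree_ne f (by rw [ex_degree]; omega)

/-- The coefficients of the monogenic extension of a polynomial in `x_{j+1}`, `x_{j+2}`. -/
noncomputable def ckCoef (k : Fin 3 → ℝ) (n : ℕ) (j : Fin 3) (c : ℕ → Fin 2 → ℂ) :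
    ℕ → ℕ → ℕ → Fin 2 → ℂ
  | 0, p, q => if p + q = n then c p else 0
  | l + 1, p, q => (dnum (k j) (l + 1) : ℂ)⁻¹ •
      (-((dnum (k (j + 1)) (p + 1) : ℂ) • (pauli j * pauli (j + 1)).mulVec (ckCoef k n j c l (p + 1) q))
      - (dnum (k (j + 2)) (q + 1) : ℂ) • (pauli j * pauli (j + 2)).mulVec (ckCoef k n j c l p (q + 1)))

theorem ckCoef_eq_zero (k : Fin 3 → ℝ) {n : ℕ} (j : Fin 3) (c : ℕ → Fin 2 → ℂ) (l : ℕ) :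
    ∀ p q, l + p + q ≠ n → ckCoef k n j c l p q = 0 := by
  induction l with
  | zero => intro p q h; rw [ckCoef, if_neg (by omega)]
  | succ l ih =>
    intro p q h
    rw [ckCoef, ih _ _ (by omega), ih _ _ (by omega)]
    simp

theorem exists_monogenic {k : Fin 3 → ℝ} {n : ℕ} {j : Fin 3}
    (hk : ∀ l, 1 ≤ l → l ≤ n → dnum (k j) l ≠ 0) (c : ℕ → Fin 2 → ℂ) :
    ∃ f : monogenics k n, ∀ p q, p + q = n → coef (ex j 0 p q) (f : Spinor) = c p := by
  classical
  set T : Finset (Fin 3 →₀ ℕ) := Finset.finsuppAntidiag Finset.univ n with hT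
  have memT : ∀ m : Fin 3 →₀ ℕ, m ∈ T ↔ m.degree = n := by
    intro m
    rw [hT, Finset.mem_finsuppAntidiag, Finsupp.degree_eq_sum]
    simp
  set G := ckCoef k n j c with hG
  set f : Spinor := ∑ m ∈ T, tmul (G (m j) (m (j + 1)) (m (j + 2))) (monomial m 1) with hf
  have hcoef : ∀ l p q, coef (ex j l p q) f = G l p q := by
    intro l p q
    have h1 : ∀ m ∈ T, coef (ex j l p q) (tmul (G (m j) (m (j + 1)) (m (j + 2))) (monomial m 1))
        = if m = ex j l p q then G l p q else 0 := by
      intro m _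
      rw [coef_tmul, coeff_monomial]
      split_ifs with h
      · rw [h, ex_zero, ex_one, ex_two, Complex.ofReal_one, one_smul]
      · rw [Complex.ofReal_zero, zero_smul]
    rw [hf, map_sum, Finset.sum_congr rfl h1, Finset.sum_ite_eq']
    split_ifs with h
    · rfl
    · rw [memT, ex_degree] at h
      rw [hG, ckCoef_eq_zero _ _ _ _ _ _ h]
  have hD : dirac k f = 0 := by
    refine coef_ext fun m => ?_
    rw [← ex_self j m, coef_dirac, hcoef, hcoef, hcoef, map_zero]
    generalize m j = l
    generalize m (j + 1) = p
    generalize m (j + 2) = q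
    by_cases h : l + 1 + p + q = n
    · have hne : (dnum (k j) (l + 1) : ℂ) ≠ 0 :=
        Complex.ofReal_ne_zero.2 (hk _ (by omega) (by omega))
      have e : ∀ M v, (pauli j).mulVec ((pauli j * M).mulVec v) = M.mulVec v := by
        intro M v
        rw [Matrix.mulVec_mulVec, ← mul_assoc, pauli_sq, one_mul]
      rw [hG, ckCoef, Matrix.mulVec_smul, smul_inv_smul₀ hne, Matrix.mulVec_sub, Matrix.mulVec_neg,
        Matrix.mulVec_smul, Matrix.mulVec_smul, e, e]
      abel
    · rw [hG, ckCoef_eq_zero _ _ _ _ _ _ h, ckCoef_eq_zero _ _ _ _ _ _ (by omega),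
        ckCoef_eq_zero _ _ _ _ _ _ (by omega)]
      simp
  refine ⟨⟨f, ?_, LinearMap.mem_ker.2 hD⟩, fun p q h => ?_⟩
  · change f ∈ tensSub (homogeneousSubmodule (Fin 3) ℝ n)
    rw [homogeneous_eq]
    refine mem_tensSub_iff.2 fun m hm => ?_
    rw [← ex_self j m, hcoef, hG, ckCoef_eq_zero]
    rw [← ex_degree j, ex_self]
    exact hm
  · change coef _ f = _
    rw [hcoef, hG, ckCoef, if_pos h]

theorem dnum_zero_of_tval {k : ℝ} {t : ℕ} (ht : tval k = t) : dnum k t = 0 := by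
  rcases tval_cases k with ⟨m, hm, hk, h⟩ | h
  · have : m = t := by rw [h] at ht; exact_mod_cast ht
    subst this
    rw [dnum, hm.neg_one_pow, ← hk]
    ring
  · rw [h] at ht
    exact absurd ht.symm (ENat.natCast_ne_top _)

theorem dnum_ne_zero {k : ℝ} {l : ℕ} (h1 : 1 ≤ l) (h : tval k ≠ l) : dnum k l ≠ 0 := by
  intro h0
  rcases Nat.even_or_odd l with e | e
  · rw [dnum, e.neg_one_pow] at h0
    have : (l : ℝ) ≠ 0 := by exact_mod_cast (by omega : l ≠ 0)
    apply this
    linarith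
  · rw [dnum, e.neg_one_pow] at h0
    exact h (tval_of_odd e (by linarith))

end BannaiIto

namespace BannaiIto
open MvPolynomial

/-! ### Homomorphisms from bidiagonal coordinates -/

theorem Split.exists_hom_of_coords {V W : Type*} [AddCommGroup V] [Module ℂ V] [Module BI V]
    [IsScalarTower ℂ BI V] [AddCommGroup W] [Module ℂ W] [Module BI W] [IsScalarTower ℂ BI W]
    {d : ℕ} {θ θs φ : ℕ → ℂ} {s : Fin 3 → ℂ} (T : Split W d θ θs φ s) {ε : ℤˣ × ℤˣ}
    {σ : Equiv.Perm (Fin 3)} (hV : Central V fun i => ((sgn ε (σ i) : ℤ) : ℂ) * s (σ i))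
    {δ : ℂ} {j a b : Fin 3} (hab : a = j + 1 ∧ b = j + 2 ∨ a = j + 2 ∧ b = j + 1)
    (ha : BI.aut ε σ (BI.gen a) = δ • BI.gen 0) (hb : BI.aut ε σ (BI.gen b) = δ • BI.gen 1)
    (y : ℕ → V →ₗ[ℂ] ℂ) (u w : ℕ → ℂ) (hu : ∀ i < d, u i ≠ 0)
    (hA : ∀ f, y 0 (BI.gen a • f) = δ * (θ 0 * y 0 f))
    (hA' : ∀ i < d, ∀ f, y (i + 1) (BI.gen a • f) = δ * (θ (i + 1) * y (i + 1) f + u i * y i f))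
    (hB : ∀ f, y d (BI.gen b • f) = δ * (θs d * y d f))
    (hB' : ∀ i < d, ∀ f, y i (BI.gen b • f) = δ * (θs i * y i f + w i * y (i + 1) f))
    (hφ : ∀ i < d, φ (i + 1) = u i * w i) :
    ∃ Φ : V →ₗ[BI] Twist (BI.aut ε σ) W, (∀ f, Φ f = 0 ↔ ∀ i ≤ d, y i f = 0) ∧
      ∀ v, ∃ c : ℕ → ℂ, ∀ f, (∀ i ≤ d, y i f = c i) → Φ f = v := by
  set G : ℕ → ℂ := fun i => ∏ r ∈ Finset.range i, (u r)⁻¹ with hG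
  have G0 : ∀ i ≤ d, G i ≠ 0 := fun i hi => Finset.prod_ne_zero_iff.2 fun r hr =>
    inv_ne_zero (hu r (by rw [Finset.mem_range] at hr; omega))
  have Gs : ∀ i < d, G (i + 1) * u i = G i := by
    intro i hi
    rw [hG]
    simp only
    rw [Finset.prod_range_succ, mul_assoc, inv_mul_cancel₀ (hu i hi), mul_one]
  let C : V →ₗ[ℂ] (Fin (d + 1) → ℂ) := LinearMap.pi fun i => G i • y i
  have hC : ∀ f, C f = fun i : Fin (d + 1) => G i * y i f := fun f => rfl
  let Ψ : V →ₗ[ℂ] W := T.e.symm.toLinearMap ∘ₗ C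
  have hΨ : ∀ f, T.e (Ψ f) = C f := fun f => T.e.apply_symm_apply _
  have h0 : ∀ f, Ψ (BI.gen a • f) = (δ • BI.gen 0) • Ψ f := by
    intro f
    apply T.e.injective
    rw [smul_assoc, T.e.map_smul, T.e_zero, hΨ, hΨ, hC, hC, matX_mulVec d θ fun i => G i * y i f]
    ext ⟨i, hi⟩
    rcases i with _ | i
    · simp only [Pi.smul_apply, smul_eq_mul, seqX, hA]
      ring
    · simp only [Pi.smul_apply, smul_eq_mul, seqX]
      rw [hA' i (by omega), ← Gs i (by omega)]
      ring
  have h1 : ∀ f, Ψ (BI.gen b • f) = (δ • BI.gen 1) • Ψ f := by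
    intro f
    apply T.e.injective
    rw [smul_assoc, T.e.map_smul, T.e_one, hΨ, hΨ, hC, hC, matY_mulVec d θs φ (fun i => G i * y i f) T.last]
    ext ⟨i, hi⟩
    simp only [Pi.smul_apply, smul_eq_mul, seqY]
    rcases Nat.lt_or_ge i d with h | h
    · rw [hB' i h, hφ i h, ← Gs i h]
      ring
    · obtain rfl : i = d := by omega
      rw [hB, T.last]
      ring
  let Ψ' : V →ₗ[ℂ] Twist (BI.aut ε σ) W := Ψ
  have e0 : ∀ f, Ψ' (BI.gen a • f) = BI.gen a • Ψ' f := by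
    intro f
    have := h0 f
    rw [← ha] at this
    exact this
  have e1 : ∀ f, Ψ' (BI.gen b • f) = BI.gen b • Ψ' f := by
    intro f
    have := h1 f
    rw [← hb] at this
    exact this
  have key : ∀ l v, Ψ' (BI.gen l • v) = BI.gen l • Ψ' v := by
    rcases hab with ⟨rfl, rfl⟩ | ⟨rfl, rfl⟩
    · exact hV.third (T.central.twist ε σ) Ψ' j e0 e1
    · exact hV.third (T.central.twist ε σ) Ψ' j e1 e0
  refine ⟨BI.linearMap Ψ' key, fun f => ?_, fun v => ?_⟩
  · change Ψ f = 0 ↔ _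
    rw [← T.e.map_eq_zero_iff, hΨ, hC]
    constructor
    · intro h i hi
      exact (mul_eq_zero.1 (congrFun h ⟨i, by omega⟩)).resolve_left (G0 i hi)
    · intro h
      ext i
      rw [h i (by omega), mul_zero, Pi.zero_apply]
  · have lift (v : W) : ∃ c : ℕ → ℂ, ∀ f, (∀ i ≤ d, y i f = c i) → Ψ f = v := by
      refine ⟨fun i => if h : i < d + 1 then (G i)⁻¹ * T.e v ⟨i, h⟩ else 0, fun f hf => ?_⟩
      apply T.e.injective
      rw [hΨ, hC]
      ext i
      simp only [hf i (by omega), i.2, dif_pos]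
      rw [mul_inv_cancel_left₀ (G0 i (by omega))]
    exact lift v

/-- If vector coordinates on `V` satisfy bidiagonal recurrences twisted by a Pauli matrix, then a
quotient of `V` is a direct sum of two copies of the module with these recurrences. -/
theorem Split.twoCopies_of_coords {V W : Type*} [AddCommGroup V] [Module ℂ V] [Module BI V]
    [IsScalarTower ℂ BI V] [AddCommGroup W] [Module ℂ W] [Module BI W] [IsScalarTower ℂ BI W]
    {d : ℕ} {θ θs φ : ℕ → ℂ} {s : Fin 3 → ℂ} (T : Split W d θ θs φ s) {ε : ℤˣ × ℤˣ}
    {σ : Equiv.Perm (Fin 3)} (hV : Central V fun i => ((sgn ε (σ i) : ℤ) : ℂ) * s (σ i))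
    {δ : ℂ} {j a b : Fin 3} (hab : a = j + 1 ∧ b = j + 2 ∨ a = j + 2 ∧ b = j + 1)
    (ha : BI.aut ε σ (BI.gen a) = δ • BI.gen 0) (hb : BI.aut ε σ (BI.gen b) = δ • BI.gen 1)
    (y : ℕ → V →ₗ[ℂ] (Fin 2 → ℂ)) (u w : ℕ → ℂ) (hu : ∀ i < d, u i ≠ 0)
    (hA : ∀ f, y 0 (BI.gen a • f) = δ • θ 0 • y 0 f)
    (hA' : ∀ i < d, ∀ f, y (i + 1) (BI.gen a • f)
      = δ • (θ (i + 1) • y (i + 1) f + u i • (pauli j).mulVec (y i f)))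
    (hB : ∀ f, y d (BI.gen b • f) = δ • θs d • y d f)
    (hB' : ∀ i < d, ∀ f, y i (BI.gen b • f)
      = δ • (θs i • y i f + w i • (pauli j).mulVec (y (i + 1) f)))
    (hφ : ∀ i < d, φ (i + 1) = u i * w i)
    (N : Submodule BI V) (hN : ∀ f, f ∈ N ↔ ∀ i ≤ d, y i f = 0)
    (hsurj : ∀ c : ℕ → Fin 2 → ℂ, ∃ f, ∀ i ≤ d, y i f = c i) :
    TwoCopies (V ⧸ N) (Twist (BI.aut ε σ) W) := by
  obtain ⟨L, hL⟩ := exists_pauli_eigen j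
  obtain ⟨Φ, hΦ, hΦ'⟩ := T.exists_hom_of_coords hV hab ha hb
    (fun i => LinearMap.fst ℂ ℂ ℂ ∘ₗ L.toLinearMap ∘ₗ y i) u w hu
    (fun f => by
      simp only [LinearMap.comp_apply, LinearEquiv.coe_coe,
        LinearMap.fst_apply, hA, map_smul, smul_eq_mul])
    (fun i hi f => by
      simp only [LinearMap.comp_apply, LinearEquiv.coe_coe,
        LinearMap.fst_apply, hA' i hi, map_add, map_smul, hL, smul_eq_mul])
    (fun f => by
      simp only [LinearMap.comp_apply, LinearEquiv.coe_coe,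
        LinearMap.fst_apply, hB, map_smul, smul_eq_mul])
    (fun i hi f => by
      simp only [LinearMap.comp_apply, LinearEquiv.coe_coe,
        LinearMap.fst_apply, hB' i hi, map_add, map_smul, hL, smul_eq_mul])
    hφ
  obtain ⟨Ψ, hΨ, hΨ'⟩ := T.exists_hom_of_coords hV hab ha hb
    (fun i => LinearMap.snd ℂ ℂ ℂ ∘ₗ L.toLinearMap ∘ₗ y i) (fun i => -u i) (fun i => -w i)
    (fun i hi => neg_ne_zero.2 (hu i hi))
    (fun f => by
      simp only [LinearMap.comp_apply, LinearEquiv.coe_coe,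
        LinearMap.snd_apply, hA, map_smul, smul_eq_mul])
    (fun i hi f => by
      simp only [LinearMap.comp_apply, LinearEquiv.coe_coe,
        LinearMap.snd_apply, hA' i hi, map_add, map_smul, hL, smul_eq_mul]
      ring)
    (fun f => by
      simp only [LinearMap.comp_apply, LinearEquiv.coe_coe,
        LinearMap.snd_apply, hB, map_smul, smul_eq_mul])
    (fun i hi f => by
      simp only [LinearMap.comp_apply, LinearEquiv.coe_coe,
        LinearMap.snd_apply, hB' i hi, map_add, map_smul, hL, smul_eq_mul]
      ring)
    (fun i hi => by rw [hφ i hi, neg_mul_neg])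
  have hker : LinearMap.ker (Φ.prod Ψ) = N := by
    ext f
    rw [LinearMap.ker_prod, Submodule.mem_inf, LinearMap.mem_ker, LinearMap.mem_ker, hΦ, hΨ, hN, ← forall₂_and]
    refine forall₂_congr fun i _ => ?_
    rw [← L.map_eq_zero_iff]
    exact Prod.mk_eq_zero.symm
  have hs : Function.Surjective (Φ.prod Ψ) := by
    rintro ⟨v, v'⟩
    obtain ⟨c, hc⟩ := hΦ' v
    obtain ⟨c', hc'⟩ := hΨ' v'
    obtain ⟨f, hf⟩ := hsurj fun i => L.symm (c i, c' i)
    refine ⟨f, Prod.ext (hc f fun i hi => ?_) (hc' f fun i hi => ?_)⟩ <;> simp [hf i hi]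
  exact ⟨(Submodule.quotEquivOfEq _ _ hker.symm).trans (LinearMap.quotKerEquivOfSurjective _ hs)⟩

/-! ### Central elements on monogenics -/

theorem central_monogenics (k : Fin 3 → ℝ) {n : ℕ} (hn : Odd n) : Central (monogenics k n)
    fun i => 2 * (k (i + 1) * k (i + 2) - (k 0 + k 1 + k 2 + n + 1) * k i) := by
  intro i f
  refine Subtype.ext ?_
  have h := biOp_quad k n (i + 1) f.2
  rw [show i + 1 + 1 = i + 2 by rw [add_assoc]; rfl, show i + 1 + 2 = i by rw [add_assoc]; exact add_zero i,
    hn.neg_one_pow] at h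
  simp only [Submodule.coe_sub, Submodule.coe_add, gen_smul, Submodule.coe_smul]
  rw [h]
  congr 1
  push_cast
  ring

theorem Central.submodule {V : Type*} [AddCommGroup V] [Module ℂ V] [Module BI V]
    [IsScalarTower ℂ BI V] {s : Fin 3 → ℂ} (hV : Central V s) (P : Submodule BI V) : Central P s :=
  hV.of_injective P.subtype P.injective_subtype fun _ _ => rfl

end BannaiIto

namespace BannaiIto
open MvPolynomial

/-! ### The reducible case -/

theorem odd_of_tval {k : ℝ} {t : ℕ} (ht : tval k = t) : Odd t ∧ -2 * k = t := by
  rcases tval_cases k with ⟨m, hm, hk, h⟩ | h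
  · have : m = t := by rw [h] at ht; exact_mod_cast ht
    exact this ▸ ⟨hm, hk⟩
  · rw [h] at ht
    exact absurd ht.symm (ENat.natCast_ne_top _)

theorem dnum_even {k : ℝ} {m : ℕ} (h : Even m) : dnum k m = m := by
  rw [dnum, h.neg_one_pow]
  ring

theorem dnum_odd {k : ℝ} {m : ℕ} (h : Odd m) : dnum k m = m + 2 * k := by
  rw [dnum, h.neg_one_pow]
  ring

theorem coef_of_add_ne {k : Fin 3 → ℝ} {n : ℕ} {j : Fin 3} (f : monogenics k n) {p q : ℕ} (hpq : p + q ≠ n) :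
    coef (ex j 0 p q) (f : Spinor) = 0 :=
  coef_of_degree_ne f (by rw [ex_degree]; omega)

theorem coef_gen_two_zero {k : Fin 3 → ℝ} {n : ℕ} (j : Fin 3) (f : monogenics k n) (q : ℕ) :
    coef (ex j 0 0 q) ((BI.gen (j + 2) • f : monogenics k n) : Spinor)
      = (1 / 2 + k j + k (j + 1) : ℂ) • coef (ex j 0 0 q) (f : Spinor) := by
  rw [gen_smul, coef_biOp_two_zero]

theorem coef_gen_one_zero {k : Fin 3 → ℝ} {n : ℕ} (j : Fin 3) (f : monogenics k n) (p : ℕ) :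
    coef (ex j 0 p 0) ((BI.gen (j + 1) • f : monogenics k n) : Spinor)
      = (1 / 2 + k j + k (j + 2) : ℂ) • coef (ex j 0 p 0) (f : Spinor) := by
  rw [gen_smul, coef_biOp_one_zero]

theorem coef_gen_two_succ {k : Fin 3 → ℝ} {n : ℕ} (j : Fin 3) (f : monogenics k n) (p q : ℕ) :
    coef (ex j 0 (p + 1) q) ((BI.gen (j + 2) • f : monogenics k n) : Spinor)
      = ((-1) ^ (p + 1) * ((p + 1 : ℕ) + 1 / 2 + k j + k (j + 1)) : ℂ) •
          coef (ex j 0 (p + 1) q) (f : Spinor)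
        + ((-1) ^ (p + 1) * Complex.I * dnum (k (j + 2)) (q + 1) : ℂ) •
          (pauli j).mulVec (coef (ex j 0 p (q + 1)) (f : Spinor)) := by
  rw [gen_smul, coef_biOp_two_succ (dirac_monogenics f)]

theorem coef_gen_one_succ {k : Fin 3 → ℝ} {n : ℕ} (j : Fin 3) (f : monogenics k n) (p q : ℕ) :
    coef (ex j 0 p (q + 1)) ((BI.gen (j + 1) • f : monogenics k n) : Spinor)
      = ((-1) ^ (q + 1) * ((q + 1 : ℕ) + 1 / 2 + k j + k (j + 2)) : ℂ) •
          coef (ex j 0 p (q + 1)) (f : Spinor)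
        + (-(-1) ^ (q + 1) * Complex.I * dnum (k (j + 1)) (p + 1) : ℂ) •
          (pauli j).mulVec (coef (ex j 0 (p + 1) q) (f : Spinor)) := by
  rw [gen_smul, coef_biOp_one_succ (dirac_monogenics f)]

theorem sum_eq (k : Fin 3 → ℝ) (j : Fin 3) : k 0 + k 1 + k 2 = k j + k (j + 1) + k (j + 2) := by
  have : j = 0 ∨ j = 1 ∨ j = 2 := by revert j; decide
  rcases this with rfl | rfl | rfl
  · simp
  · simp
    ring
  · simp
    ring

/-- The hypothesis `t_{j+1} + t_{j+2} ≤ n < t_j` with `t_{j+1} = t`, `t_{j+2} = r`. -/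
structure Reducible (k : Fin 3 → ℝ) (n : ℕ) (j : Fin 3) (t r : ℕ) : Prop where
  odd : Odd n
  lt : (n : ℕ∞) < tval (k j)
  one : tval (k (j + 1)) = t
  two : tval (k (j + 2)) = r
  le : t + r ≤ n

namespace Reducible

variable {k : Fin 3 → ℝ} {n : ℕ} {j : Fin 3} {t r : ℕ} (h : Reducible k n j t r)
include h

theorem dnum_ne_zero (l : ℕ) (h1 : 1 ≤ l) (h2 : l ≤ n) : dnum (k j) l ≠ 0 := by
  refine BannaiIto.dnum_ne_zero h1 fun h' => absurd h.lt (not_lt.2 ?_)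
  rw [h']
  exact_mod_cast h2

theorem dnum_one_ne_zero {l : ℕ} (h1 : t < l) : dnum (k (j + 1)) l ≠ 0 := by
  refine BannaiIto.dnum_ne_zero (by omega) fun h' => ?_
  rw [h.one] at h'
  have : t = l := by exact_mod_cast h'
  omega

theorem dnum_two_ne_zero {l : ℕ} (h1 : r < l) : dnum (k (j + 2)) l ≠ 0 := by
  refine BannaiIto.dnum_ne_zero (by omega) fun h' => ?_
  rw [h.two] at h'
  have : r = l := by exact_mod_cast h'
  omega

theorem mem_Mx_one {f : monogenics k n} :
    f ∈ Mx k n (j + 1) ↔ ∀ p q, p < t → coef (ex j 0 p q) (f : Spinor) = 0 := by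
  rw [mem_Mx_iff, h.one]
  constructor
  · intro hf p q hp
    refine hf _ ?_
    rw [ex_one]
    exact_mod_cast hp
  · intro hf m hm
    rw [← ex_self j m]
    refine coef_spread h.dnum_ne_zero (fun p _ => p < t) (fun p q hp => ⟨?_, Or.inl hp⟩) hf _ _ _
      (by exact_mod_cast hm)
    rcases Nat.lt_or_ge (p + 1) t with h' | h'
    · exact Or.inl h'
    · obtain rfl : p + 1 = t := by omega
      exact Or.inr (dnum_zero_of_tval h.one)

theorem mem_Mx_two {f : monogenics k n} :
    f ∈ Mx k n (j + 2) ↔ ∀ p q, q < r → coef (ex j 0 p q) (f : Spinor) = 0 := by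
  rw [mem_Mx_iff, h.two]
  constructor
  · intro hf p q hp
    refine hf _ ?_
    rw [ex_two]
    exact_mod_cast hp
  · intro hf m hm
    rw [← ex_self j m]
    refine coef_spread h.dnum_ne_zero (fun _ q => q < r) (fun p q hp => ⟨Or.inl hp, ?_⟩) hf _ _ _
      (by exact_mod_cast hm)
    rcases Nat.lt_or_ge (q + 1) r with h' | h'
    · exact Or.inl h'
    · obtain rfl : q + 1 = r := by omega
      exact Or.inr (dnum_zero_of_tval h.two)

theorem eq_zero {f : monogenics k n} (hf : ∀ p q, coef (ex j 0 p q) (f : Spinor) = 0) : f = 0 := by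
  refine Subtype.ext (coef_ext fun m => ?_)
  rw [← ex_self j m]
  exact (coef_spread h.dnum_ne_zero (fun _ _ => True) (fun p q hp => ⟨Or.inl hp, Or.inl hp⟩)
    (fun p q _ => hf p q) _ _ _ trivial).trans (map_zero _).symm

theorem exists_mem (c : ℕ → Fin 2 → ℂ) :
    ∃ f : monogenics k n, (∀ p q, p + q = n → coef (ex j 0 p q) (f : Spinor) = c p) ∧
      ((∀ p < t, c p = 0) → f ∈ Mx k n (j + 1)) ∧
      ((∀ p q, p + q = n → q < r → c p = 0) → f ∈ Mx k n (j + 2)) := by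
  obtain ⟨f, hf⟩ := exists_monogenic h.dnum_ne_zero c
  refine ⟨f, hf, fun hc => h.mem_Mx_one.2 fun p q hp => ?_, fun hc => h.mem_Mx_two.2 fun p q hq => ?_⟩
  · by_cases hpq : p + q = n
    · rw [hf p q hpq, hc p hp]
    · exact coef_of_add_ne f hpq
  · by_cases hpq : p + q = n
    · rw [hf p q hpq, hc p q hpq hq]
    · exact coef_of_add_ne f hpq

end Reducible

end BannaiIto

namespace BannaiIto
open MvPolynomial

theorem neg_one_pow_of_add_odd {m l n : ℕ} (hn : Odd n) (h : m + l = n) :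
    (-1 : ℂ) ^ l = -(-1) ^ m := by
  subst h
  rcases Nat.even_or_odd m with e | e
  · have := (Nat.odd_add'.1 hn).2 e
    rw [e.neg_one_pow, this.neg_one_pow]
  · have := (Nat.odd_add.1 hn).1 e
    rw [e.neg_one_pow, this.neg_one_pow, neg_neg]

theorem neg_one_pow_mul_self (i : ℕ) : (-1 : ℂ) ^ i * (-1) ^ i = 1 := by
  rw [← mul_pow]
  simp

theorem ofReal_of_tval {k : ℝ} {t : ℕ} (ht : tval k = t) : (k : ℂ) = -t / 2 := by
  have e' : k = -t / 2 := by linarith [(odd_of_tval ht).2]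
  rw [e']
  push_cast
  ring

namespace Reducible

variable {k : Fin 3 → ℝ} {n : ℕ} {j : Fin 3} {t r : ℕ} (h : Reducible k n j t r)
  {V : Type*} [AddCommGroup V] [Module ℂ V] [Module BI V] [IsScalarTower ℂ BI V]
  (ι : V →ₗ[ℂ] monogenics k n) (hι : ∀ i v, ι (BI.gen i • v) = BI.gen i • ι v)
  {σ : Equiv.Perm (Fin 3)}

include h hι

theorem twoCopies_O_one
    (hV : Central V fun i => 2 * (k (i + 1) * k (i + 2) - (k 0 + k 1 + k 2 + n + 1) * k i))
    (h0 : σ (j + 2) = 0) (h1 : σ (j + 1) = 1) (h2 : σ j = 2)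
    {d : ℕ} (hd : Even d) (hdt : d + 1 = t) {a b c : ℂ} (ha : a = k j)
    (hb : b = -(k 0 + k 1 + k 2 + n + 1)) (hc : c = k (j + 2))
    (N : Submodule BI V) (hN : ∀ f, f ∈ N ↔ ι f ∈ Mx k n (j + 1))
    (hs : ∀ c : ℕ → Fin 2 → ℂ, ∃ f, ∀ p < t, ∀ q, p + q = n →
      coef (ex j 0 p q) (ι f : Spinor) = c p) :
    TwoCopies (V ⧸ N) (Twist (BI.aut (1, 1) σ) (O d hd a b c)) := by
  have hn := h.odd
  have hle := h.le
  have hr := (odd_of_tval h.two).1.pos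
  have ek : (k (j + 1) : ℂ) = -(d + 1) / 2 := by
    rw [ofReal_of_tval h.one, ← hdt]
    push_cast
    ring
  have es : (k 0 + k 1 + k 2 : ℂ) = k j + k (j + 1) + k (j + 2) := by exact_mod_cast sum_eq k j
  refine (splitO d hd a b c).twoCopies_of_coords (s := _) (δ := 1) (j := j) (a := j + 2) (b := j + 1)
    ?_ (Or.inr ⟨rfl, rfl⟩) ?_ ?_
    (fun i => coef (ex j 0 i (n - i)) ∘ₗ (monogenics k n).subtype ∘ₗ ι)
    (fun i => (-1) ^ (i + 1) * Complex.I * dnum (k (j + 2)) (n - i))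
    (fun i => (-1) ^ i * Complex.I * dnum (k (j + 1)) (i + 1)) ?_ ?_ ?_ ?_ ?_ ?_ N ?_ ?_
  · convert hV using 1
    ext i
    have hi : i = j ∨ i = j + 1 ∨ i = j + 2 := by clear * -; revert i j; decide
    rw [es, ek]
    rw [es, ek] at hb
    rcases hi with rfl | rfl | rfl
    · rw [h2, ek]
      simp [sgn, ha, hb, hc]
      ring
    · rw [h1, add_one_add_one, add_one_add_two, ek]
      simp [sgn, ha, hb, hc]
      ring
    · rw [h0, add_two_add_one, add_two_add_two, ek]
      simp [sgn, ha, hb, hc]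
      ring
  · rw [BI.aut_one_gen, h0, one_smul]
  · rw [BI.aut_one_gen, h1, one_smul]
  · intro i hi
    refine mul_ne_zero (mul_ne_zero (pow_ne_zero _ (by norm_num)) Complex.I_ne_zero)
      (Complex.ofReal_ne_zero.2 (h.dnum_two_ne_zero (by omega)))
  · intro f
    simp only [LinearMap.comp_apply, hι]
    refine (coef_gen_two_zero j (ι f) _).trans ?_
    rw [one_smul]
    change _ = _ • coef _ (ι f : Spinor)
    congr 1
    rw [theta, ha, ek]
    push_cast
    ring
  · intro i hi f
    obtain ⟨q, hq⟩ : ∃ q, n - i = q + 1 := ⟨n - i - 1, by omega⟩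
    have hq' : n - (i + 1) = q := by omega
    simp only [LinearMap.comp_apply, hι, hq, hq']
    refine (coef_gen_two_succ j (ι f) i q).trans ?_
    rw [one_smul]
    change _ = _ • coef _ (ι f : Spinor) + _ • Matrix.mulVec _ (coef _ (ι f : Spinor))
    congr 2
    rw [theta, ha, ek]
    push_cast
    ring
  · intro f
    obtain ⟨q, hq⟩ : ∃ q, n - d = q + 1 := ⟨n - d - 1, by omega⟩
    simp only [LinearMap.comp_apply, hι, hq]
    refine (coef_gen_one_succ j (ι f) d q).trans ?_
    rw [hdt, dnum_zero_of_tval h.one, Complex.ofReal_zero, mul_zero, zero_smul, add_zero, one_smul]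
    change _ = _ • coef _ (ι f : Spinor)
    congr 1
    have hnq : (n : ℂ) = d + (q + 1) := by
      exact_mod_cast (show n = d + (q + 1) by omega)
    rw [theta, hb, es, ek, neg_one_pow_of_add_odd hn (show d + (q + 1) = n by omega), hnq]
    push_cast
    ring
  · intro i hi f
    obtain ⟨q, hq⟩ : ∃ q, n - i = q + 1 := ⟨n - i - 1, by omega⟩
    have hq' : n - (i + 1) = q := by omega
    simp only [LinearMap.comp_apply, hι, hq, hq']
    refine (coef_gen_one_succ j (ι f) i q).trans ?_
    rw [one_smul]
    change _ = _ • coef _ (ι f : Spinor) + _ • Matrix.mulVec _ (coef _ (ι f : Spinor))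
    have hnq : (n : ℂ) = i + (q + 1) := by
      exact_mod_cast (show n = i + (q + 1) by omega)
    rw [neg_one_pow_of_add_odd hn (show i + (q + 1) = n by omega)]
    congr 2
    · rw [theta, hb, es, ek, hnq]
      push_cast
      ring
    · ring
  · intro i hi
    obtain ⟨l, hl⟩ : ∃ l, n = i + l := ⟨n - i, by omega⟩
    have hl' : n - i = l := by omega
    have e1 : ((-1 : ℂ) ^ (i + 1) * Complex.I * dnum (k (j + 2)) (n - i))
        * ((-1) ^ i * Complex.I * dnum (k (j + 1)) (i + 1))
        = dnum (k (j + 2)) l * dnum (k (j + 1)) (i + 1) := by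
      rw [hl']
      linear_combination (((-1) ^ i * (-1) ^ i) * dnum (k (j + 2)) l * dnum (k (j + 1)) (i + 1))
        * (-1) * Complex.I_sq + dnum (k (j + 2)) l * dnum (k (j + 1)) (i + 1) * neg_one_pow_mul_self i
    rw [e1, phiO, ha, hb, hc, es]
    rcases Nat.even_or_odd i with e | e
    · have ho : Odd l := (Nat.odd_add'.1 (hl ▸ hn)).2 e
      rw [if_neg (Nat.not_even_iff_odd.2 e.add_one), dnum_odd ho, dnum_odd e.add_one]
      push_cast
      rw [ek, hl]
      push_cast
      ring
    · have ho : Even l := (Nat.odd_add.1 (hl ▸ hn)).1 e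
      rw [if_pos e.add_one, dnum_even ho, dnum_even e.add_one, ek, hl]
      push_cast
      ring
  · intro f
    rw [hN, h.mem_Mx_one]
    constructor
    · exact fun hf i hi => hf i _ (by omega)
    · intro hf p q hp
      by_cases hpq : p + q = n
      · have := hf p (by omega)
        rwa [show n - p = q by omega] at this
      · exact coef_of_add_ne _ hpq
  · intro c
    obtain ⟨f, hf⟩ := hs c
    exact ⟨f, fun i hi => hf i (by omega) (n - i) (by omega)⟩

theorem twoCopies_O_two
    (hV : Central V fun i => 2 * (k (i + 1) * k (i + 2) - (k 0 + k 1 + k 2 + n + 1) * k i))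
    (h0 : σ (j + 1) = 0) (h1 : σ (j + 2) = 1) (h2 : σ j = 2)
    {d : ℕ} (hd : Even d) (hdt : d + 1 = r) {a b c : ℂ} (ha : a = k j)
    (hb : b = -(k 0 + k 1 + k 2 + n + 1)) (hc : c = k (j + 1))
    (N : Submodule BI V) (hN : ∀ f, f ∈ N ↔ ι f ∈ Mx k n (j + 2))
    (hs : ∀ c : ℕ → Fin 2 → ℂ, ∃ f, ∀ q < r, ∀ p, p + q = n →
      coef (ex j 0 p q) (ι f : Spinor) = c q) :
    TwoCopies (V ⧸ N) (Twist (BI.aut (1, 1) σ) (O d hd a b c)) := by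
  have hn := h.odd
  have hle := h.le
  have hr := (odd_of_tval h.one).1.pos
  have ek : (k (j + 2) : ℂ) = -(d + 1) / 2 := by
    rw [ofReal_of_tval h.two, ← hdt]
    push_cast
    ring
  have es : (k 0 + k 1 + k 2 : ℂ) = k j + k (j + 1) + k (j + 2) := by exact_mod_cast sum_eq k j
  refine (splitO d hd a b c).twoCopies_of_coords (s := _) (δ := 1) (j := j) (a := j + 1) (b := j + 2)
    ?_ (Or.inl ⟨rfl, rfl⟩) ?_ ?_
    (fun i => coef (ex j 0 (n - i) i) ∘ₗ (monogenics k n).subtype ∘ₗ ι)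
    (fun i => -(-1) ^ (i + 1) * Complex.I * dnum (k (j + 1)) (n - i))
    (fun i => -(-1) ^ i * Complex.I * dnum (k (j + 2)) (i + 1)) ?_ ?_ ?_ ?_ ?_ ?_ N ?_ ?_
  · convert hV using 1
    ext i
    have hi : i = j ∨ i = j + 1 ∨ i = j + 2 := by clear * -; revert i j; decide
    rw [es, ek]
    rw [es, ek] at hb
    rcases hi with rfl | rfl | rfl
    · rw [h2, ek]
      simp [sgn, ha, hb, hc]
      ring
    · rw [h0, add_one_add_one, add_one_add_two, ek]
      simp [sgn, ha, hb, hc]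
      ring
    · rw [h1, add_two_add_one, add_two_add_two, ek]
      simp [sgn, ha, hb, hc]
      ring
  · rw [BI.aut_one_gen, h0, one_smul]
  · rw [BI.aut_one_gen, h1, one_smul]
  · intro i hi
    refine mul_ne_zero (mul_ne_zero (neg_ne_zero.2 (pow_ne_zero _ (by norm_num))) Complex.I_ne_zero)
      (Complex.ofReal_ne_zero.2 (h.dnum_one_ne_zero (by omega)))
  · intro f
    simp only [LinearMap.comp_apply, hι]
    refine (coef_gen_one_zero j (ι f) _).trans ?_
    rw [one_smul]
    change _ = _ • coef _ (ι f : Spinor)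
    congr 1
    rw [theta, ha, ek]
    push_cast
    ring
  · intro i hi f
    obtain ⟨q, hq⟩ : ∃ q, n - i = q + 1 := ⟨n - i - 1, by omega⟩
    have hq' : n - (i + 1) = q := by omega
    simp only [LinearMap.comp_apply, hι, hq, hq']
    refine (coef_gen_one_succ j (ι f) q i).trans ?_
    rw [one_smul]
    change _ = _ • coef _ (ι f : Spinor) + _ • Matrix.mulVec _ (coef _ (ι f : Spinor))
    congr 2
    rw [theta, ha, ek]
    push_cast
    ring
  · intro f
    obtain ⟨q, hq⟩ : ∃ q, n - d = q + 1 := ⟨n - d - 1, by omega⟩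
    simp only [LinearMap.comp_apply, hι, hq]
    refine (coef_gen_two_succ j (ι f) q d).trans ?_
    rw [hdt, dnum_zero_of_tval h.two, Complex.ofReal_zero, mul_zero, zero_smul, add_zero, one_smul]
    change _ = _ • coef _ (ι f : Spinor)
    congr 1
    have hnq : (n : ℂ) = d + (q + 1) := by
      exact_mod_cast (show n = d + (q + 1) by omega)
    rw [theta, hb, es, ek, neg_one_pow_of_add_odd hn (show d + (q + 1) = n by omega), hnq]
    push_cast
    ring
  · intro i hi f
    obtain ⟨q, hq⟩ : ∃ q, n - i = q + 1 := ⟨n - i - 1, by omega⟩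
    have hq' : n - (i + 1) = q := by omega
    simp only [LinearMap.comp_apply, hι, hq, hq']
    refine (coef_gen_two_succ j (ι f) q i).trans ?_
    rw [one_smul]
    change _ = _ • coef _ (ι f : Spinor) + _ • Matrix.mulVec _ (coef _ (ι f : Spinor))
    have hnq : (n : ℂ) = i + (q + 1) := by
      exact_mod_cast (show n = i + (q + 1) by omega)
    rw [neg_one_pow_of_add_odd hn (show i + (q + 1) = n by omega)]
    congr 2
    rw [theta, hb, es, ek, hnq]
    push_cast
    ring
  · intro i hi
    obtain ⟨l, hl⟩ : ∃ l, n = i + l := ⟨n - i, by omega⟩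
    have hl' : n - i = l := by omega
    have e1 : (-(-1 : ℂ) ^ (i + 1) * Complex.I * dnum (k (j + 1)) (n - i))
        * (-(-1) ^ i * Complex.I * dnum (k (j + 2)) (i + 1))
        = dnum (k (j + 1)) l * dnum (k (j + 2)) (i + 1) := by
      rw [hl']
      linear_combination (((-1) ^ i * (-1) ^ i) * dnum (k (j + 1)) l * dnum (k (j + 2)) (i + 1))
        * (-1) * Complex.I_sq + dnum (k (j + 1)) l * dnum (k (j + 2)) (i + 1) * neg_one_pow_mul_self i
    rw [e1, phiO, ha, hb, hc, es]
    rcases Nat.even_or_odd i with e | e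
    · have ho : Odd l := (Nat.odd_add'.1 (hl ▸ hn)).2 e
      rw [if_neg (Nat.not_even_iff_odd.2 e.add_one), dnum_odd ho, dnum_odd e.add_one]
      push_cast
      rw [ek, hl]
      push_cast
      ring
    · have ho : Even l := (Nat.odd_add.1 (hl ▸ hn)).1 e
      rw [if_pos e.add_one, dnum_even ho, dnum_even e.add_one, ek, hl]
      push_cast
      ring
  · intro f
    rw [hN, h.mem_Mx_two]
    constructor
    · exact fun hf i hi => hf _ i (by omega)
    · intro hf p q hq
      by_cases hpq : p + q = n
      · have := hf q (by omega)
        rwa [show n - q = p by omega] at this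
      · exact coef_of_add_ne _ hpq
  · intro c
    obtain ⟨f, hf⟩ := hs c
    exact ⟨f, fun i hi => hf i (by omega) (n - i) (by omega)⟩


theorem twoCopies_E
    (hV : Central V fun i => 2 * (k (i + 1) * k (i + 2) - (k 0 + k 1 + k 2 + n + 1) * k i))
    (h0 : σ (j + 2) = 0) (h1 : σ (j + 1) = 1) (h2 : σ j = 2)
    {d : ℕ} (hd : Odd d) (hdt : t + d + r = n) {a b c : ℂ} (ha : a = k (j + 2) + k j + (n + 1) / 2)
    (hb : b = -k j - k (j + 1) - (n + 1) / 2) (hc : c = (n + 1) / 2)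
    (hV1 : ∀ f, ι f ∈ Mx k n (j + 1)) (hV2 : ∀ f, ι f ∈ Mx k n (j + 2))
    (N : Submodule BI V) (hN : ∀ f, f ∈ N ↔ ι f = 0)
    (hs : ∀ c : ℕ → Fin 2 → ℂ, ∃ f, ∀ p q, t ≤ p → r ≤ q → p + q = n →
      coef (ex j 0 p q) (ι f : Spinor) = c p) :
    TwoCopies (V ⧸ N) (Twist (BI.aut (-1, -1) σ) (E d hd a b c)) := by
  have hn := h.odd
  have ht := (odd_of_tval h.one).1
  have hr := (odd_of_tval h.two).1
  have h1t := ht.pos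
  have h1r := hr.pos
  have ek := ofReal_of_tval h.one
  have ek' := ofReal_of_tval h.two
  have en : (n : ℂ) = t + d + r := by exact_mod_cast hdt.symm
  have es : (k 0 + k 1 + k 2 : ℂ) = k j + k (j + 1) + k (j + 2) := by exact_mod_cast sum_eq k j
  have sg0 : sgn (-1, -1) 0 = -1 := rfl
  have sg1 : sgn (-1, -1) 1 = -1 := rfl
  have sg2 : sgn (-1, -1) 2 = 1 := rfl
  refine (splitE d hd a b c).twoCopies_of_coords (s := _) (δ := -1) (j := j) (a := j + 2) (b := j + 1)
    ?_ (Or.inr ⟨rfl, rfl⟩) ?_ ?_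
    (fun i => coef (ex j 0 (t + i) (n - (t + i))) ∘ₗ (monogenics k n).subtype ∘ₗ ι)
    (fun i => -(-1) ^ i * Complex.I * dnum (k (j + 2)) (n - (t + i)))
    (fun i => (-1) ^ i * Complex.I * dnum (k (j + 1)) (t + i + 1)) ?_ ?_ ?_ ?_ ?_ ?_ N ?_ ?_
  · convert hV using 1
    ext i
    have hi : i = j ∨ i = j + 1 ∨ i = j + 2 := by clear * -; revert i j; decide
    rw [es, ek, ek', en]
    rw [ek, en] at hb
    rw [ek', en] at ha
    rw [en] at hc
    rcases hi with rfl | rfl | rfl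
    · rw [h2, ek, ek', sg2]
      simp [ha, hb, hc]
      ring
    · rw [h1, add_one_add_one, add_one_add_two, ek, ek', sg1]
      simp [ha, hb, hc]
      ring
    · rw [h0, add_two_add_one, add_two_add_two, ek, ek', sg0]
      simp [ha, hb, hc]
      ring
  · rw [BI.aut_gen, h0, sg0]
    simp
  · rw [BI.aut_gen, h1, sg1]
    simp
  · intro i hi
    refine mul_ne_zero (mul_ne_zero (neg_ne_zero.2 (pow_ne_zero _ (by norm_num))) Complex.I_ne_zero)
      (Complex.ofReal_ne_zero.2 (h.dnum_two_ne_zero (by omega)))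
  · intro f
    obtain ⟨p, hp⟩ : ∃ p, t = p + 1 := ⟨t - 1, by omega⟩
    simp only [LinearMap.comp_apply, hι, hp, add_zero]
    refine (coef_gen_two_succ j (ι f) p _).trans ?_
    rw [h.mem_Mx_one.1 (hV1 f) p _ (by omega), Matrix.mulVec_zero, smul_zero, add_zero, smul_smul]
    change _ = _ • coef _ (ι f : Spinor)
    congr 1
    rw [← hp, ht.neg_one_pow, theta, ha, ek, ek', en]
    push_cast
    ring
  · intro i hi f
    obtain ⟨q, hq⟩ : ∃ q, n - (t + i) = q + 1 := ⟨n - (t + i) - 1, by omega⟩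
    have hq' : n - (t + (i + 1)) = q := by omega
    simp only [LinearMap.comp_apply, hι, hq, hq']
    refine (coef_gen_two_succ j (ι f) (t + i) q).trans ?_
    rw [smul_add, smul_smul, smul_smul]
    change _ = _ • coef _ (ι f : Spinor) + _ • Matrix.mulVec _ (coef _ (ι f : Spinor))
    rw [pow_succ, pow_add, ht.neg_one_pow]
    congr 2
    · rw [theta, ha, ek, ek', en]
      push_cast
      ring
    · ring
  · intro f
    obtain ⟨q, hq⟩ : ∃ q, n - (t + d) = q + 1 := ⟨n - (t + d) - 1, by omega⟩
    simp only [LinearMap.comp_apply, hι, hq]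
    refine (coef_gen_one_succ j (ι f) (t + d) q).trans ?_
    rw [h.mem_Mx_two.1 (hV2 f) _ q (by omega), Matrix.mulVec_zero, smul_zero, add_zero, smul_smul]
    change _ = _ • coef _ (ι f : Spinor)
    congr 1
    have hqr : (r : ℂ) = q + 1 := by
      exact_mod_cast (show r = q + 1 by omega)
    rw [theta, hb, ek, ek', neg_one_pow_of_add_odd hn (show t + d + (q + 1) = n by omega), en, hqr,
      pow_add, ht.neg_one_pow]
    push_cast
    ring
  · intro i hi f
    obtain ⟨q, hq⟩ : ∃ q, n - (t + i) = q + 1 := ⟨n - (t + i) - 1, by omega⟩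
    have hq' : n - (t + (i + 1)) = q := by omega
    simp only [LinearMap.comp_apply, hι, hq, hq']
    refine (coef_gen_one_succ j (ι f) (t + i) q).trans ?_
    rw [smul_add, smul_smul, smul_smul]
    change _ = _ • coef _ (ι f : Spinor) + _ • Matrix.mulVec _ (coef _ (ι f : Spinor))
    have hqr : (q : ℂ) = d + r - i - 1 := by
      rw [eq_sub_iff_add_eq, eq_sub_iff_add_eq]
      exact_mod_cast (show q + 1 + i = d + r by omega)
    rw [neg_one_pow_of_add_odd hn (show t + i + (q + 1) = n by omega), pow_add, ht.neg_one_pow]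
    congr 2
    · rw [theta, hb, ek, ek', en]
      push_cast
      rw [hqr]
      ring
    · ring
  · intro i hi
    obtain ⟨l, hl⟩ : ∃ l, n = t + i + l := ⟨n - (t + i), by omega⟩
    have hl' : n - (t + i) = l := by omega
    have e1 : (-(-1 : ℂ) ^ i * Complex.I * dnum (k (j + 2)) (n - (t + i)))
        * ((-1) ^ i * Complex.I * dnum (k (j + 1)) (t + i + 1))
        = dnum (k (j + 2)) l * dnum (k (j + 1)) (t + i + 1) := by
      rw [hl']
      linear_combination (((-1) ^ i * (-1) ^ i) * dnum (k (j + 2)) l * dnum (k (j + 1)) (t + i + 1))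
        * (-1) * Complex.I_sq
        + dnum (k (j + 2)) l * dnum (k (j + 1)) (t + i + 1) * neg_one_pow_mul_self i
    have hlr : (l : ℂ) = d + r - i := by
      rw [eq_sub_iff_add_eq]
      exact_mod_cast (show l + i = d + r by omega)
    rw [e1, phiE, ha, hb, hc]
    rcases Nat.even_or_odd i with e | e
    · have ho : Even l := (Nat.odd_add.1 (hl ▸ hn)).1 (ht.add_even e)
      rw [if_neg (Nat.not_even_iff_odd.2 e.add_one), dnum_even ho, dnum_even (ht.add_even e).add_one]
      push_cast
      rw [ek, ek', hlr, en]
      ring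
    · have ho : Odd l := (Nat.odd_add'.1 (hl ▸ hn)).2 (ht.add_odd e)
      rw [if_pos e.add_one, dnum_odd ho, dnum_odd (ht.add_odd e).add_one]
      push_cast
      rw [ek, ek', hlr]
      ring
  · intro f
    rw [hN]
    constructor
    · intro hf i _
      simp [hf]
    · intro hf
      refine h.eq_zero fun p q => ?_
      rcases Nat.lt_or_ge p t with hp | hp
      · exact h.mem_Mx_one.1 (hV1 f) p q hp
      rcases Nat.lt_or_ge q r with hq | hq
      · exact h.mem_Mx_two.1 (hV2 f) p q hq
      by_cases hpq : p + q = n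
      · have := hf (p - t) (by omega)
        rwa [show t + (p - t) = p by omega, show n - p = q by omega] at this
      · exact coef_of_add_ne _ hpq
  · intro c
    obtain ⟨f, hf⟩ := hs fun p => c (p - t)
    refine ⟨f, fun i hi => ?_⟩
    refine (hf (t + i) (n - (t + i)) (by omega) (by omega) (by omega)).trans ?_
    rw [show t + i - t = i by omega]

end Reducible

end BannaiIto

namespace BannaiIto
open MvPolynomial

theorem mem_submoduleOf_iff {R M : Type*} [Ring R] [AddCommGroup M] [Module R M] {P Q N : Submodule R M}
    (h : P = N ⊓ Q) {f : Q} : f ∈ P.submoduleOf Q ↔ (f : M) ∈ N := by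
  rw [Submodule.submoduleOf, Submodule.mem_comap, h]
  exact ⟨fun hf => hf.1, fun hf => ⟨hf, f.2⟩⟩

theorem tval_pred_add_one {k : ℝ} {t : ℕ} (h : tval k = t) : (tval k).toNat - 1 + 1 = t := by
  have := (odd_of_tval h).1.pos
  rw [h, ENat.toNat_natCast]
  omega

namespace Reducible

variable {k : Fin 3 → ℝ} {n : ℕ} {j : Fin 3} {t r : ℕ}

theorem mk_of_le (hn : Odd n) (h : tval (k (j + 1)) + tval (k (j + 2)) ≤ n)
    (hj : (n : ℕ∞) < tval (k j)) :
    Reducible k n j (tval (k (j + 1))).toNat (tval (k (j + 2))).toNat := by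
  have h1 : tval (k (j + 1)) ≠ ⊤ := fun h' => by simp [h'] at h
  have h2 : tval (k (j + 2)) ≠ ⊤ := fun h' => by simp [h'] at h
  refine ⟨hn, hj, (ENat.natCast_toNat h1).symm, (ENat.natCast_toNat h2).symm, ?_⟩
  rw [← ENat.natCast_toNat h1, ← ENat.natCast_toNat h2] at h
  exact_mod_cast h

variable (h : Reducible k n j t r) {σ : Equiv.Perm (Fin 3)}
include h

section
variable (h0 : σ (j + 2) = 0) (h1 : σ (j + 1) = 1) (h2 : σ j = 2)
    {d : ℕ} (hd : Even d) (hdt : d + 1 = t) {a b c : ℂ} (ha : a = k j)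
    (hb : b = -(k 0 + k 1 + k 2 + n + 1)) (hc : c = k (j + 2))
include h0 h1 h2 hdt ha hb hc

theorem twoCopies_quot_one :
    TwoCopies (monogenics k n ⧸ Mx k n (j + 1)) (Twist (BI.aut (1, 1) σ) (O d hd a b c)) := by
  refine h.twoCopies_O_one LinearMap.id (fun _ _ => rfl) (central_monogenics k h.odd) h0 h1 h2 hd hdt
    ha hb hc _ (fun f => Iff.rfl) fun c => ?_
  obtain ⟨f, hf, -⟩ := h.exists_mem c
  exact ⟨f, fun p _ q hpq => hf p q hpq⟩

theorem twoCopies_inf_quot_one {P : Submodule BI (monogenics k n)}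
    (hP : P = Mx k n (j + 1) ⊓ Mx k n (j + 2)) :
    TwoCopies (Mx k n (j + 2) ⧸ P.submoduleOf (Mx k n (j + 2)))
      (Twist (BI.aut (1, 1) σ) (O d hd a b c)) := by
  refine h.twoCopies_O_one ((Mx k n (j + 2)).subtype.restrictScalars ℂ) (fun _ _ => rfl)
    ((central_monogenics k h.odd).submodule _) h0 h1 h2 hd hdt
    ha hb hc _ (fun f => mem_submoduleOf_iff hP) fun c => ?_
  obtain ⟨f, hf, -, hf'⟩ := h.exists_mem fun p => if p < t then c p else 0
  refine ⟨⟨f, hf' fun p q hpq hq => if_neg ?_⟩, fun p hp q hpq => (hf p q hpq).trans (if_pos hp)⟩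
  have := h.le
  omega

end

section
variable (h0 : σ (j + 1) = 0) (h1 : σ (j + 2) = 1) (h2 : σ j = 2)
    {d : ℕ} (hd : Even d) (hdt : d + 1 = r) {a b c : ℂ} (ha : a = k j)
    (hb : b = -(k 0 + k 1 + k 2 + n + 1)) (hc : c = k (j + 1))
include h0 h1 h2 hdt ha hb hc

theorem twoCopies_quot_two :
    TwoCopies (monogenics k n ⧸ Mx k n (j + 2)) (Twist (BI.aut (1, 1) σ) (O d hd a b c)) := by
  refine h.twoCopies_O_two LinearMap.id (fun _ _ => rfl) (central_monogenics k h.odd) h0 h1 h2 hd hdt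
    ha hb hc _ (fun f => Iff.rfl) fun c => ?_
  obtain ⟨f, hf, -⟩ := h.exists_mem fun p => c (n - p)
  refine ⟨f, fun q _ p hpq => (hf p q hpq).trans ?_⟩
  rw [show n - p = q by omega]

theorem twoCopies_inf_quot_two {P : Submodule BI (monogenics k n)}
    (hP : P = Mx k n (j + 1) ⊓ Mx k n (j + 2)) :
    TwoCopies (Mx k n (j + 1) ⧸ P.submoduleOf (Mx k n (j + 1)))
      (Twist (BI.aut (1, 1) σ) (O d hd a b c)) := by
  refine h.twoCopies_O_two ((Mx k n (j + 1)).subtype.restrictScalars ℂ) (fun _ _ => rfl)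
    ((central_monogenics k h.odd).submodule _) h0 h1 h2 hd hdt
    ha hb hc _ (fun f => mem_submoduleOf_iff (hP.trans (inf_comm _ _))) fun c => ?_
  have hle := h.le
  obtain ⟨f, hf, hf', -⟩ := h.exists_mem fun p => if p < t then 0 else c (n - p)
  refine ⟨⟨f, hf' fun p hp => if_pos hp⟩, fun q hq p hpq => (hf p q hpq).trans ?_⟩
  rw [if_neg (by omega), show n - p = q by omega]

end

theorem twoCopies_inf (h0 : σ (j + 2) = 0) (h1 : σ (j + 1) = 1) (h2 : σ j = 2)
    {d : ℕ} (hd : Odd d) (hdt : t + d + r = n) {a b c : ℂ} (ha : a = k (j + 2) + k j + (n + 1) / 2)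
    (hb : b = -k j - k (j + 1) - (n + 1) / 2) (hc : c = (n + 1) / 2)
    {P : Submodule BI (monogenics k n)} (hP : P = Mx k n (j + 1) ⊓ Mx k n (j + 2)) :
    TwoCopies P (Twist (BI.aut (-1, -1) σ) (E d hd a b c)) := by
  subst hP
  have key := h.twoCopies_E ((Mx k n (j + 1) ⊓ Mx k n (j + 2)).subtype.restrictScalars ℂ)
    (fun _ _ => rfl) ((central_monogenics k h.odd).submodule _) h0 h1 h2 hd hdt ha hb hc
    (fun f => f.2.1) (fun f => f.2.2) ⊥
    (fun f => (Submodule.mem_bot BI).trans Submodule.coe_eq_zero.symm) fun c => by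
      obtain ⟨f, hf, hf1, hf2⟩ := h.exists_mem fun p => if t ≤ p ∧ p + r ≤ n then c p else 0
      refine ⟨⟨f, hf1 fun p hp => if_neg (by omega), hf2 fun p q hpq hq => if_neg (by omega)⟩,
        fun p q hp hq hpq => (hf p q hpq).trans (if_pos (by omega))⟩
  exact ⟨(Submodule.quotEquivOfEqBot ⊥ rfl).symm.trans key.some⟩

theorem generic_O_one (hk : 0 ≤ k j) {d : ℕ} (hdt : d + 1 = t) {a b c : ℂ} (ha : a = k j)
    (hb : b = -(k 0 + k 1 + k 2 + n + 1)) (hc : c = k (j + 2)) :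
    Generic d a b c ∧ Regular d a ∧ Regular d b := by
  have e1 := (odd_of_tval h.one).2
  have e2 := (odd_of_tval h.two).2
  have p2 : (1 : ℝ) ≤ r := by exact_mod_cast (odd_of_tval h.two).1.pos
  have hle : (t : ℝ) + r ≤ n := by exact_mod_cast h.le
  have ht : (d : ℝ) + 1 = t := by exact_mod_cast hdt
  have es := sum_eq k j
  have ra : a.re = k j := by rw [ha, Complex.ofReal_re]
  have rb : b.re = -(k j + k (j + 1) + k (j + 2) + n + 1) := by rw [hb, ← es]; simp
  have rc : c.re = k (j + 2) := by rw [hc, Complex.ofReal_re]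
  refine ⟨⟨?_, ?_, ?_, ?_⟩, regular_of_re ?_, regular_of_re ?_⟩
  · rw [Far, le_abs]
    right
    simp only [Complex.add_re, ra, rb, rc]
    linarith
  · rw [Far, le_abs]
    right
    simp only [Complex.add_re, Complex.sub_re, ra, rb, rc]
    linarith
  · rw [Far, le_abs]
    left
    simp only [Complex.add_re, Complex.sub_re, ra, rb, rc]
    linarith
  · rw [Far, le_abs]
    right
    simp only [Complex.add_re, Complex.neg_re, ra, rb, rc]
    linarith
  · left
    rwa [ra]
  · right
    rw [rb]
    linarith

theorem generic_O_two (hk : 0 ≤ k j) {d : ℕ} (hdt : d + 1 = r) {a b c : ℂ} (ha : a = k j)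
    (hb : b = -(k 0 + k 1 + k 2 + n + 1)) (hc : c = k (j + 1)) :
    Generic d a b c ∧ Regular d a ∧ Regular d b := by
  have e1 := (odd_of_tval h.one).2
  have e2 := (odd_of_tval h.two).2
  have p2 : (1 : ℝ) ≤ t := by exact_mod_cast (odd_of_tval h.one).1.pos
  have hle : (t : ℝ) + r ≤ n := by exact_mod_cast h.le
  have ht : (d : ℝ) + 1 = r := by exact_mod_cast hdt
  have es := sum_eq k j
  have ra : a.re = k j := by rw [ha, Complex.ofReal_re]
  have rb : b.re = -(k j + k (j + 1) + k (j + 2) + n + 1) := by rw [hb, ← es]; simp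
  have rc : c.re = k (j + 1) := by rw [hc, Complex.ofReal_re]
  refine ⟨⟨?_, ?_, ?_, ?_⟩, regular_of_re ?_, regular_of_re ?_⟩
  · rw [Far, le_abs]
    right
    simp only [Complex.add_re, ra, rb, rc]
    linarith
  · rw [Far, le_abs]
    right
    simp only [Complex.add_re, Complex.sub_re, ra, rb, rc]
    linarith
  · rw [Far, le_abs]
    left
    simp only [Complex.add_re, Complex.sub_re, ra, rb, rc]
    linarith
  · rw [Far, le_abs]
    right
    simp only [Complex.add_re, Complex.neg_re, ra, rb, rc]
    linarith
  · left
    rwa [ra]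
  · right
    rw [rb]
    linarith

theorem generic_E (hk : 0 ≤ k j) {d : ℕ} (hdt : t + d + r = n) {a b c : ℂ}
    (ha : a = k (j + 2) + k j + (n + 1) / 2) (hb : b = -k j - k (j + 1) - (n + 1) / 2)
    (hc : c = (n + 1) / 2) :
    Generic d a b c ∧ Regular d a ∧ Regular d b ∧ Regular d (-b) ∧ Regular d c := by
  have e1 := (odd_of_tval h.one).2
  have e2 := (odd_of_tval h.two).2
  have p1 : (1 : ℝ) ≤ t := by exact_mod_cast (odd_of_tval h.one).1.pos
  have p2 : (1 : ℝ) ≤ r := by exact_mod_cast (odd_of_tval h.two).1.pos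
  have ht : (t : ℝ) + d + r = n := by exact_mod_cast hdt
  have hd0 : (0 : ℝ) ≤ d := d.cast_nonneg
  have ra : a.re = k (j + 2) + k j + (n + 1) / 2 := by rw [ha]; simp
  have rb : b.re = -k j - k (j + 1) - (n + 1) / 2 := by rw [hb]; simp
  have rc : c.re = (n + 1) / 2 := by rw [hc]; simp
  refine ⟨⟨?_, ?_, ?_, ?_⟩, regular_of_re ?_, regular_of_re ?_, regular_of_re ?_, regular_of_re ?_⟩
  · rw [Far, le_abs]
    left
    simp only [Complex.add_re, ra, rb, rc]
    linarith
  · rw [Far, le_abs]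
    right
    simp only [Complex.add_re, Complex.sub_re, ra, rb, rc]
    linarith
  · rw [Far, le_abs]
    left
    simp only [Complex.add_re, Complex.sub_re, ra, rb, rc]
    linarith
  · rw [Far, le_abs]
    right
    simp only [Complex.add_re, Complex.neg_re, ra, rb, rc]
    linarith
  · left
    rw [ra]
    linarith
  · right
    rw [rb]
    linarith
  · left
    rw [Complex.neg_re, rb]
    linarith
  · left
    rw [rc]
    positivity

end Reducible

end BannaiIto

namespace BannaiIto
open MvPolynomial

theorem twoCopies_congr {M V W : Type*} [AddCommGroup M] [Module BI M] [AddCommGroup V] [Module BI V]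
    [AddCommGroup W] [Module BI W] (e : Nonempty (V ≃ₗ[BI] W)) (h : TwoCopies M V) : TwoCopies M W :=
  ⟨h.some.trans (e.some.prodCongr e.some)⟩

end BannaiIto

theorem theorem8p5 (k₁ k₂ k₃ : ℝ) (n : ℕ) (hn : Odd n) :
  (∀ h : tval k₁ + tval k₃ ≤ n, (n : ℕ∞) < tval k₂ →
    TwoCopies (↥(Mx ![k₁, k₂, k₃] n 0 ⊓ Mx ![k₁, k₂, k₃] n 2))
      (Twist (BI.aut (-1, -1) (Equiv.swap 1 2)) (E (n - (tval k₁).toNat - (tval k₃).toNat) (odd_sub_tval hn h)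
        (k₁ + k₂ + (n + 1) / 2) (-k₂ - k₃ - (n + 1) / 2) ((n + 1) / 2))) ∧
    TwoCopies (↥(Mx ![k₁, k₂, k₃] n 0) ⧸ (Mx ![k₁, k₂, k₃] n 0 ⊓ Mx ![k₁, k₂, k₃] n 2).submoduleOf (Mx ![k₁, k₂, k₃] n 0))
      (Twist (BI.aut (1, 1) (Equiv.swap 1 2))
        (O ((tval k₃).toNat - 1) (even_pred_tval k₃) (k₂) (-k₁ - k₂ - k₃ - n - 1) (k₁))) ∧
    TwoCopies (monogenics ![k₁, k₂, k₃] n ⧸ Mx ![k₁, k₂, k₃] n 2)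
      (Twist (BI.aut (1, 1) (Equiv.swap 1 2))
        (O ((tval k₃).toNat - 1) (even_pred_tval k₃) (k₂) (-k₁ - k₂ - k₃ - n - 1) (k₁))) ∧
    TwoCopies (↥(Mx ![k₁, k₂, k₃] n 2) ⧸ (Mx ![k₁, k₂, k₃] n 0 ⊓ Mx ![k₁, k₂, k₃] n 2).submoduleOf (Mx ![k₁, k₂, k₃] n 2))
      (Twist (BI.aut (1, 1) c[0, 1, 2])
        (O ((tval k₁).toNat - 1) (even_pred_tval k₁) (k₂) (-k₁ - k₂ - k₃ - n - 1) (k₃))) ∧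
    TwoCopies (monogenics ![k₁, k₂, k₃] n ⧸ Mx ![k₁, k₂, k₃] n 0)
      (Twist (BI.aut (1, 1) c[0, 1, 2])
        (O ((tval k₁).toNat - 1) (even_pred_tval k₁) (k₂) (-k₁ - k₂ - k₃ - n - 1) (k₃))) ∧
    (0 ≤ k₂ →
    IsSimpleModule BI
      (Twist (BI.aut (-1, -1) (Equiv.swap 1 2)) (E (n - (tval k₁).toNat - (tval k₃).toNat) (odd_sub_tval hn h)
        (k₁ + k₂ + (n + 1) / 2) (-k₂ - k₃ - (n + 1) / 2) ((n + 1) / 2))) ∧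
    IsSimpleModule BI
      (Twist (BI.aut (1, 1) (Equiv.swap 1 2))
        (O ((tval k₃).toNat - 1) (even_pred_tval k₃) (k₂) (-k₁ - k₂ - k₃ - n - 1) (k₁))) ∧
    IsSimpleModule BI
      (Twist (BI.aut (1, 1) c[0, 1, 2])
        (O ((tval k₁).toNat - 1) (even_pred_tval k₁) (k₂) (-k₁ - k₂ - k₃ - n - 1) (k₃))) ∧
    Nonempty ((Twist (BI.aut (-1, -1) (Equiv.swap 1 2)) (E (n - (tval k₁).toNat - (tval k₃).toNat) (odd_sub_tval hn h)
        (k₁ + k₂ + (n + 1) / 2) (-k₂ - k₃ - (n + 1) / 2) ((n + 1) / 2))) ≃ₗ[BI]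
      (Twist (BI.aut (-1, 1) 1) (E (n - (tval k₁).toNat - (tval k₃).toNat) (odd_sub_tval hn h)
        (k₁ + k₂ + (n + 1) / 2) ((n + 1) / 2) (k₂ + k₃ + (n + 1) / 2)))) ∧
    Nonempty ((Twist (BI.aut (1, 1) (Equiv.swap 1 2))
        (O ((tval k₃).toNat - 1) (even_pred_tval k₃) (k₂) (-k₁ - k₂ - k₃ - n - 1) (k₁))) ≃ₗ[BI]
      (O ((tval k₃).toNat - 1) (even_pred_tval k₃) (k₂) (k₁) (-k₁ - k₂ - k₃ - n - 1))) ∧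
    Nonempty ((Twist (BI.aut (1, 1) c[0, 1, 2])
        (O ((tval k₁).toNat - 1) (even_pred_tval k₁) (k₂) (-k₁ - k₂ - k₃ - n - 1) (k₃))) ≃ₗ[BI]
      (O ((tval k₁).toNat - 1) (even_pred_tval k₁) (-k₁ - k₂ - k₃ - n - 1) (k₃) (k₂))))) ∧
  (∀ h : tval k₁ + tval k₂ ≤ n, (n : ℕ∞) < tval k₃ →
    TwoCopies (↥(Mx ![k₁, k₂, k₃] n 0 ⊓ Mx ![k₁, k₂, k₃] n 1))
      (Twist (BI.aut (-1, -1) (Equiv.swap 0 1)) (E (n - (tval k₁).toNat - (tval k₂).toNat) (odd_sub_tval hn h)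
        (k₂ + k₃ + (n + 1) / 2) (-k₁ - k₃ - (n + 1) / 2) ((n + 1) / 2))) ∧
    TwoCopies (↥(Mx ![k₁, k₂, k₃] n 1) ⧸ (Mx ![k₁, k₂, k₃] n 0 ⊓ Mx ![k₁, k₂, k₃] n 1).submoduleOf (Mx ![k₁, k₂, k₃] n 1))
      (Twist (BI.aut (1, 1) (Equiv.swap 0 1))
        (O ((tval k₁).toNat - 1) (even_pred_tval k₁) (k₃) (-k₁ - k₂ - k₃ - n - 1) (k₂))) ∧
    TwoCopies (monogenics ![k₁, k₂, k₃] n ⧸ Mx ![k₁, k₂, k₃] n 0)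
      (Twist (BI.aut (1, 1) (Equiv.swap 0 1))
        (O ((tval k₁).toNat - 1) (even_pred_tval k₁) (k₃) (-k₁ - k₂ - k₃ - n - 1) (k₂))) ∧
    TwoCopies (↥(Mx ![k₁, k₂, k₃] n 0) ⧸ (Mx ![k₁, k₂, k₃] n 0 ⊓ Mx ![k₁, k₂, k₃] n 1).submoduleOf (Mx ![k₁, k₂, k₃] n 0))
      (O ((tval k₂).toNat - 1) (even_pred_tval k₂) (k₃) (-k₁ - k₂ - k₃ - n - 1) (k₁)) ∧
    TwoCopies (monogenics ![k₁, k₂, k₃] n ⧸ Mx ![k₁, k₂, k₃] n 1)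
      (O ((tval k₂).toNat - 1) (even_pred_tval k₂) (k₃) (-k₁ - k₂ - k₃ - n - 1) (k₁)) ∧
    (0 ≤ k₃ →
    IsSimpleModule BI
      (Twist (BI.aut (-1, -1) (Equiv.swap 0 1)) (E (n - (tval k₁).toNat - (tval k₂).toNat) (odd_sub_tval hn h)
        (k₂ + k₃ + (n + 1) / 2) (-k₁ - k₃ - (n + 1) / 2) ((n + 1) / 2))) ∧
    IsSimpleModule BI
      (Twist (BI.aut (1, 1) (Equiv.swap 0 1))
        (O ((tval k₁).toNat - 1) (even_pred_tval k₁) (k₃) (-k₁ - k₂ - k₃ - n - 1) (k₂))) ∧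
    IsSimpleModule BI
      (O ((tval k₂).toNat - 1) (even_pred_tval k₂) (k₃) (-k₁ - k₂ - k₃ - n - 1) (k₁)) ∧
    Nonempty ((Twist (BI.aut (-1, -1) (Equiv.swap 0 1)) (E (n - (tval k₁).toNat - (tval k₂).toNat) (odd_sub_tval hn h)
        (k₂ + k₃ + (n + 1) / 2) (-k₁ - k₃ - (n + 1) / 2) ((n + 1) / 2))) ≃ₗ[BI]
      (Twist (BI.aut (-1, -1) 1) (E (n - (tval k₁).toNat - (tval k₂).toNat) (odd_sub_tval hn h)
        (k₁ + k₃ + (n + 1) / 2) (k₂ + k₃ + (n + 1) / 2) ((n + 1) / 2)))) ∧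
    Nonempty ((Twist (BI.aut (1, 1) (Equiv.swap 0 1))
        (O ((tval k₁).toNat - 1) (even_pred_tval k₁) (k₃) (-k₁ - k₂ - k₃ - n - 1) (k₂))) ≃ₗ[BI]
      (O ((tval k₁).toNat - 1) (even_pred_tval k₁) (-k₁ - k₂ - k₃ - n - 1) (k₃) (k₂))))) ∧
  (∀ h : tval k₂ + tval k₃ ≤ n, (n : ℕ∞) < tval k₁ →
    TwoCopies (↥(Mx ![k₁, k₂, k₃] n 1 ⊓ Mx ![k₁, k₂, k₃] n 2))
      (Twist (BI.aut (-1, -1) (Equiv.swap 0 2)) (E (n - (tval k₂).toNat - (tval k₃).toNat) (odd_sub_tval hn h)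
        (k₁ + k₃ + (n + 1) / 2) (-k₁ - k₂ - (n + 1) / 2) ((n + 1) / 2))) ∧
    TwoCopies (↥(Mx ![k₁, k₂, k₃] n 2) ⧸ (Mx ![k₁, k₂, k₃] n 1 ⊓ Mx ![k₁, k₂, k₃] n 2).submoduleOf (Mx ![k₁, k₂, k₃] n 2))
      (Twist (BI.aut (1, 1) (Equiv.swap 0 2))
        (O ((tval k₂).toNat - 1) (even_pred_tval k₂) (k₁) (-k₁ - k₂ - k₃ - n - 1) (k₃))) ∧
    TwoCopies (monogenics ![k₁, k₂, k₃] n ⧸ Mx ![k₁, k₂, k₃] n 1)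
      (Twist (BI.aut (1, 1) (Equiv.swap 0 2))
        (O ((tval k₂).toNat - 1) (even_pred_tval k₂) (k₁) (-k₁ - k₂ - k₃ - n - 1) (k₃))) ∧
    TwoCopies (↥(Mx ![k₁, k₂, k₃] n 1) ⧸ (Mx ![k₁, k₂, k₃] n 1 ⊓ Mx ![k₁, k₂, k₃] n 2).submoduleOf (Mx ![k₁, k₂, k₃] n 1))
      (Twist (BI.aut (1, 1) c[0, 2, 1])
        (O ((tval k₃).toNat - 1) (even_pred_tval k₃) (k₁) (-k₁ - k₂ - k₃ - n - 1) (k₂))) ∧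
    TwoCopies (monogenics ![k₁, k₂, k₃] n ⧸ Mx ![k₁, k₂, k₃] n 2)
      (Twist (BI.aut (1, 1) c[0, 2, 1])
        (O ((tval k₃).toNat - 1) (even_pred_tval k₃) (k₁) (-k₁ - k₂ - k₃ - n - 1) (k₂))) ∧
    (0 ≤ k₁ →
    IsSimpleModule BI
      (Twist (BI.aut (-1, -1) (Equiv.swap 0 2)) (E (n - (tval k₂).toNat - (tval k₃).toNat) (odd_sub_tval hn h)
        (k₁ + k₃ + (n + 1) / 2) (-k₁ - k₂ - (n + 1) / 2) ((n + 1) / 2))) ∧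
    IsSimpleModule BI
      (Twist (BI.aut (1, 1) (Equiv.swap 0 2))
        (O ((tval k₂).toNat - 1) (even_pred_tval k₂) (k₁) (-k₁ - k₂ - k₃ - n - 1) (k₃))) ∧
    IsSimpleModule BI
      (Twist (BI.aut (1, 1) c[0, 2, 1])
        (O ((tval k₃).toNat - 1) (even_pred_tval k₃) (k₁) (-k₁ - k₂ - k₃ - n - 1) (k₂))) ∧
    Nonempty ((Twist (BI.aut (-1, -1) (Equiv.swap 0 2)) (E (n - (tval k₂).toNat - (tval k₃).toNat) (odd_sub_tval hn h)
        (k₁ + k₃ + (n + 1) / 2) (-k₁ - k₂ - (n + 1) / 2) ((n + 1) / 2))) ≃ₗ[BI]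
      (Twist (BI.aut (1, -1) 1) (E (n - (tval k₂).toNat - (tval k₃).toNat) (odd_sub_tval hn h)
        ((n + 1) / 2) (k₁ + k₂ + (n + 1) / 2) (k₁ + k₃ + (n + 1) / 2)))) ∧
    Nonempty ((Twist (BI.aut (1, 1) (Equiv.swap 0 2))
        (O ((tval k₂).toNat - 1) (even_pred_tval k₂) (k₁) (-k₁ - k₂ - k₃ - n - 1) (k₃))) ≃ₗ[BI]
      (O ((tval k₂).toNat - 1) (even_pred_tval k₂) (k₃) (-k₁ - k₂ - k₃ - n - 1) (k₁))) ∧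
    Nonempty ((Twist (BI.aut (1, 1) c[0, 2, 1])
        (O ((tval k₃).toNat - 1) (even_pred_tval k₃) (k₁) (-k₁ - k₂ - k₃ - n - 1) (k₂))) ≃ₗ[BI]
      (O ((tval k₃).toNat - 1) (even_pred_tval k₃) (k₂) (k₁) (-k₁ - k₂ - k₃ - n - 1))))) := by
  set k : Fin 3 → ℝ := ![k₁, k₂, k₃]
  have es : (-k₁ - k₂ - k₃ - n - 1 : ℂ) = -(k 0 + k 1 + k 2 + n + 1) := by
    change _ = -((k₁ : ℂ) + k₂ + k₃ + n + 1)
    ring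
  refine ⟨fun h hlt => ?_, fun h hlt => ?_, fun h hlt => ?_⟩
  · have R : Reducible k n 1 (tval k₃).toNat (tval k₁).toNat :=
      Reducible.mk_of_le (j := 1) hn (by rw [add_comm]; exact h) hlt
    have hle := R.le
    have d1 : (tval k₃).toNat - 1 + 1 = (tval k₃).toNat := tval_pred_add_one R.one
    have d2 : (tval k₁).toNat - 1 + 1 = (tval k₁).toNat := tval_pred_add_one R.two
    have dE : (tval k₃).toNat + (n - (tval k₁).toNat - (tval k₃).toNat) + (tval k₁).toNat = n := by
      omega
    have ea : (k₁ + k₂ + (n + 1) / 2 : ℂ) = k (1 + 2) + k 1 + (n + 1) / 2 := rfl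
    have eb : (-k₂ - k₃ - (n + 1) / 2 : ℂ) = -k 1 - k (1 + 1) - (n + 1) / 2 := rfl
    refine ⟨R.twoCopies_inf (σ := Equiv.swap 1 2) rfl rfl rfl _ dE ea eb rfl (inf_comm _ _),
      R.twoCopies_inf_quot_one (σ := Equiv.swap 1 2) rfl rfl rfl (even_pred_tval k₃) d1 rfl es rfl
        (inf_comm _ _),
      R.twoCopies_quot_one (σ := Equiv.swap 1 2) rfl rfl rfl (even_pred_tval k₃) d1 rfl es rfl,
      R.twoCopies_inf_quot_two (σ := c[0, 1, 2]) rfl rfl rfl (even_pred_tval k₁) d2 rfl es rfl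
        (inf_comm _ _),
      R.twoCopies_quot_two (σ := c[0, 1, 2]) rfl rfl rfl (even_pred_tval k₁) d2 rfl es rfl,
      fun h0 => ?_⟩
    obtain ⟨gE, rEa, rEb, rEb', rEc⟩ := R.generic_E h0 dE ea eb rfl
    obtain ⟨g1, r1a, r1b⟩ := R.generic_O_one h0 d1 rfl es rfl
    obtain ⟨g2, r2a, r2b⟩ := R.generic_O_two h0 d2 rfl es rfl
    refine ⟨Twist.isSimpleModule _ (gE.isSimpleModule_E _), Twist.isSimpleModule _ (g1.isSimpleModule_O _),
      Twist.isSimpleModule _ (g2.isSimpleModule_O _), ?_,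
      nonempty_symm (equiv_O_swap_one_two g1 _ r1a),
      nonempty_symm (equiv_O_cycle g2 _ r2a r2b)⟩
    have e := equiv_E_twist_swap_one_two gE (odd_sub_tval hn h) rEa rEc
    rwa [show -(-k₂ - k₃ - (n + 1) / 2 : ℂ) = k₂ + k₃ + (n + 1) / 2 by ring] at e
  · have R : Reducible k n 2 (tval k₁).toNat (tval k₂).toNat :=
      Reducible.mk_of_le (j := 2) hn h hlt
    have hle := R.le
    have d1 : (tval k₁).toNat - 1 + 1 = (tval k₁).toNat := tval_pred_add_one R.one
    have d2 : (tval k₂).toNat - 1 + 1 = (tval k₂).toNat := tval_pred_add_one R.two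
    have dE : (tval k₁).toNat + (n - (tval k₁).toNat - (tval k₂).toNat) + (tval k₂).toNat = n := by
      omega
    have ea : (k₂ + k₃ + (n + 1) / 2 : ℂ) = k (2 + 2) + k 2 + (n + 1) / 2 := rfl
    have eb : (-k₁ - k₃ - (n + 1) / 2 : ℂ) = -k 2 - k (2 + 1) - (n + 1) / 2 := by
      change _ = -(k₃ : ℂ) - k₁ - (n + 1) / 2
      ring
    refine ⟨R.twoCopies_inf (σ := Equiv.swap 0 1) rfl rfl rfl _ dE ea eb rfl rfl,
      R.twoCopies_inf_quot_one (σ := Equiv.swap 0 1) rfl rfl rfl (even_pred_tval k₁) d1 rfl es rfl rfl,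
      R.twoCopies_quot_one (σ := Equiv.swap 0 1) rfl rfl rfl (even_pred_tval k₁) d1 rfl es rfl,
      twoCopies_congr equiv_twist_aut_one
        (R.twoCopies_inf_quot_two (σ := 1) rfl rfl rfl (even_pred_tval k₂) d2 rfl es rfl rfl),
      twoCopies_congr equiv_twist_aut_one
        (R.twoCopies_quot_two (σ := 1) rfl rfl rfl (even_pred_tval k₂) d2 rfl es rfl),
      fun h0 => ?_⟩
    obtain ⟨gE, rEa, rEb, rEb', rEc⟩ := R.generic_E h0 dE ea eb rfl
    obtain ⟨g1, r1a, r1b⟩ := R.generic_O_one h0 d1 rfl es rfl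
    obtain ⟨g2, r2a, r2b⟩ := R.generic_O_two h0 d2 rfl es rfl
    refine ⟨Twist.isSimpleModule _ (gE.isSimpleModule_E _), Twist.isSimpleModule _ (g1.isSimpleModule_O _),
      g2.isSimpleModule_O _, ?_,
      nonempty_symm (equiv_O_swap_zero_one g1 _ r1a)⟩
    have e := equiv_E_twist_swap_zero_one gE (odd_sub_tval hn h) rEa
    rwa [show -(-k₁ - k₃ - (n + 1) / 2 : ℂ) = k₁ + k₃ + (n + 1) / 2 by ring] at e
  · have R : Reducible k n 0 (tval k₂).toNat (tval k₃).toNat :=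
      Reducible.mk_of_le (j := 0) hn h hlt
    have hle := R.le
    have d1 : (tval k₂).toNat - 1 + 1 = (tval k₂).toNat := tval_pred_add_one R.one
    have d2 : (tval k₃).toNat - 1 + 1 = (tval k₃).toNat := tval_pred_add_one R.two
    have dE : (tval k₂).toNat + (n - (tval k₂).toNat - (tval k₃).toNat) + (tval k₃).toNat = n := by
      omega
    have ea : (k₁ + k₃ + (n + 1) / 2 : ℂ) = k (0 + 2) + k 0 + (n + 1) / 2 := by
      change _ = (k₃ : ℂ) + k₁ + (n + 1) / 2
      ring
    have eb : (-k₁ - k₂ - (n + 1) / 2 : ℂ) = -k 0 - k (0 + 1) - (n + 1) / 2 := rfl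
    refine ⟨R.twoCopies_inf (σ := Equiv.swap 0 2) rfl rfl rfl _ dE ea eb rfl rfl,
      R.twoCopies_inf_quot_one (σ := Equiv.swap 0 2) rfl rfl rfl (even_pred_tval k₂) d1 rfl es rfl rfl,
      R.twoCopies_quot_one (σ := Equiv.swap 0 2) rfl rfl rfl (even_pred_tval k₂) d1 rfl es rfl,
      R.twoCopies_inf_quot_two (σ := c[0, 2, 1]) rfl rfl rfl (even_pred_tval k₃) d2 rfl es rfl rfl,
      R.twoCopies_quot_two (σ := c[0, 2, 1]) rfl rfl rfl (even_pred_tval k₃) d2 rfl es rfl,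
      fun h0 => ?_⟩
    obtain ⟨gE, rEa, rEb, rEb', rEc⟩ := R.generic_E h0 dE ea eb rfl
    obtain ⟨g1, r1a, r1b⟩ := R.generic_O_one h0 d1 rfl es rfl
    obtain ⟨g2, r2a, r2b⟩ := R.generic_O_two h0 d2 rfl es rfl
    refine ⟨Twist.isSimpleModule _ (gE.isSimpleModule_E _), Twist.isSimpleModule _ (g1.isSimpleModule_O _),
      Twist.isSimpleModule _ (g2.isSimpleModule_O _), ?_,
      nonempty_symm (equiv_O_swap_zero_two g1 _ r1b),
      nonempty_symm (equiv_O_cycle_inv g2 _ r2a)⟩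
    have e := equiv_E_twist_swap_zero_two gE (odd_sub_tval hn h) rEb rEb' rEc
    rwa [show -(-k₁ - k₂ - (n + 1) / 2 : ℂ) = k₁ + k₂ + (n + 1) / 2 by ring] at e
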